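/- Notation. $\mathbb N=\{1,2,\dots\}$, scalars are real, $1<p,q<\infty$ with $1/p+1/q=1$, $(e_i)$ is the unit vector basis of $c_{00}=c_{00}(\mathbb N)$ and $(e_i^*)$ are the biorthogonal functionals. For $E,F\subset\mathbb N$, $E<F$ means $\max E<\min F$, and $n\le F$ means $n\le\min F$. The Schreier families are $S_0=\{\{n\}:n\in\mathbb N\}\cup\{\emptyset\}$ and $S_{n+1}=\{\bigcup_{i=1}^d F_i : F_i\in S_n,\ d\le F_1<\dots<F_d\}\cup\{\emptyset\}$. A finite sequence of nonzero functionals in $\mathrm{span}\{e_i^*\}$ with successive supports is $S_n$ admissible if the minima of the supports form a set in $S_n$. A set $\mathcal N\subset\mathrm{span}\{e_i^*\}$ is norming if it contains every $e_i^*$, is symmetric, is closed under restriction to intervals, and $|x^*(e_i)|\le1$ for all $x^*\in\mathcal N$ and all $i$; then $X_{\mathcal N}$ is the completion of $c_{00}$ under $\|x\|=\sup\{x^*(x):x^*\in\mathcal N\}$. Let $M=(m_i)_{i\ge1}$ and $N=(n_i)_{i\ge1}$ be strictly increasing sequences of positive integers with (i) $m_1>3$, $m_2=m_1^5$, $m_{2j+1}=m_{2j}^5$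 for $j\ge1$, and $m_{2j}=\prod_{i=1}^{j-1}m_{2i}^{s_i}$ for $j\ge2$, for some strictly increasing sequence $(s_i)_{i\ge1}$ of positive integers; (ii) $5n_1<n_2$ and $4f_j<n_{2j}$ for $j\ge2$, where $f_j=\max\{\rho n_1+\sum_{1\le i<j}\rho_i n_{2i} : \rho,\rho_i\in\mathbb N\cup\{0\},\ m_1^{\rho}\prod_{1\le i<j}m_{2i}^{\rho_i}<m_{2j}\}$. For a norming set $\mathcal N$ and $k\ge1$ let $\mathcal N_k$ be the set of all $\frac1{m_{2k}}\sum_i\gamma_i x_i^*$ with $\gamma_i\in\mathbb Q$, $\|(\gamma_i)\|_q\le1$ and $(x_i^*)_i\subset\mathcal N$ an $S_{n_{2k}}$ admissible finite sequence. Let $\mathcal N_\infty^q$ be the set of all $\frac1{m_{2k+1}}\sum_i\gamma_i\,Ex_i^*$ with $k\ge0$, $\gamma_i\in\mathbb Q$, $\|(\gamma_i)\|_q\le2^{1/p}$, $E$ an interval (and $Ex_i^*$ the restriction of $x_i^*$ to $E$) and $(x_i^*)_i$ an $S_{n_{2k+1}}$ admissible finite sequence such that $x_i^*\in\mathcal N_{j_i}$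 for pairwise different indices $j_i\ge1$. The norming set $\mathcal N$ is $(M,N,q)$-Schreier if $\mathcal N_k\subset\mathcal N$ for all $k\ge1$ and $\mathcal N\subset\bigcup_{k\ge1}\mathcal N_k\cup\mathcal N_\infty^q\cup\{\pm e_i^*:i\in\mathbb N\}$. **Theorem 3.1.** Let $\mathcal N$ be an $(M,N,q)$-Schreier norming set. Then there is an infinite sequence $(y_i^*)_{i\ge1}$ of nonzero functionals in $\mathcal N$ with successive supports (regarded as elements of $X_{\mathcal N}^*$) such that the following hold. 1. The formula $Tx=\lim_{n\to\infty}\sum_{i=1}^n y_i^*(x)e_i$ (norm limit, for $x\in X_{\mathcal N}$) defines a bounded operator $T$ on $X_{\mathcal N}$ that is not of the form $\lambda I+K$ with $\lambda$ a scalar and $K$ compact. 2. If $X_{\mathcal N}$ is hereditarily indecomposable (no closed subspace is the direct sum of two closed infinite-dimensional subspaces), then $T$ is strictly singular (its restriction to any infinite-dimensional subspace is not an isomorphism onto its image). 3. $\ell_\infty$ embeds isomorphically into the space $\mathcal L(X_{\mathcal N})$ of bounded operators (with the operator norm) by the map $$(a_i)_{i\ge1}\ \longmapsto\ \mathrm{SOT}\text{-}\lim_{n\to\infty}\sum_{i=1}^n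 a_i\,y_i^*\otimes e_i .$$ -/

import Mathlib

noncomputable section

namespace SchreierSpace

/-- The Schreier families `S_n` of finite subsets of `{1, 2, 3, …}`. -/
def schreier : ℕ → Set (Finset ℕ+)
  | 0 => {F | F = ∅ ∨ ∃ a : ℕ+, F = {a}}
  | n + 1 => {F | F = ∅ ∨ ∃ (d : ℕ) (G : Fin d → Finset ℕ+),
      (∀ i, G i ∈ schreier n) ∧
      (∀ i, ∀ a ∈ G i, d ≤ (a : ℕ)) ∧
      (∀ i j, i < j → ∀ a ∈ G i, ∀ b ∈ G j, a < b) ∧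
      F = Finset.univ.biUnion G}

/-- Finitely supported real sequences indexed by `{1, 2, 3, …}`. Both the vectors of `c₀₀` and
the elements of the span of the biorthogonal functionals are such sequences. -/
abbrev FinSeq : Type := ℕ+ →₀ ℝ

/-- The value `x(a) = ∑ xᵢ aᵢ` of a functional `x` at a vector `a`. -/
def pairing (x a : FinSeq) : ℝ := a.sum fun i c => x i * c

/-- The restriction of `x` to the coordinates in the interval `{a, …, b}`
(which is empty if `b < a`). -/
def restrict (a b : ℕ+) (x : FinSeq) : FinSeq := x.filter fun i => a ≤ i ∧ i ≤ b

/-- The finite sequence `x` is a block sequence (its terms are nonzero and their supports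
successive). -/
def IsBlock {ι : Type} [LT ι] (x : ι → FinSeq) : Prop :=
  (∀ i, x i ≠ 0) ∧ ∀ i j, i < j → ∀ a ∈ (x i).support, ∀ b ∈ (x j).support, a < b

/-- `x` is a block sequence and the minima of the supports of its terms form a set in `S_n`. -/
def IsAdmissible (n : ℕ) {d : ℕ} (x : Fin d → FinSeq) : Prop :=
  IsBlock x ∧ ∃ k : Fin d → ℕ+, (∀ i, IsLeast (↑(x i).support : Set ℕ+) (k i)) ∧
    Finset.univ.image k ∈ schreier n

/-- Norming sets. -/
structure NormingSet where
  carrier : Set FinSeq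
  single_mem : ∀ i : ℕ+, Finsupp.single i (1 : ℝ) ∈ carrier
  abs_apply_le : ∀ x ∈ carrier, ∀ i : ℕ+, |x i| ≤ 1
  neg_mem : ∀ x ∈ carrier, -x ∈ carrier
  restrict_mem : ∀ x ∈ carrier, ∀ a b : ℕ+, restrict a b x ∈ carrier

/-! ### The Banach space of a norming set -/

/-- `c₀₀`, to be equipped with the norm given by the norming set `𝒩`. -/
def C00 (_ : NormingSet) : Type := FinSeq

namespace C00

variable (𝒩 : NormingSet)

instance : AddCommGroup (C00 𝒩) := inferInstanceAs (AddCommGroup FinSeq)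
instance : Module ℝ (C00 𝒩) := inferInstanceAs (Module ℝ FinSeq)

/-- A finitely supported sequence, viewed as a vector of `C00 𝒩`. -/
def of (a : FinSeq) : C00 𝒩 := a

variable {𝒩} in
/-- The coordinates of a vector of `C00 𝒩`. -/
def coords (a : C00 𝒩) : FinSeq := a

/-- The norm `‖a‖ = sup {x(a) : x ∈ 𝒩}`. -/
instance : Norm (C00 𝒩) := ⟨fun a => ⨆ x : 𝒩.carrier, pairing x.1 (coords a)⟩

end C00

theorem pairing_add (x a b : FinSeq) : pairing x (a + b) = pairing x a + pairing x b :=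
  Finsupp.sum_add_index' (by simp) (by intros; ring)

theorem pairing_smul (x a : FinSeq) (c : ℝ) : pairing x (c • a) = c * pairing x a := by
  unfold pairing
  rw [Finsupp.sum_smul_index (by simp), Finsupp.mul_sum]
  exact Finsupp.sum_congr fun i _ => by ring

theorem pairing_neg_left (x a : FinSeq) : pairing (-x) a = -pairing x a := by
  simp [pairing, Finsupp.sum]

theorem pairing_single_left (i : ℕ+) (a : FinSeq) :
    pairing (Finsupp.single i 1) a = a i := by
  classical
  simp only [pairing, Finsupp.sum, Finsupp.single_apply, ite_mul, one_mul, zero_mul]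
  rw [Finset.sum_ite_eq]
  split_ifs with h
  · rfl
  · simpa using (Finsupp.notMem_support_iff.mp h).symm

namespace C00

variable (𝒩 : NormingSet)

theorem bddAbove (a : FinSeq) :
    BddAbove (Set.range fun x : 𝒩.carrier => pairing x.1 a) := by
  refine ⟨∑ i ∈ a.support, |a i|, ?_⟩
  rintro _ ⟨x, rfl⟩
  refine Finset.sum_le_sum fun i _ => ?_
  calc x.1 i * a i ≤ |x.1 i * a i| := le_abs_self _
    _ = |x.1 i| * |a i| := abs_mul _ _
    _ ≤ 1 * |a i| := by gcongr; exact 𝒩.abs_apply_le x.1 x.2 i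
    _ = |a i| := one_mul _

theorem pairing_le (a : C00 𝒩) {x : FinSeq} (hx : x ∈ 𝒩.carrier) : pairing x (coords a) ≤ ‖a‖ :=
  le_ciSup (bddAbove 𝒩 (coords a)) ⟨x, hx⟩

theorem abs_pairing_le (a : C00 𝒩) {x : FinSeq} (hx : x ∈ 𝒩.carrier) :
    |pairing x (coords a)| ≤ ‖a‖ := by
  refine abs_le'.mpr ⟨pairing_le 𝒩 a hx, ?_⟩
  rw [← pairing_neg_left]
  exact pairing_le 𝒩 a (𝒩.neg_mem x hx)

theorem norm_le (a : C00 𝒩) {r : ℝ} (h : ∀ x ∈ 𝒩.carrier, pairing x (coords a) ≤ r) : ‖a‖ ≤ r :=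
  haveI : Nonempty 𝒩.carrier := ⟨⟨_, 𝒩.single_mem 1⟩⟩
  ciSup_le fun x => h x.1 x.2

theorem nonneg (a : C00 𝒩) : 0 ≤ ‖a‖ :=
  (abs_nonneg _).trans (abs_pairing_le 𝒩 a (𝒩.single_mem 1))

theorem norm_smul_le' (c : ℝ) (a : C00 𝒩) : ‖c • a‖ ≤ |c| * ‖a‖ := by
  refine norm_le 𝒩 _ fun x hx => ?_
  calc pairing x (coords (c • a)) = c * pairing x (coords a) := pairing_smul x (coords a) c
    _ ≤ |c * pairing x (coords a)| := le_abs_self _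
    _ = |c| * |pairing x (coords a)| := abs_mul _ _
    _ ≤ |c| * ‖a‖ := by gcongr; exact abs_pairing_le 𝒩 a hx

theorem core : NormedSpace.Core ℝ (C00 𝒩) where
  norm_nonneg := nonneg 𝒩
  norm_smul c a := by
    refine le_antisymm (norm_smul_le' 𝒩 c a) ?_
    rcases eq_or_ne c 0 with rfl | hc
    · simpa using nonneg 𝒩 _
    · have h := norm_smul_le' 𝒩 c⁻¹ (c • a)
      rw [smul_smul, inv_mul_cancel₀ hc, one_smul, abs_inv] at h
      have hc' : 0 < |c| := abs_pos.mpr hc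
      rw [Real.norm_eq_abs]
      calc |c| * ‖a‖ ≤ |c| * (|c|⁻¹ * ‖c • a‖) := by gcongr
        _ = ‖c • a‖ := by field_simp
  norm_triangle a b := by
    refine norm_le 𝒩 _ fun x hx => ?_
    calc pairing x (coords (a + b)) = pairing x (coords a) + pairing x (coords b) :=
          pairing_add x (coords a) (coords b)
      _ ≤ ‖a‖ + ‖b‖ := add_le_add (pairing_le 𝒩 a hx) (pairing_le 𝒩 b hx)
  norm_eq_zero_iff a := by
    constructor
    · intro h
      refine Finsupp.ext (M := ℝ) fun i => ?_
      have h1 := abs_pairing_le 𝒩 a (𝒩.single_mem i)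
      rw [h, pairing_single_left] at h1
      exact abs_nonpos_iff.mp h1
    · rintro rfl
      exact le_antisymm (norm_le 𝒩 _ fun x _ => (Finsupp.sum_zero_index (α := ℕ+) (M := ℝ)).le)
        (nonneg 𝒩 _)

instance : NormedAddCommGroup (C00 𝒩) := NormedAddCommGroup.ofCore (core 𝒩)
instance : NormedSpace ℝ (C00 𝒩) := NormedSpace.ofCore (core 𝒩)

end C00

/-- The Banach space `X_𝒩`: the completion of `c₀₀` in the norm given by `𝒩`. -/
abbrev X (𝒩 : NormingSet) : Type := UniformSpace.Completion (C00 𝒩)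

/-- The unit vector basis `(e_i)` of `X_𝒩`. -/
def basisVec (𝒩 : NormingSet) (i : ℕ+) : X 𝒩 :=
  ((C00.of 𝒩 (Finsupp.single i 1) : C00 𝒩) : X 𝒩)

/-! ### The sequences `M`, `N` and `(M, N, q)`-Schreier norming sets

The sequences are indexed by `1, 2, 3, …`; the terms with index `0` are never used. -/

/-- The set of the integers `ρ n₁ + ∑_{1 ≤ i < j} ρᵢ n_{2i}` over the nonnegative integers
`ρ, ρᵢ` with `m₁^ρ ∏_{1 ≤ i < j} m_{2i}^{ρᵢ} < m_{2j}`; its maximum is `f_j`. -/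
def fSet (m n : ℕ → ℕ) (j : ℕ) : Set ℕ :=
  {t | ∃ (r : ℕ) (ρ : ℕ → ℕ),
    m 1 ^ r * ∏ i ∈ Finset.Ico 1 j, m (2 * i) ^ ρ i < m (2 * j) ∧
    t = r * n 1 + ∑ i ∈ Finset.Ico 1 j, ρ i * n (2 * i)}

/-- The conditions (i) and (ii) on the increasing sequences `M = (m_i)`, `N = (n_i)` of positive
integers. -/
structure Conditions (m n : ℕ → ℕ) : Prop where
  m_strictMono : StrictMonoOn m (Set.Ici 1)
  n_strictMono : StrictMonoOn n (Set.Ici 1)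
  n_pos : 0 < n 1
  three_lt : 3 < m 1
  m_two : m 2 = m 1 ^ 5
  m_odd : ∀ j, 1 ≤ j → m (2 * j + 1) = m (2 * j) ^ 5
  m_even : ∃ s : ℕ → ℕ, StrictMonoOn s (Set.Ici 1) ∧ 0 < s 1 ∧
    ∀ j, 2 ≤ j → m (2 * j) = ∏ i ∈ Finset.Ico 1 j, m (2 * i) ^ s i
  n_two : 5 * n 1 < n 2
  n_even : ∀ j, 2 ≤ j → ∃ f, IsGreatest (fSet m n j) f ∧ 4 * f < n (2 * j)

/-- The `ℓ_q` norm of a finite sequence of rational numbers. -/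
def lqNorm (q : ℝ) {d : ℕ} (γ : Fin d → ℚ) : ℝ := (∑ i, |(γ i : ℝ)| ^ q) ^ (1 / q)

/-- The set `𝒩_k`, `k ≥ 1`. -/
def evenPart (m n : ℕ → ℕ) (q : ℝ) (𝒩 : Set FinSeq) (k : ℕ) : Set FinSeq :=
  {z | ∃ (d : ℕ) (γ : Fin d → ℚ) (x : Fin d → FinSeq),
    lqNorm q γ ≤ 1 ∧ IsAdmissible (n (2 * k)) x ∧ (∀ i, x i ∈ 𝒩) ∧
    z = (1 / (m (2 * k) : ℝ)) • ∑ i, (γ i : ℝ) • x i}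

/-- The set `𝒩_∞^q`: the functionals `m_{2k+1}⁻¹ ∑ γᵢ E xᵢ` with `‖γ‖_q ≤ 2^{1/p}`, where `E` is an
interval and `(xᵢ)` is `S_{n_{2k+1}}` admissible with the `xᵢ` in sets `𝒩_{jᵢ}` of pairwise
different indices `jᵢ ≥ 1` (the functionals `xᵢ` have pairwise different weights `m_{2jᵢ}`). -/
def oddPart (m n : ℕ → ℕ) (p q : ℝ) (𝒩 : Set FinSeq) : Set FinSeq :=
  {z | ∃ (k d : ℕ) (γ : Fin d → ℚ) (a b : ℕ+) (x : Fin d → FinSeq) (j : Fin d → ℕ),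
    lqNorm q γ ≤ 2 ^ (1 / p) ∧ IsAdmissible (n (2 * k + 1)) x ∧
    Function.Injective j ∧ (∀ i, 1 ≤ j i ∧ x i ∈ evenPart m n q 𝒩 (j i)) ∧
    z = (1 / (m (2 * k + 1) : ℝ)) • ∑ i, (γ i : ℝ) • restrict a b (x i)}

/-- The norming set `𝒩` is `(M, N, q)`-Schreier; here `1/p + 1/q = 1`. -/
def IsSchreierNorming (m n : ℕ → ℕ) (p q : ℝ) (𝒩 : NormingSet) : Prop :=
  (∀ k, 1 ≤ k → evenPart m n q 𝒩.carrier k ⊆ 𝒩.carrier) ∧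
  ∀ x ∈ 𝒩.carrier,
    (∃ k, 1 ≤ k ∧ x ∈ evenPart m n q 𝒩.carrier k) ∨
    x ∈ oddPart m n p q 𝒩.carrier ∨
    ∃ i : ℕ+, x = Finsupp.single i 1 ∨ x = -Finsupp.single i 1

/-! ### Notions about Banach spaces and operators -/

section Banach

variable (E : Type) [NormedAddCommGroup E] [NormedSpace ℝ E]

/-- `E` is hereditarily indecomposable: no closed subspace `W` of `E` is the direct sum of two
closed infinite-dimensional subspaces `Y` and `Z`. -/
def IsHI : Prop :=
  ∀ W Y Z : Submodule ℝ E, IsClosed (W : Set E) → IsClosed (Y : Set E) → IsClosed (Z : Set E) →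
    ¬ FiniteDimensional ℝ Y → ¬ FiniteDimensional ℝ Z → Disjoint Y Z → Y ⊔ Z ≠ W

variable {E}

/-- `T` is strictly singular: it is not an isomorphism onto its image on any infinite-dimensional
subspace. -/
def IsStrictlySingular (T : E →L[ℝ] E) : Prop :=
  ∀ Y : Submodule ℝ E, ¬ FiniteDimensional ℝ Y → ¬ ∃ c : ℝ, 0 < c ∧ ∀ y ∈ Y, c * ‖y‖ ≤ ‖T y‖

/-- `T` is a compact perturbation of a multiple of the identity. -/
def IsScalarPlusCompact (T : E →L[ℝ] E) : Prop :=
  ∃ (c : ℝ) (K : E →L[ℝ] E), IsCompactOperator K ∧ T = c • ContinuousLinearMap.id ℝ E + K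

end Banach

end SchreierSpace

end

namespace SchreierSpace

/-! ### Schreier families -/

/-! The operator is built from functionals `y_i = m_{2(i+1)}⁻¹ ∑_{l ∈ A_i} γ_i(l) e_l^*` on
successive sets `A_i ∈ S_{f_{i+1}+1}`, with infinitely many coordinates left outside all blocks. Two
estimates carry the proof. Both rest on an analysis of an arbitrary `x ∈ 𝒩` (`exists_isAnalysis`):
`Q l` is the product of the weights on the branch of a tree for `x` that leads to the coordinate
`l`, an odd weight being counted as `m₁/2` so that the factor `2^{1/p} ≤ 2` is absorbed, and `∑
(|x_l| Q_l)^q ≤ 1`. An even weight `m_{2k}` costs `n_{2k}` Schreier levels, and `f_j` bounds the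
cost of the products of `m₁, m₂, m₄, …, m_{2(j-1)}` below `m_{2j}`; hence `{Q < m_{2j}}` is small.
The children of an odd node have different even weights, so fewer than `j` of them matter below
`m_{2j}`. They are paid for either by one Schreier level, which puts the part of the set beyond `j`
into `S_{2f_j+1}`, or by splitting the set into a controlled number of colour classes, each in
`S_{f_j}`.

Lower estimate (`exists_block`): `A_i` carries a probability measure `μ` that is tiny on all sets of
`S_{f_{i+1}}`. By the colouring and Hölder's inequality, `∑ μ_l^{1/p} e_l` has norm at most
`2/m_{2(i+1)}`. As `γ_i` is close to `μ^{1/q}`, this gives vectors `u_i` in the unit ball with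
`y_i(u_i) ≥ 1/4`, on which the other `y_k` vanish.

Upper estimate (`IsBlockSystem.sum_le`): the unit vectors `e_i` dominate the `y_i`. Since
`m_{2(i+1)}` is `m_{2j}` times a product of even weights, each `y_i` with `i ≥ j` can be rewritten
as a functional of weight `m_{2j}`. The rewriting leaves enough levels for `∑_{i ∈ F} β_i y_i` to
belong to `𝒩` whenever `F ∈ S_{2f_j+1}`, `j ≤ F` and `‖β‖_q ≤ 1` (`IsBlockSystem.sum_mem`). Cutting
`x` according to the size of `Q` and summing a geometric series gives `‖∑ a_i y_i(v) e_i‖ ≤ 6 ‖a‖_∞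
‖v‖`.

The upper estimate defines the operators, and the `u_i` show that `ℓ_∞` embeds. The operator `T`
kills the unit vectors outside the blocks but sends `u_i` to a large multiple of `e_i`, so it is not
scalar plus compact. Its kernel is infinite-dimensional, which on a hereditarily indecomposable
space forces strict singularity. -/

theorem sum_biUnion_le {ι α : Type*} [DecidableEq α] (s : Finset ι) (t : ι → Finset α) (f : α → ℝ)
    (hf : ∀ i, ∀ a ∈ t i, 0 ≤ f a) : ∑ a ∈ s.biUnion t, f a ≤ ∑ i ∈ s, ∑ a ∈ t i, f a := by
  classical
  induction s using Finset.induction_on with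
  | empty => simp
  | insert i s hi ih =>
    rw [Finset.biUnion_insert, Finset.sum_insert hi]
    have h := Finset.sum_union_inter (s₁ := t i) (s₂ := s.biUnion t) (f := f)
    have : 0 ≤ ∑ a ∈ t i ∩ s.biUnion t, f a :=
      Finset.sum_nonneg fun a ha => hf i a (Finset.mem_inter.1 ha).1
    linarith

/-- Serves to define a function on a union of disjoint supports from its values on the pieces. -/
theorem exists_glue {ι α β : Type*} [Nonempty β] (s : ι → Set α) (g : ι → α → β)
    (h : ∀ i j l, l ∈ s i → l ∈ s j → i = j) : ∃ f : α → β, ∀ i, ∀ l ∈ s i, f l = g i l := by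
  classical
  refine ⟨fun l => if h : ∃ i, l ∈ s i then g h.choose l else Classical.arbitrary β,
    fun i l hl => ?_⟩
  have hex : ∃ i, l ∈ s i := ⟨i, hl⟩
  simp only [hex, ↓reduceDIte]
  rw [h _ _ _ hex.choose_spec hl]

theorem empty_mem_schreier (n : ℕ) : ∅ ∈ schreier n := by
  cases n <;> exact Or.inl rfl

/-- Induction on `n`. The condition `d ≤ F₁` at the top of `K` passes to the union because `V k`
lies to the right of `k`. -/
theorem schreier_biUnion_mem {n m : ℕ} {K : Finset ℕ+} (hK : K ∈ schreier n)
    (V : ℕ+ → Finset ℕ+) (hV : ∀ k ∈ K, V k ∈ schreier m) (hle : ∀ k ∈ K, ∀ a ∈ V k, k ≤ a)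
    (hlt : ∀ k ∈ K, ∀ k' ∈ K, k < k' → ∀ a ∈ V k, ∀ b ∈ V k', a < b) :
    K.biUnion V ∈ schreier (n + m) := by
  classical
  induction n generalizing K with
  | zero =>
    rcases hK with rfl | ⟨a, rfl⟩
    · simpa using empty_mem_schreier _
    · simpa using hV a (by simp)
  | succ n ih =>
    rcases hK with rfl | ⟨d, G, hG, hd, hs, rfl⟩
    · simpa using empty_mem_schreier _
    · rw [Nat.add_right_comm]
      refine Or.inr ⟨d, fun i => (G i).biUnion V, fun i => ?_, ?_, ?_, ?_⟩
      · have hsub : ∀ k ∈ G i, k ∈ Finset.univ.biUnion G := fun k hk =>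
          Finset.mem_biUnion.2 ⟨i, Finset.mem_univ _, hk⟩
        exact ih (hG i) (fun k hk => hV k (hsub k hk)) (fun k hk => hle k (hsub k hk))
          fun k hk k' hk' => hlt k (hsub k hk) k' (hsub k' hk')
      · intro i a ha
        obtain ⟨k, hk, ha⟩ := Finset.mem_biUnion.1 ha
        exact (hd i k hk).trans (PNat.coe_le_coe _ _ |>.2
          (hle k (Finset.mem_biUnion.2 ⟨i, Finset.mem_univ _, hk⟩) a ha))
      · intro i j hij a ha b hb
        obtain ⟨k, hk, ha⟩ := Finset.mem_biUnion.1 ha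
        obtain ⟨k', hk', hb⟩ := Finset.mem_biUnion.1 hb
        exact hlt k (Finset.mem_biUnion.2 ⟨i, Finset.mem_univ _, hk⟩) k'
          (Finset.mem_biUnion.2 ⟨j, Finset.mem_univ _, hk'⟩) (hs i j hij k hk k' hk') a ha b hb
      · ext a
        simp only [Finset.mem_biUnion, Finset.mem_univ, true_and]
        tauto

theorem schreier_hereditary {n : ℕ} {F G : Finset ℕ+} (hF : F ∈ schreier n) (h : G ⊆ F) :
    G ∈ schreier n := by
  classical
  -- Each point is replaced by itself or by the empty set.
  have := schreier_biUnion_mem (m := 0) hF (fun k => if k ∈ G then {k} else ∅)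
    (fun k _ => by split_ifs; exacts [Or.inr ⟨k, rfl⟩, Or.inl rfl])
    (fun k _ a ha => by split_ifs at ha <;> simp_all)
    (fun k _ k' _ hkk a ha b hb => by split_ifs at ha hb <;> simp_all)
  rw [Nat.add_zero] at this
  convert this using 1
  ext a
  simp only [Finset.mem_biUnion]
  constructor
  · exact fun ha => ⟨a, h ha, by simp [ha]⟩
  · rintro ⟨k, _, hk⟩
    split_ifs at hk <;> simp_all

theorem schreier_mono {n m : ℕ} (h : n ≤ m) : schreier n ⊆ schreier m := by
  induction h with
  | refl => exact subset_rfl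
  | step _ ih =>
    intro F hF
    exact Or.inr ⟨1, fun _ => F, fun _ => ih hF, fun _ a _ => a.2,
      fun i j hij => absurd hij (by simp [Subsingleton.elim i j]), by ext; simp⟩

theorem singleton_mem_schreier (n : ℕ) (a : ℕ+) : {a} ∈ schreier n :=
  schreier_mono (Nat.zero_le n) (Or.inr ⟨a, rfl⟩)

/-- Unions of sets in `S_m` indexed by a set in `S_n`, in terms of a parametrisation. -/
theorem schreier_biUnion_mem_of_strictMono {n m d : ℕ} {k : Fin d → ℕ+} (hk : StrictMono k)
    (hK : Finset.univ.image k ∈ schreier n) (V : Fin d → Finset ℕ+)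
    (hV : ∀ i, V i ∈ schreier m) (hle : ∀ i, ∀ a ∈ V i, k i ≤ a)
    (hlt : ∀ i j, i < j → ∀ a ∈ V i, ∀ b ∈ V j, a < b) :
    Finset.univ.biUnion V ∈ schreier (n + m) := by
  classical
  obtain ⟨W, hW⟩ := exists_glue (fun i => ({k i} : Set ℕ+)) (fun i _ => V i)
    (fun i j l hi hj => hk.injective (by simp_all))
  have hW' : ∀ i, W (k i) = V i := fun i => hW i _ rfl
  have := schreier_biUnion_mem (m := m) hK W
    (by simpa [hW'] using hV) (by simpa [hW'] using hle)
    (by simpa [hW', hk.lt_iff_lt] using hlt)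
  convert this using 1
  ext a
  simp [hW']

/-- `S_{n+m}` consists of the unions of sets in `S_m` whose minima form a set in `S_n`. -/
theorem exists_schreier_split {n m : ℕ} {F : Finset ℕ+} (hF : F ∈ schreier (n + m)) :
    ∃ (K : Finset ℕ+) (V : ℕ+ → Finset ℕ+), K ∈ schreier n ∧ (∀ k ∈ K, V k ∈ schreier m) ∧
      (∀ k ∈ K, k ∈ V k) ∧ (∀ k ∈ K, ∀ a ∈ V k, k ≤ a) ∧
      (∀ k ∈ K, ∀ k' ∈ K, k < k' → ∀ a ∈ V k, ∀ b ∈ V k', a < b) ∧ F = K.biUnion V := by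
  classical
  induction n generalizing F with
  | zero =>
    rcases F.eq_empty_or_nonempty with rfl | hne
    · exact ⟨∅, fun _ => ∅, by simp [empty_mem_schreier]⟩
    · refine ⟨{F.min' hne}, fun _ => F, singleton_mem_schreier _ _, ?_, ?_, ?_, ?_, ?_⟩
      · simpa using hF
      · simpa using F.min'_mem hne
      · simpa using fun a ha => F.min'_le a ha
      · simp only [Finset.mem_singleton, forall_eq, lt_irrefl, false_implies]
      · simp
  | succ n ih =>
    rw [Nat.add_right_comm] at hF
    rcases hF with rfl | ⟨d, G, hG, hd, hs, rfl⟩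
    · exact ⟨∅, fun _ => ∅, by simp [empty_mem_schreier]⟩
    · choose K V hK hV hmem hle hlt hGV using fun i => ih (hG i)
      have hKG : ∀ i, ∀ k ∈ K i, ∀ a ∈ V i k, a ∈ G i := fun i k hk a ha => by
        rw [hGV i]; exact Finset.mem_biUnion.2 ⟨k, hk, ha⟩
      have hKG' : ∀ i, ∀ k ∈ K i, k ∈ G i := fun i k hk => hKG i k hk k (hmem i k hk)
      have hord : ∀ i j, ∀ a ∈ G i, ∀ b ∈ G j, a ≤ b → i ≤ j := fun i j a ha b hb hab => by
        by_contra! h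
        exact absurd (hs j i h b hb a ha) (not_lt.2 hab)
      obtain ⟨W, hW⟩ := exists_glue (fun i => (K i : Set ℕ+)) V (fun i j l hi hj =>
        le_antisymm (hord i j l (hKG' i l hi) l (hKG' j l hj) le_rfl)
          (hord j i l (hKG' j l hj) l (hKG' i l hi) le_rfl))
      refine ⟨Finset.univ.biUnion K, W, Or.inr ⟨d, K, hK, fun i a ha => hd i a (hKG' i a ha),
        fun i j hij a ha b hb => hs i j hij a (hKG' i a ha) b (hKG' j b hb), rfl⟩, ?_, ?_, ?_, ?_, ?_⟩
      · intro k hk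
        obtain ⟨i, -, hk⟩ := Finset.mem_biUnion.1 hk
        rw [hW i k hk]; exact hV i k hk
      · intro k hk
        obtain ⟨i, -, hk⟩ := Finset.mem_biUnion.1 hk
        rw [hW i k hk]; exact hmem i k hk
      · intro k hk
        obtain ⟨i, -, hk⟩ := Finset.mem_biUnion.1 hk
        rw [hW i k hk]; exact hle i k hk
      · intro k hk k' hk' hkk
        obtain ⟨i, -, hk⟩ := Finset.mem_biUnion.1 hk
        obtain ⟨j, -, hk'⟩ := Finset.mem_biUnion.1 hk'
        rw [hW i k hk, hW j k' hk']
        rcases (hord i j k (hKG' i k hk) k' (hKG' j k' hk') hkk.le).eq_or_lt with rfl | hij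
        · exact hlt i k hk k' hk' hkk
        · exact fun a ha b hb => hs i j hij a (hKG i k hk a ha) b (hKG j k' hk' b hb)
      · ext a
        simp only [Finset.mem_biUnion, Finset.mem_univ, true_and]
        constructor
        · rintro ⟨i, ha⟩
          rw [hGV i] at ha
          obtain ⟨k, hk, ha⟩ := Finset.mem_biUnion.1 ha
          exact ⟨k, ⟨i, hk⟩, by rwa [hW i k hk]⟩
        · rintro ⟨k, ⟨i, hk⟩, ha⟩
          rw [hW i k hk] at ha
          exact ⟨i, hKG i k hk a ha⟩

/-- The minima of successive sets dominating a set in `S_n` form a set in `S_n`. -/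
theorem schreier_image_mem {n : ℕ} {K : Finset ℕ+} (hK : K ∈ schreier n) (φ : ℕ+ → ℕ+)
    (hle : ∀ k ∈ K, k ≤ φ k) (hlt : ∀ k ∈ K, ∀ k' ∈ K, k < k' → φ k < φ k') :
    K.image φ ∈ schreier n := by
  classical
  have := schreier_biUnion_mem (m := 0) hK (fun k => {φ k})
    (fun k _ => singleton_mem_schreier _ _) (by simpa using hle) (by simpa using hlt)
  rwa [Finset.biUnion_singleton] at this

/-! ### Averages that are small on the sets of `S_n` -/

/-- A probability measure `μ` with support `A ∈ S_{n+1}` giving mass at most `ε` to the sets in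
`S_n`. -/
structure IsAverage (n : ℕ) (ε : ℝ) (A : Finset ℕ+) (μ : ℕ+ → ℝ) : Prop where
  mem : A ∈ schreier (n + 1)
  pos : ∀ l ∈ A, 0 < μ l
  sum_eq : ∑ l ∈ A, μ l = 1
  small : ∀ G ∈ schreier n, ∑ l ∈ A with l ∈ G, μ l ≤ ε

theorem exists_isAverage_zero {ε : ℝ} (hε : 0 < ε) (N : ℕ) :
    ∃ A μ, IsAverage 0 ε A μ ∧ ∀ l ∈ A, N ≤ (l : ℕ) := by
  classical
  obtain ⟨k, hk⟩ := exists_nat_gt (max (N : ℝ) (1 / ε))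
  have hkN : N < k := by exact_mod_cast (le_max_left _ _).trans_lt hk
  have hkε : 1 / ε < k := (le_max_right _ _).trans_lt hk
  have hk0 : 0 < k := by omega
  have hkr : (0 : ℝ) < k := by exact_mod_cast hk0
  have hke : 1 / (k : ℝ) ≤ ε := by
    rw [div_le_iff₀ hkr]
    rw [div_lt_iff₀ hε] at hkε
    linarith [mul_comm (k : ℝ) ε]
  -- The uniform measure on `{k, …, 2k-1}`.
  let g : Fin k → ℕ+ := fun i => ⟨k + i, by omega⟩
  have hg : StrictMono g := fun i j hij => by
    change (k + i : ℕ) < k + j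
    exact Nat.add_lt_add_left hij k
  have hcard : (Finset.univ.image g).card = k := by
    rw [Finset.card_image_of_injective _ hg.injective]; simp
  refine ⟨Finset.univ.image g, fun _ => 1 / k, ⟨?_, ?_, ?_, ?_⟩, ?_⟩
  · refine Or.inr ⟨k, fun i => {g i}, fun i => singleton_mem_schreier _ _, ?_, ?_, ?_⟩
    · intro i a ha
      obtain rfl := Finset.mem_singleton.1 ha
      exact Nat.le_add_right k i
    · intro i j hij
      simpa using hg hij
    · rw [Finset.biUnion_singleton]
  · intros; positivity
  · rw [Finset.sum_const, hcard]; simp; field_simp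
  · intro G hG
    refine le_trans ?_ hke
    rw [Finset.sum_const, nsmul_eq_mul]
    refine mul_le_of_le_one_left (by positivity) ?_
    have : (Finset.filter (· ∈ G) (Finset.univ.image g)).card ≤ G.card :=
      Finset.card_le_card fun l hl => (Finset.mem_filter.1 hl).2
    have h2 : G.card ≤ 1 := by rcases hG with rfl | ⟨a, rfl⟩ <;> simp
    exact_mod_cast this.trans h2
  · intro l hl
    obtain ⟨i, -, rfl⟩ := Finset.mem_image.1 hl
    exact hkN.le.trans (Nat.le_add_right k i)

/-- Successive averages, each chosen with a smallness that depends on where the earlier ones end. If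
`G ∈ S_{n+1}` meets the earlier sets, which lie below `b`, then `G` is a union of at most `b` sets
of `S_n`, and the new average has mass at most `b · ε/(b+1) ≤ ε` on it. So only the first average
that `G` meets can contribute as much as `1`. -/
theorem exists_sum_of_averages {n : ℕ}
    (ih : ∀ ε : ℝ, 0 < ε → ∀ N : ℕ, ∃ A μ, IsAverage n ε A μ ∧ ∀ l ∈ A, N ≤ (l : ℕ))
    {ε : ℝ} (hε : 0 < ε) (N d : ℕ) :
    ∃ (B : Fin d → Finset ℕ+) (ν : ℕ+ → ℝ), (∀ i, B i ∈ schreier (n + 1)) ∧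
      (∀ i, ∀ l ∈ B i, N ≤ (l : ℕ)) ∧ (∀ i j, i < j → ∀ a ∈ B i, ∀ b ∈ B j, a < b) ∧
      (∀ l ∈ Finset.univ.biUnion B, 0 < ν l) ∧ ∑ l ∈ Finset.univ.biUnion B, ν l = d ∧
      ∀ G ∈ schreier (n + 1), ∑ l ∈ Finset.univ.biUnion B with l ∈ G, ν l ≤ 1 + d * ε := by
  classical
  induction d with
  | zero => exact ⟨fun _ => ∅, fun _ => 0, by simp [empty_mem_schreier]⟩
  | succ d ihd =>
    obtain ⟨B, ν, hB, hN, hs, hpos, hsum, hsmall⟩ := ihd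
    set A := Finset.univ.biUnion B with hA
    obtain ⟨b, hb⟩ : ∃ b : ℕ, ∀ l ∈ A, (l : ℕ) < b := by
      refine ⟨A.sup (fun l : ℕ+ => (l : ℕ)) + 1, fun l hl => Nat.lt_succ_of_le ?_⟩
      exact Finset.le_sup (f := fun l : ℕ+ => (l : ℕ)) hl
    obtain ⟨A', μ, hμ, hA'⟩ := ih (ε / (b + 1)) (by positivity) (max N b)
    have hlt : ∀ l ∈ A, ∀ l' ∈ A', l < l' := fun l hl l' hl' =>
      PNat.coe_lt_coe _ _ |>.1 ((hb l hl).trans_le ((le_max_right _ _).trans (hA' l' hl')))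
    have hdisj : Disjoint A A' := Finset.disjoint_left.2 fun l hl hl' => (hlt l hl l hl').false
    have hunion : Finset.univ.biUnion (Fin.snoc B A' : Fin (d + 1) → Finset ℕ+) = A ∪ A' := by
      ext l
      simp [hA, Fin.exists_fin_succ', or_comm]
    refine ⟨Fin.snoc B A', fun l => if l ∈ A then ν l else μ l, ?_, ?_, ?_, ?_, ?_, ?_⟩
    · intro i
      refine Fin.lastCases ?_ (fun i => ?_) i
      · simpa using hμ.mem
      · simpa using hB i
    · intro i
      refine Fin.lastCases ?_ (fun i => ?_) i
      · simpa using fun l hl => (le_max_left _ _).trans (hA' l hl)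
      · simpa using hN i
    · intro i j
      refine Fin.lastCases (fun h => absurd h (not_lt.2 (Fin.le_last _))) (fun i => ?_) i
      refine Fin.lastCases (fun _ => ?_) (fun j hij => ?_) j
      · simpa using fun l hl l' hl' =>
          hlt l (Finset.mem_biUnion.2 ⟨i, Finset.mem_univ _, hl⟩) l' hl'
      · simpa using hs i j (by simpa using hij)
    · rw [hunion]
      intro l hl
      by_cases h : l ∈ A
      · simpa [h] using hpos l h
      · simpa [h] using hμ.pos l ((Finset.mem_union.1 hl).resolve_left h)
    · rw [hunion, Finset.sum_union hdisj, Finset.sum_congr rfl fun l hl => if_pos hl, hsum,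
        Finset.sum_congr rfl fun l hl => if_neg (Finset.disjoint_right.1 hdisj hl), hμ.sum_eq]
      push_cast; ring
    · intro G hG
      rw [hunion, Finset.filter_union, Finset.sum_union
        (Finset.disjoint_filter_filter hdisj),
        Finset.sum_congr rfl fun l hl => if_pos (Finset.mem_filter.1 hl).1,
        Finset.sum_congr rfl fun l hl => if_neg (Finset.disjoint_right.1 hdisj
          (Finset.mem_filter.1 hl).1)]
      by_cases hGA : ∃ l ∈ A, l ∈ G
      · have h1 := hsmall G hG
        have h2 : ∑ l ∈ A' with l ∈ G, μ l ≤ ε := by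
          obtain ⟨l, hl, hlG⟩ := hGA
          rcases hG with rfl | ⟨e, H, hH, he, -, rfl⟩
          · simpa using hε.le
          · obtain ⟨i, -, hli⟩ := Finset.mem_biUnion.1 hlG
            have heb : e ≤ b := (he i l hli).trans (hb l hl).le
            have hnn : ∀ i, ∀ l ∈ A'.filter (· ∈ H i), 0 ≤ μ l := fun i l hl =>
              (hμ.pos l (Finset.mem_filter.1 hl).1).le
            calc ∑ l ∈ A' with l ∈ Finset.univ.biUnion H, μ l
                = ∑ l ∈ Finset.univ.biUnion fun i => A'.filter (· ∈ H i), μ l := by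
                  congr 1; ext l; simp
              _ ≤ ∑ i, ∑ l ∈ A' with l ∈ H i, μ l := sum_biUnion_le _ _ _ hnn
              _ ≤ ∑ i : Fin e, ε / (b + 1) := Finset.sum_le_sum fun i _ => hμ.small _ (hH i)
              _ = e * (ε / (b + 1)) := by simp
              _ ≤ (b + 1) * (ε / (b + 1)) := by
                gcongr; exact (Nat.cast_le.2 heb).trans (by linarith)
              _ = ε := by field_simp
        push_cast
        linarith
      · have h1 : A.filter (· ∈ G) = ∅ := by
          ext l; simp only [Finset.mem_filter, Finset.notMem_empty, iff_false]
          exact fun h => hGA ⟨l, h.1, h.2⟩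
        rw [h1, Finset.sum_empty, zero_add]
        have h2 : ∑ l ∈ A' with l ∈ G, μ l ≤ 1 := by
          rw [← hμ.sum_eq]
          exact Finset.sum_le_sum_of_subset_of_nonneg (Finset.filter_subset _ _)
            fun l hl _ => (hμ.pos l hl).le
        have : 0 ≤ ((d + 1 : ℕ) : ℝ) * ε := by positivity
        linarith

theorem exists_isAverage (n : ℕ) : ∀ ε : ℝ, 0 < ε → ∀ N : ℕ,
    ∃ A μ, IsAverage n ε A μ ∧ ∀ l ∈ A, N ≤ (l : ℕ) := by
  classical
  induction n with
  | zero => exact fun ε hε N => exists_isAverage_zero hε N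
  | succ n ih =>
    intro ε hε N
    obtain ⟨d, hd⟩ := exists_nat_gt (max (N : ℝ) (2 / ε))
    have hdN : N < d := by exact_mod_cast (le_max_left _ _).trans_lt hd
    have hdε : 2 / ε < d := (le_max_right _ _).trans_lt hd
    have hdr : (0 : ℝ) < d := by exact_mod_cast (by omega : 0 < d)
    -- The number `d` of averages is also the lower bound for their supports, which makes the union
    -- a set of `S_{n+2}`. After division by `d` the mass on `G` is at most `1/d + ε/2 < ε`.
    obtain ⟨B, ν, hB, hN, hs, hpos, hsum, hsmall⟩ :=
      exists_sum_of_averages ih (half_pos hε) d d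
    refine ⟨Finset.univ.biUnion B, fun l => ν l / d, ⟨Or.inr ⟨d, B, hB, hN, hs, rfl⟩,
      fun l hl => div_pos (hpos l hl) hdr, ?_, fun G hG => ?_⟩, ?_⟩
    · rw [← Finset.sum_div, hsum, div_self hdr.ne']
    · rw [← Finset.sum_div, div_le_iff₀ hdr]
      refine (hsmall G hG).trans ?_
      rw [div_lt_iff₀ hε] at hdε
      nlinarith
    · intro l hl
      obtain ⟨i, -, hl⟩ := Finset.mem_biUnion.1 hl
      exact hdN.le.trans (hN i l hl)

end SchreierSpace

namespace SchreierSpace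

/-! ### Budgets -/

/-- Every product of weights `w l`, `l < j`, which is below `t` has total cost at most `G`. -/
def Budget (w : ℕ → ℝ) (c : ℕ → ℕ) (j : ℕ) (t : ℝ) (G : ℕ) : Prop :=
  ∀ L : List ℕ, (∀ l ∈ L, l < j) → (L.map w).prod < t → (L.map c).sum ≤ G

theorem Budget.step {w : ℕ → ℝ} {c : ℕ → ℕ} {j : ℕ} {t : ℝ} {G l : ℕ} (h : Budget w c j t G)
    (hl : l < j) (hw : 0 < w l) (ht : w l < t) :
    c l ≤ G ∧ Budget w c j (t / w l) (G - c l) := by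
  refine ⟨by simpa using h [l] (by simpa) (by simpa), fun L hL hp => ?_⟩
  have := h (l :: L) (by simpa [hl] using hL) (by
    rw [lt_div_iff₀ hw] at hp; simpa [mul_comm] using hp)
  simp only [List.map_cons, List.sum_cons] at this
  omega

/-- Greedy packing. Indices below `i` are collected in `σ` until the product would reach `w i`; then
`σ` and the new index are traded for one copy of `i`. The trade does not raise the product, and it
does not lower the cost: `σ` and the new index cost at most `f` each, and `2 f ≤ c i`. -/
theorem exists_list_reduction {w : ℕ → ℝ} {c : ℕ → ℕ} {i f : ℕ} (hw : ∀ l ≤ i, 1 < w l)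
    (hlt : ∀ l < i, w l < w i) (hb : Budget w c i (w i) f) (hf : 2 * f ≤ c i) (L : List ℕ)
    (hL : ∀ l ∈ L, l < i + 1) :
    ∃ (k : ℕ) (σ : List ℕ), (∀ l ∈ σ, l < i) ∧ (σ.map w).prod < w i ∧
      w i ^ k * (σ.map w).prod ≤ (L.map w).prod ∧ (L.map c).sum ≤ k * c i + (σ.map c).sum := by
  induction L with
  | nil => exact ⟨0, [], by simpa using hw i le_rfl⟩
  | cons l L ih =>
    obtain ⟨k, σ, hσ, hσw, hk, hc⟩ := ih fun l hl => hL l (by simp [hl])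
    have hwi : 0 < w i := zero_lt_one.trans (hw i le_rfl)
    have hli : l ≤ i := Nat.lt_succ_iff.1 (hL l (by simp))
    have hwl : 0 < w l := zero_lt_one.trans (hw l hli)
    have hmul : w l * (w i ^ k * (σ.map w).prod) ≤ w l * (L.map w).prod := by gcongr
    simp only [List.map_cons, List.prod_cons, List.sum_cons]
    rcases hli.eq_or_lt with rfl | hli
    · refine ⟨k + 1, σ, hσ, hσw, ?_, ?_⟩
      · rw [pow_succ]; linarith
      · rw [add_mul]; omega
    · by_cases h : w l * (σ.map w).prod < w i
      · refine ⟨k, l :: σ, by simpa [hli] using hσ, by simpa using h, ?_, ?_⟩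
        · simp only [List.map_cons, List.prod_cons]; linarith
        · simp only [List.map_cons, List.sum_cons]; omega
      · refine ⟨k + 1, [], by simp, by simpa using hw i le_rfl, ?_, ?_⟩
        · have : w i ^ k * w i ≤ w i ^ k * (w l * (σ.map w).prod) := by
            gcongr; exact not_lt.1 h
          simp only [List.map_nil, List.prod_nil]
          rw [pow_succ]; linarith
        · have h1 := hb σ hσ hσw
          have h2 := hb [l] (by simpa) (by simpa using hlt l hli)
          simp only [List.map_cons, List.map_nil, List.sum_cons, List.sum_nil] at h2 ⊢
          rw [add_mul]; omega

/-- After the reduction at most `s` copies of `i` fit below `w i ^ (s + 1)`. Since `m_{2(j+1)} =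
m_{2j}^{s_j + 1}`, this is the source of `f_{j+1} ≤ s_j n_{2j} + f_j`. -/
theorem Budget.pow {w : ℕ → ℝ} {c : ℕ → ℕ} {i f : ℕ} (hw : ∀ l ≤ i, 1 < w l)
    (hlt : ∀ l < i, w l < w i) (hb : Budget w c i (w i) f) (hf : 2 * f ≤ c i) (s : ℕ) :
    Budget w c (i + 1) (w i ^ (s + 1)) (s * c i + f) := by
  intro L hL hp
  obtain ⟨k, σ, hσ, hσw, hk, hc⟩ := exists_list_reduction hw hlt hb hf L hL
  have hone : 1 ≤ (σ.map w).prod := by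
    clear hσw hk hc
    induction σ with
    | nil => simp
    | cons l σ ih =>
      simp only [List.map_cons, List.prod_cons]
      exact one_le_mul_of_one_le_of_one_le (hw l (hσ l (by simp)).le).le
        (ih fun l hl => hσ l (by simp [hl]))
  have hks : w i ^ k < w i ^ (s + 1) := by
    refine lt_of_le_of_lt (le_trans ?_ hk) hp
    exact le_mul_of_one_le_right (pow_pos (zero_lt_one.trans (hw i le_rfl)) k).le hone
  have hks' : k < s + 1 := (pow_lt_pow_iff_right₀ (hw i le_rfl)).1 hks
  have := hb σ hσ hσw
  have : k * c i ≤ s * c i := Nat.mul_le_mul_right _ (by omega)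
  omega

/-- The weights `m₁, m₂, m₄, m₆, …`. -/
noncomputable def weight (m : ℕ → ℕ) (l : ℕ) : ℝ := if l = 0 then (m 1 : ℝ) else m (2 * l)

/-- The costs `n₁, n₂, n₄, n₆, …`. -/
def cost (n : ℕ → ℕ) (l : ℕ) : ℕ := if l = 0 then n 1 else n (2 * l)

/-- The weights `m₁ / 2, m₂, m₄, m₆, …`. -/
noncomputable def halfWeight (m : ℕ → ℕ) (l : ℕ) : ℝ := if l = 0 then (m 1 : ℝ) / 2 else m (2 * l)

/-- The costs `1, n₂, n₄, n₆, …`. -/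
def unitCost (n : ℕ → ℕ) (l : ℕ) : ℕ := if l = 0 then 1 else n (2 * l)

theorem exists_exponents_of_list (m n : ℕ → ℕ) (j : ℕ) (L : List ℕ) (hL : ∀ l ∈ L, l < j) :
    ∃ (r : ℕ) (ρ : ℕ → ℕ),
      (L.map (weight m)).prod = ((m 1 ^ r * ∏ i ∈ Finset.Ico 1 j, m (2 * i) ^ ρ i : ℕ) : ℝ) ∧
      (L.map (cost n)).sum = r * n 1 + ∑ i ∈ Finset.Ico 1 j, ρ i * n (2 * i) := by
  induction L with
  | nil => exact ⟨0, 0, by simp⟩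
  | cons l L ih =>
    obtain ⟨r, ρ, h1, h2⟩ := ih fun l hl => hL l (by simp [hl])
    simp only [List.map_cons, List.prod_cons, List.sum_cons, h1, h2]
    rcases Nat.eq_zero_or_pos l with rfl | hl
    · refine ⟨r + 1, ρ, ?_, ?_⟩
      · simp only [weight, ↓reduceIte]; push_cast; ring
      · simp only [cost, ↓reduceIte]; ring
    · have hmem : l ∈ Finset.Ico 1 j := Finset.mem_Ico.2 ⟨hl, hL l (by simp)⟩
      refine ⟨r, fun i => ρ i + if l = i then 1 else 0, ?_, ?_⟩
      · simp only [weight, hl.ne', ↓reduceIte, pow_add, Finset.prod_mul_distrib,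
          Finset.prod_pow_boole, hmem, ↓reduceIte]
        push_cast; ring
      · simp only [cost, hl.ne', ↓reduceIte, add_mul, Finset.sum_add_distrib, ite_mul, one_mul,
          zero_mul, Finset.sum_ite_eq, hmem, ↓reduceIte]
        ring

theorem exists_list_of_exponents (m n : ℕ → ℕ) (j r : ℕ) (hj : 1 ≤ j) (ρ : ℕ → ℕ) :
    ∃ L : List ℕ, (∀ l ∈ L, l < j) ∧
      (L.map (weight m)).prod = ((m 1 ^ r * ∏ i ∈ Finset.Ico 1 j, m (2 * i) ^ ρ i : ℕ) : ℝ) ∧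
      (L.map (cost n)).sum = r * n 1 + ∑ i ∈ Finset.Ico 1 j, ρ i * n (2 * i) := by
  induction j, hj using Nat.le_induction with
  | base =>
    refine ⟨List.replicate r 0, fun l hl => by simp [List.eq_of_mem_replicate hl], ?_, ?_⟩
    · simp [weight]
    · simp [cost]
  | succ j hj ih =>
    obtain ⟨L, h0, h1, h2⟩ := ih
    have hj0 : j ≠ 0 := by omega
    refine ⟨List.replicate (ρ j) j ++ L, ?_, ?_, ?_⟩
    · intro l hl
      rcases List.mem_append.1 hl with hl | hl
      · simp [List.eq_of_mem_replicate hl]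
      · exact (h0 l hl).trans (Nat.lt_succ_self j)
    · rw [Finset.prod_Ico_succ_top hj, List.map_append, List.prod_append, h1]
      simp only [List.map_replicate, List.prod_replicate, weight, hj0, ↓reduceIte]
      push_cast; ring
    · rw [Finset.sum_Ico_succ_top hj, List.map_append, List.sum_append, h2]
      simp only [List.map_replicate, List.sum_replicate, cost, hj0, ↓reduceIte, smul_eq_mul]
      ring

/-- Factors `m₁/2` are paired: two of them make up at least one `m₁` because `m₁ ≥ 4`, and their
cost `2` is at most `2 n₁`. One unpaired factor may remain, whence the summand `1`. -/
theorem budget_half {m n : ℕ → ℕ} {j f : ℕ} {t : ℝ} (hm : ∀ l, 0 < weight m l) (hm1 : 4 ≤ m 1)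
    (hn1 : 1 ≤ n 1) (h : Budget (weight m) (cost n) j t f) :
    Budget (halfWeight m) (unitCost n) j t (2 * f + 1) := by
  intro L hL hp
  have hm1' : (4 : ℝ) ≤ m 1 := by exact_mod_cast hm1
  -- The exponent `e` records whether a factor `m₁/2` is still waiting for a partner.
  have key : ∃ (L' : List ℕ) (e : ℕ), e ≤ 1 ∧ (∀ l ∈ L', l < j) ∧
      (L'.map (weight m)).prod * ((m 1 : ℝ) / 2) ^ e ≤ (L.map (halfWeight m)).prod ∧
      (L.map (unitCost n)).sum ≤ 2 * (L'.map (cost n)).sum + e := by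
    clear hp
    induction L with
    | nil => exact ⟨[], 0, by simp⟩
    | cons l L ih =>
      obtain ⟨L', e, he, h0, h1, h2⟩ := ih fun l hl => hL l (by simp [hl])
      have hlj := hL l (by simp)
      simp only [List.map_cons, List.prod_cons, List.sum_cons]
      rcases Nat.eq_zero_or_pos l with rfl | hl
      · have hP : (0 : ℝ) < (L'.map (weight m)).prod := List.prod_pos (by simpa using fun l _ => hm l)
        simp only [halfWeight, unitCost, ↓reduceIte]
        interval_cases e
        · refine ⟨L', 1, le_rfl, h0, ?_, by omega⟩
          simp only [pow_zero, mul_one, pow_one] at h1 ⊢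
          rw [mul_comm]
          gcongr
        · refine ⟨0 :: L', 0, by omega, by simpa [hlj] using h0, ?_, ?_⟩
          · simp only [pow_zero, mul_one, pow_one, List.map_cons, List.prod_cons] at h1 ⊢
            have : (m 1 : ℝ) / 2 * ((L'.map (weight m)).prod * (m 1 / 2)) ≤
              m 1 / 2 * (L.map (halfWeight m)).prod := by gcongr
            refine le_trans ?_ this
            simp only [weight, ↓reduceIte] at hP ⊢
            nlinarith [mul_le_mul_of_nonneg_right hm1' (mul_pos (by linarith : (0:ℝ) < m 1) hP).le]
          · simp only [List.map_cons, List.sum_cons, cost, ↓reduceIte] at h2 ⊢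
            omega
      · refine ⟨l :: L', e, he, by simpa [hlj] using h0, ?_, ?_⟩
        · have hw : halfWeight m l = weight m l := by simp [halfWeight, weight, hl.ne']
          simp only [List.map_cons, List.prod_cons, hw, mul_assoc]
          have := hm l
          gcongr
        · have hw : unitCost n l = cost n l := by simp [unitCost, cost, hl.ne']
          simp only [List.map_cons, List.sum_cons, hw]
          omega
  obtain ⟨L', e, he, h0, h1, h2⟩ := key
  have hP : (0 : ℝ) < (L'.map (weight m)).prod := List.prod_pos (by simpa using fun l _ => hm l)
  have := h L' h0 (by
    refine lt_of_le_of_lt (le_trans ?_ h1) hp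
    exact le_mul_of_one_le_right hP.le (one_le_pow₀ (by linarith)))
  omega

/-! ### The sequences `(m_i)`, `(n_i)`, `(f_j)` -/

/-- The consequences of the conditions on `(m_i)` and `(n_i)` which are used below. -/
structure Rates (m n f s : ℕ → ℕ) : Prop where
  m_one : 4 ≤ m 1
  m_odd : ∀ k, m 1 ≤ m (2 * k + 1)
  m_even : ∀ k, 1 ≤ k → 4 ^ k ≤ m (2 * k)
  m_lt : ∀ k l, 1 ≤ k → k < l → m (2 * k) < m (2 * l)
  m_succ : ∀ j, 2 ≤ j → m (2 * (j + 1)) = m (2 * j) ^ (s j + 1)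
  s_pos : ∀ j, 2 ≤ j → 1 ≤ s j
  n_pos : ∀ k, 1 ≤ k → 1 ≤ n k
  f_pos : ∀ j, 2 ≤ j → 1 ≤ f j
  f_lt : ∀ j, 2 ≤ j → 4 * f j < n (2 * j)
  f_succ : ∀ j, 2 ≤ j → f (j + 1) ≤ s j * n (2 * j) + f j
  budget : ∀ j, 2 ≤ j → Budget (weight m) (cost n) j (m (2 * j)) (f j)

theorem Conditions.exists_rates {m n : ℕ → ℕ} (h : Conditions m n) : ∃ f s, Rates m n f s := by
  obtain ⟨s, hs, hs1, hm⟩ := h.m_even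
  have hspos : ∀ j, 1 ≤ j → 1 ≤ s j := fun j hj =>
    hs1.trans_le (hs.monotoneOn (Set.mem_Ici.2 le_rfl) (Set.mem_Ici.2 hj) hj)
  choose! f hf using h.n_even
  have hm1 : 4 ≤ m 1 := h.three_lt
  have hmono : ∀ k l, 1 ≤ k → k < l → m k < m l := fun k l hk hl =>
    h.m_strictMono (Set.mem_Ici.2 hk) (Set.mem_Ici.2 (by omega)) hl
  have hm4 : ∀ k, 1 ≤ k → 4 ≤ m k := fun k hk => by
    rcases hk.eq_or_lt with rfl | hk
    · exact hm1
    · exact hm1.trans (hmono 1 k le_rfl hk).le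
  have hm_even : ∀ k, 1 ≤ k → 4 ^ k ≤ m (2 * k) := by
    intro k hk
    induction k, hk using Nat.le_induction with
    | base => simpa using hm4 2 (by omega)
    | succ k hk ih =>
      have h1 : m (2 * k + 1) < m (2 * (k + 1)) := hmono _ _ (by omega) (by omega)
      rw [h.m_odd k hk] at h1
      have h2 := hm4 (2 * k) (by omega)
      calc 4 ^ (k + 1) ≤ m (2 * k) * m (2 * k) := by rw [pow_succ]; gcongr
        _ = m (2 * k) ^ 2 := by ring
        _ ≤ m (2 * k) ^ 5 := Nat.pow_le_pow_right (by omega) (by omega)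
        _ ≤ _ := h1.le
  have hm_succ : ∀ j, 2 ≤ j → m (2 * (j + 1)) = m (2 * j) ^ (s j + 1) := fun j hj => by
    rw [hm (j + 1) (by omega), Finset.prod_Ico_succ_top (by omega), ← hm j hj, pow_succ]
    ring
  have hn_pos : ∀ k, 1 ≤ k → 1 ≤ n k := fun k hk =>
    (Nat.succ_le_of_lt h.n_pos).trans
      (h.n_strictMono.monotoneOn (Set.mem_Ici.2 le_rfl) (Set.mem_Ici.2 hk) hk)
  have hbudget : ∀ j, 2 ≤ j → Budget (weight m) (cost n) j (m (2 * j)) (f j) := by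
    intro j hj L hL hp
    obtain ⟨r, ρ, h1, h2⟩ := exists_exponents_of_list m n j L hL
    rw [h2]
    refine (hf j hj).1.2 ⟨r, ρ, ?_, rfl⟩
    rw [h1] at hp
    exact_mod_cast hp
  refine ⟨f, s, hm1, ?_, hm_even, fun k l hk hl => hmono _ _ (by omega) (by omega), hm_succ,
    fun j hj => hspos j (by omega), hn_pos, ?_, fun j hj => (hf j hj).2, ?_, hbudget⟩
  · intro k
    rcases Nat.eq_zero_or_pos k with rfl | hk
    · simp
    · exact (hmono 1 _ le_rfl (by omega)).le
  · intro j hj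
    have h1 := hbudget j hj [0] (by simp; omega) (by
      simpa [weight] using hmono 1 (2 * j) le_rfl (by omega))
    have h2 := hn_pos 1 le_rfl
    simp only [List.map_cons, List.map_nil, List.sum_cons, List.sum_nil, cost, ↓reduceIte] at h1
    omega
  · intro j hj
    obtain ⟨r, ρ, hlt, heq⟩ := (hf (j + 1) (by omega)).1.1
    obtain ⟨L, h0, h1, h2⟩ := exists_list_of_exponents m n (j + 1) r (by omega) ρ
    rw [heq, ← h2]
    have hj0 : j ≠ 0 := by omega
    have hwj : weight m j = m (2 * j) := by simp [weight, hj0]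
    have hcj : cost n j = n (2 * j) := by simp [cost, hj0]
    have := (hwj ▸ hbudget j hj : Budget (weight m) (cost n) j (weight m j) (f j)).pow
      (fun l _ => ?_) (fun l hl => ?_) (by have := (hf j hj).2; rw [hcj]; omega) (s j) L h0 (by
        rw [h1, hwj]; exact_mod_cast (hm_succ j hj ▸ hlt))
    · rwa [hcj] at this
    · unfold weight
      split_ifs
      · exact_mod_cast (by omega : 1 < m 1)
      · exact_mod_cast (by have := hm4 (2 * l) (by omega); omega : 1 < m (2 * l))
    · rw [hwj]
      unfold weight
      split_ifs
      · exact_mod_cast hmono _ _ le_rfl (by omega)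
      · exact_mod_cast hmono _ _ (by omega) (by omega)

theorem Rates.weight_gt {m n f s : ℕ → ℕ} (h : Rates m n f s) (l : ℕ) : 2 ≤ weight m l := by
  unfold weight
  split_ifs with hl
  · exact_mod_cast (by have := h.m_one; omega : 2 ≤ m 1)
  · have h1 := h.m_even l (by omega)
    have h2 : 4 ^ 1 ≤ 4 ^ l := Nat.pow_le_pow_right (by omega) (by omega)
    exact_mod_cast (by omega : 2 ≤ m (2 * l))

/-- `m_{2i}` is `m_{2j}` times a product of weights whose total cost is at least `f_i - f_j`. -/
theorem Rates.exists_factorization {m n f s : ℕ → ℕ} (h : Rates m n f s) {j i : ℕ} (hj : 2 ≤ j)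
    (hi : j < i) : ∃ L : List ℕ, L ≠ [] ∧ (∀ l ∈ L, 1 ≤ l) ∧
      (m (2 * i) : ℝ) = m (2 * j) * (L.map fun l => (m (2 * l) : ℝ)).prod ∧
      f i ≤ f j + (L.map fun l => n (2 * l)).sum := by
  induction i, hi using Nat.le_induction with
  | base =>
    have := h.s_pos j hj
    refine ⟨List.replicate (s j) j, by simp; omega,
      fun l hl => by rw [List.eq_of_mem_replicate hl]; omega, ?_, ?_⟩
    · rw [Nat.succ_eq_add_one, h.m_succ j hj]; simp [pow_succ']
    · have := h.f_succ j hj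
      simp; omega
  | succ i hi ih =>
    obtain ⟨L, hL, h0, h1, h2⟩ := ih
    refine ⟨List.replicate (s i) i ++ L, by simp [hL], ?_, ?_, ?_⟩
    · intro l hl
      rcases List.mem_append.1 hl with hl | hl
      · rw [List.eq_of_mem_replicate hl]; omega
      · exact h0 l hl
    · rw [h.m_succ i (by omega), pow_succ]
      push_cast
      simp only [List.map_append, List.prod_append, List.map_replicate, List.prod_replicate]
      nth_rw 2 [h1]
      ring
    · have := h.f_succ i (by omega)
      simp only [List.map_append, List.sum_append, List.map_replicate, List.sum_replicate,
        smul_eq_mul]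
      omega

end SchreierSpace

namespace SchreierSpace

/-! ### Analysis of the functionals in a Schreier norming set -/

theorem schreier_succ_biUnion_mem {n d e : ℕ} (I : Finset (Fin d)) (hI : I.card ≤ e)
    (V : Fin d → Finset ℕ+) (hV : ∀ i ∈ I, V i ∈ schreier n) (he : ∀ i ∈ I, ∀ a ∈ V i, e ≤ (a : ℕ))
    (hlt : ∀ i j, i < j → ∀ a ∈ V i, ∀ b ∈ V j, a < b) : I.biUnion V ∈ schreier (n + 1) := by
  refine Or.inr ⟨I.card, fun i => V (I.orderEmbOfFin rfl i),
    fun i => hV _ (I.orderEmbOfFin_mem rfl i),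
    fun i a ha => hI.trans (he _ (I.orderEmbOfFin_mem rfl i) a ha),
    fun i j hij => hlt _ _ ((I.orderEmbOfFin rfl).lt_iff_lt.2 hij), ?_⟩
  ext a
  simp only [Finset.mem_biUnion, Finset.mem_univ, true_and]
  constructor
  · rintro ⟨i, hi, ha⟩
    obtain ⟨k, rfl⟩ : i ∈ Set.range (I.orderEmbOfFin rfl) := by simpa using hi
    exact ⟨k, ha⟩
  · rintro ⟨k, ha⟩
    exact ⟨_, I.orderEmbOfFin_mem rfl k, ha⟩

/-- The function `Q` gives for the coordinates of `x` the product of the weights in a tree of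
functionals from which `x` is built. -/
structure IsAnalysis (m n : ℕ → ℕ) (q : ℝ) (x : FinSeq) (Q : ℕ+ → ℝ) : Prop where
  one_le : ∀ l ∈ x.support, 1 ≤ Q l
  sum_le : ∑ l ∈ x.support, (|x l| * Q l) ^ q ≤ 1
  -- Here an odd node costs one Schreier level: at most `j` of its children are relevant, so their
  -- union is admissible to the right of `j`.
  mem_schreier : ∀ (j : ℕ) (t : ℝ) (G : ℕ), 1 ≤ j → t ≤ m (2 * j) →
    Budget (halfWeight m) (unitCost n) j t G →
    (x.support.filter fun l : ℕ+ => j ≤ (l : ℕ) ∧ Q l < t) ∈ schreier G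
  -- Here odd nodes cost no level: the relevant children of an odd node are separated by a colour
  -- below `j`. A branch with `Q l < t ≤ 2 ^ a` has fewer than `a` odd nodes, since each contributes
  -- at least `2` to `Q`; this accounts for `j ^ a` colours. The smaller Schreier index is what
  -- allows the blocks to be taken in `S_{f_i+1}`.
  colorable : ∀ (j a : ℕ) (t : ℝ) (G : ℕ), 1 ≤ j → t ≤ m (2 * j) → t ≤ 2 ^ a →
    Budget (weight m) (cost n) j t G → ∃ χ : ℕ+ → ℕ,
      (∀ l ∈ x.support, Q l < t → χ l < j ^ a) ∧
      ∀ c, (x.support.filter fun l => Q l < t ∧ χ l = c) ∈ schreier G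

variable {m n f s : ℕ → ℕ} {q : ℝ}

theorem isAnalysis_of_support_subset {x : FinSeq} {i : ℕ+} (hx : x.support ⊆ {i})
    (hxi : |x i| ≤ 1) (hq : 0 < q) : IsAnalysis m n q x fun _ => 1 where
  one_le _ _ := le_rfl
  sum_le := by
    calc ∑ l ∈ x.support, (|x l| * 1) ^ q ≤ ∑ l ∈ {i}, (|x l| * 1) ^ q :=
          Finset.sum_le_sum_of_subset_of_nonneg hx fun l _ _ => by positivity
      _ = |x i| ^ q := by simp
      _ ≤ 1 := Real.rpow_le_one (abs_nonneg _) hxi hq.le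
  mem_schreier j t G _ _ _ :=
    schreier_hereditary (singleton_mem_schreier G i) ((Finset.filter_subset _ _).trans hx)
  colorable j a t G hj _ _ _ := ⟨fun _ => 0, fun _ _ _ => Nat.pow_pos hj, fun _ =>
    schreier_hereditary (singleton_mem_schreier G i) ((Finset.filter_subset _ _).trans hx)⟩

theorem isAnalysis_zero (hq : 0 < q) : IsAnalysis m n q 0 fun _ => 1 :=
  isAnalysis_of_support_subset (i := 1) (by simp) (by simp) hq

/-- The supports of the terms of `z` are successive. -/
def IsSuccessive {d : ℕ} (z : Fin d → FinSeq) : Prop :=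
  ∀ i j, i < j → ∀ a ∈ (z i).support, ∀ b ∈ (z j).support, a < b

theorem IsSuccessive.eq {d : ℕ} {z : Fin d → FinSeq} (h : IsSuccessive z) (i j : Fin d) (l : ℕ+)
    (hi : l ∈ (z i).support) (hj : l ∈ (z j).support) : i = j := by
  rcases lt_trichotomy i j with hij | hij | hij
  · exact absurd (h i j hij l hi l hj) (lt_irrefl _)
  · exact hij
  · exact absurd (h j i hij l hj l hi) (lt_irrefl _)

theorem IsSuccessive.sum_apply {d : ℕ} {z : Fin d → FinSeq} (h : IsSuccessive z) (c : ℝ)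
    (γ : Fin d → ℝ) {i : Fin d} {l : ℕ+} (hl : l ∈ (z i).support) :
    (c • ∑ i, γ i • z i) l = c * (γ i * z i l) := by
  simp only [Finsupp.smul_apply, Finsupp.finsetSum_apply, smul_eq_mul]
  rw [Finset.sum_eq_single i]
  · intro j _ hj
    rw [Finsupp.notMem_support_iff.1 fun hl' => hj (h.eq j i l hl' hl), mul_zero]
  · simp

theorem support_sum_subset {d : ℕ} (z : Fin d → FinSeq) (c : ℝ) (γ : Fin d → ℝ) :
    (c • ∑ i, γ i • z i).support ⊆ Finset.univ.biUnion fun i => (z i).support := by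
  intro l hl
  by_contra h
  simp only [Finset.mem_biUnion, Finset.mem_univ, true_and, not_exists,
    Finsupp.notMem_support_iff] at h
  simp [h] at hl

theorem sum_rpow_node_le {d : ℕ} {x : FinSeq} {z : Fin d → FinSeq} {θ : Fin d → ℝ} {Q : ℕ+ → ℝ}
    {R : Fin d → ℕ+ → ℝ} (hx : x.support ⊆ Finset.univ.biUnion fun i => (z i).support)
    (h : ∀ i, ∀ l ∈ (z i).support, |x l| * Q l = |θ i| * (|z i l| * R i l))
    (hR : ∀ i, ∀ l ∈ (z i).support, 1 ≤ R i l) (hθ : ∑ i, |θ i| ^ q ≤ 1)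
    (hz : ∀ i, ∑ l ∈ (z i).support, (|z i l| * R i l) ^ q ≤ 1) :
    ∑ l ∈ x.support, (|x l| * Q l) ^ q ≤ 1 := by
  have hnn : ∀ i, ∀ l ∈ (z i).support, 0 ≤ |z i l| * R i l := fun i l hl =>
    mul_nonneg (abs_nonneg _) (zero_le_one.trans (hR i l hl))
  have hnn' : ∀ i, ∀ l ∈ (z i).support, 0 ≤ (|x l| * Q l) ^ q := fun i l hl => by
    rw [h i l hl]
    exact Real.rpow_nonneg (mul_nonneg (abs_nonneg _) (hnn i l hl)) _
  calc ∑ l ∈ x.support, (|x l| * Q l) ^ q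
      ≤ ∑ l ∈ Finset.univ.biUnion fun i => (z i).support, (|x l| * Q l) ^ q := by
        refine Finset.sum_le_sum_of_subset_of_nonneg hx fun l hl _ => ?_
        obtain ⟨i, -, hl⟩ := Finset.mem_biUnion.1 hl
        exact hnn' i l hl
    _ ≤ ∑ i, ∑ l ∈ (z i).support, (|x l| * Q l) ^ q := sum_biUnion_le _ _ _ hnn'
    _ = ∑ i, |θ i| ^ q * ∑ l ∈ (z i).support, (|z i l| * R i l) ^ q := by
        refine Finset.sum_congr rfl fun i _ => ?_
        rw [Finset.mul_sum]
        refine Finset.sum_congr rfl fun l hl => ?_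
        rw [h i l hl, Real.mul_rpow (abs_nonneg _) (hnn i l hl)]
    _ ≤ ∑ i, |θ i| ^ q * 1 := by
        gcongr with i
        exact hz i
    _ ≤ 1 := by simpa using hθ

theorem Budget.mono {w : ℕ → ℝ} {c : ℕ → ℕ} {j : ℕ} {t t' : ℝ} {G : ℕ} (h : Budget w c j t G)
    (ht : t' ≤ t) : Budget w c j t' G := fun L hL hp => h L hL (hp.trans_le ht)

/-- `Q` is the weight of the root times the `Q` of the child. Below the threshold `t` the children
are only needed up to `t / w`, with the budget reduced by the cost of the root; admissibility of the
children restores that cost. The `κ i` need not be the minima of the supports, only lower bounds, so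
that restricted children are allowed. -/
theorem isAnalysis_even_aux (hr : Rates m n f s) {k d : ℕ} (hk : 1 ≤ k) {κ : Fin d → ℕ+}
    (hκ : StrictMono κ) (hS : Finset.univ.image κ ∈ schreier (n (2 * k))) {z : Fin d → FinSeq}
    (hle : ∀ i, ∀ l ∈ (z i).support, κ i ≤ l) (hs : IsSuccessive z) {γ : Fin d → ℝ}
    (hγ : ∑ i, |γ i| ^ q ≤ 1) {R : Fin d → ℕ+ → ℝ} (hR : ∀ i, IsAnalysis m n q (z i) (R i)) :
    ∃ Q, IsAnalysis m n q ((1 / (m (2 * k) : ℝ)) • ∑ i, γ i • z i) Q ∧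
      ∀ l ∈ ((1 / (m (2 * k) : ℝ)) • ∑ i, γ i • z i).support, (m (2 * k) : ℝ) ≤ Q l := by
  set x := (1 / (m (2 * k) : ℝ)) • ∑ i, γ i • z i with hx
  set w : ℝ := (m (2 * k) : ℝ) with hw
  have hk0 : k ≠ 0 := by omega
  have hwk : weight m k = w := by simp [weight, hw, hk0]
  have hwk' : halfWeight m k = w := by simp [halfWeight, hw, hk0]
  have hck : cost n k = n (2 * k) := by simp [cost, hk0]
  have hck' : unitCost n k = n (2 * k) := by simp [unitCost, hk0]
  have hw2 : 2 ≤ w := hwk ▸ hr.weight_gt k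
  have hw0 : 0 < w := by linarith
  obtain ⟨Q, hQ⟩ := exists_glue (fun i => ((z i).support : Set ℕ+)) (fun i l => w * R i l)
    (fun i j l hi hj => hs.eq i j l hi hj)
  have hsupp : ∀ l ∈ x.support, ∃ i, l ∈ (z i).support := fun l hl => by
    simpa using support_sum_subset z _ γ hl
  have hkj : ∀ (j : ℕ) (t : ℝ), 1 ≤ j → t ≤ m (2 * j) → w < t → k < j := fun j t hj ht hwt => by
    by_contra! h
    have : m (2 * j) ≤ m (2 * k) := by
      rcases h.eq_or_lt with rfl | h
      · exact le_rfl
      · exact (hr.m_lt j k hj h).le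
    have : (m (2 * j) : ℝ) ≤ m (2 * k) := by exact_mod_cast this
    linarith
  have hge : ∀ l ∈ x.support, w ≤ Q l := fun l hl => by
    obtain ⟨i, hi⟩ := hsupp l hl
    rw [hQ i l hi]
    exact le_mul_of_one_le_right hw0.le ((hR i).one_le l hi)
  have hempty : ∀ (G : ℕ) (t : ℝ) (p : ℕ+ → Prop) [DecidablePred p], t ≤ w → (∀ l, p l → Q l < t) →
      x.support.filter p ∈ schreier G := fun G t p _ ht hp => by
    rw [Finset.filter_eq_empty_iff.2 fun l hl hpl => absurd (hge l hl)
      (not_le.2 ((hp l hpl).trans_le ht))]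
    exact empty_mem_schreier G
  have hdiv : ∀ t : ℝ, ∀ i, ∀ l ∈ (z i).support, Q l < t → R i l < t / w := fun t i l hl ht => by
    rw [hQ i l hl] at ht
    rwa [lt_div_iff₀ hw0, mul_comm]
  refine ⟨Q, ⟨fun l hl => by linarith [hge l hl], ?_, ?_, ?_⟩, hge⟩
  · refine sum_rpow_node_le (θ := γ) (support_sum_subset z _ γ) (fun i l hl => ?_)
      (fun i => (hR i).one_le) hγ fun i => (hR i).sum_le
    rw [hx, hs.sum_apply _ _ hl, hQ i l hl, abs_mul, abs_mul, abs_of_pos (by positivity)]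
    field_simp
  · intro j t G hj htj hb
    by_cases ht : t ≤ w
    · exact hempty G t _ ht fun l hl => hl.2
    rw [not_le] at ht
    obtain ⟨hG, hb'⟩ := hb.step (hkj j t hj htj ht) (by rw [hwk']; exact hw0) (by rwa [hwk'])
    rw [hwk', hck'] at hb'
    rw [hck'] at hG
    have htw : t / w ≤ m (2 * j) := (div_le_self (by linarith) (by linarith)).trans htj
    have := schreier_biUnion_mem_of_strictMono hκ hS
      (fun i => (z i).support.filter fun l : ℕ+ => j ≤ (l : ℕ) ∧ R i l < t / w)
      (fun i => (hR i).mem_schreier j (t / w) _ hj htw hb')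
      (fun i a ha => hle i a (Finset.mem_filter.1 ha).1)
      (fun i i' hii a ha b hb => hs i i' hii a (Finset.mem_filter.1 ha).1 b
        (Finset.mem_filter.1 hb).1)
    rw [Nat.add_sub_cancel' hG] at this
    refine schreier_hereditary this fun l hl => ?_
    obtain ⟨hl, hjl, hlt⟩ := Finset.mem_filter.1 hl
    obtain ⟨i, hi⟩ := hsupp l hl
    exact Finset.mem_biUnion.2 ⟨i, Finset.mem_univ _,
      Finset.mem_filter.2 ⟨hi, hjl, hdiv t i l hi hlt⟩⟩
  · intro j a t G hj htj hta hb
    by_cases ht : t ≤ w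
    · exact ⟨fun _ => 0, fun _ _ _ => Nat.pow_pos hj, fun c => hempty G t _ ht fun l hl => hl.1⟩
    rw [not_le] at ht
    obtain ⟨hG, hb'⟩ := hb.step (hkj j t hj htj ht) (by rw [hwk]; exact hw0) (by rwa [hwk])
    rw [hwk, hck] at hb'
    rw [hck] at hG
    have htw : t / w ≤ t := div_le_self (by linarith) (by linarith)
    choose χ' hχ' hmem using fun i => (hR i).colorable j a (t / w) _ hj (htw.trans htj)
      (htw.trans hta) hb'
    obtain ⟨χ, hχ⟩ := exists_glue (fun i => ((z i).support : Set ℕ+)) χ'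
      (fun i j l hi hj => hs.eq i j l hi hj)
    refine ⟨χ, fun l hl hlt => ?_, fun c => ?_⟩
    · obtain ⟨i, hi⟩ := hsupp l hl
      rw [hχ i l hi]
      exact hχ' i l hi (hdiv t i l hi hlt)
    have := schreier_biUnion_mem_of_strictMono hκ hS
      (fun i => (z i).support.filter fun l : ℕ+ => R i l < t / w ∧ χ' i l = c)
      (fun i => hmem i c)
      (fun i a ha => hle i a (Finset.mem_filter.1 ha).1)
      (fun i i' hii a ha b hb => hs i i' hii a (Finset.mem_filter.1 ha).1 b
        (Finset.mem_filter.1 hb).1)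
    rw [Nat.add_sub_cancel' hG] at this
    refine schreier_hereditary this fun l hl => ?_
    obtain ⟨hl, hlt, hc⟩ := Finset.mem_filter.1 hl
    obtain ⟨i, hi⟩ := hsupp l hl
    exact Finset.mem_biUnion.2 ⟨i, Finset.mem_univ _,
      Finset.mem_filter.2 ⟨hi, hdiv t i l hi hlt, by rw [← hχ i l hi, hc]⟩⟩

/-- Children with coefficient zero are replaced by `0`, as the induction gives no analysis for them.
-/
theorem isAnalysis_even (hq : 0 < q) (hr : Rates m n f s) {k d : ℕ} (hk : 1 ≤ k)
    {κ : Fin d → ℕ+} (hκ : StrictMono κ) (hS : Finset.univ.image κ ∈ schreier (n (2 * k)))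
    {z : Fin d → FinSeq} (hle : ∀ i, ∀ l ∈ (z i).support, κ i ≤ l) (hs : IsSuccessive z)
    {γ : Fin d → ℝ} (hγ : ∑ i, |γ i| ^ q ≤ 1)
    (hR : ∀ i, γ i ≠ 0 → ∃ R, IsAnalysis m n q (z i) R) :
    ∃ Q, IsAnalysis m n q ((1 / (m (2 * k) : ℝ)) • ∑ i, γ i • z i) Q ∧
      ∀ l ∈ ((1 / (m (2 * k) : ℝ)) • ∑ i, γ i • z i).support, (m (2 * k) : ℝ) ≤ Q l := by
  have heq : ∀ i, γ i • (if γ i = 0 then 0 else z i) = γ i • z i := fun i => by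
    split_ifs with h <;> simp [h]
  have hsub : ∀ i, (if γ i = 0 then 0 else z i).support ⊆ (z i).support := fun i => by
    split_ifs <;> simp
  have hex : ∀ i, ∃ R, IsAnalysis m n q (if γ i = 0 then 0 else z i) R := fun i => by
    split_ifs with h
    · exact ⟨_, isAnalysis_zero hq⟩
    · exact hR i h
  choose R hR' using hex
  have := isAnalysis_even_aux hr hk hκ hS (fun i l hl => hle i l (hsub i hl))
    (fun i j hij a ha b hb => hs i j hij a (hsub i ha) b (hsub j hb)) hγ hR'
  simpa only [heq] using this

theorem isAnalysis_odd_aux (hq : 0 < q) (hr : Rates m n f s) {k d : ℕ} {z : Fin d → FinSeq}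
    (hs : IsSuccessive z) {γ : Fin d → ℝ} (hγ : ∑ i, |γ i| ^ q ≤ 2 ^ q) {j : Fin d → ℕ}
    (hinj : Function.Injective j) {R : Fin d → ℕ+ → ℝ}
    (hR : ∀ i, IsAnalysis m n q (z i) (R i))
    (hge : ∀ i, ∀ l ∈ (z i).support, (m (2 * j i) : ℝ) ≤ R i l) :
    ∃ Q, IsAnalysis m n q ((1 / (m (2 * k + 1) : ℝ)) • ∑ i, γ i • z i) Q := by
  set x := (1 / (m (2 * k + 1) : ℝ)) • ∑ i, γ i • z i with hx
  set w : ℝ := m 1 / 2 with hw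
  have hm1 : (4 : ℝ) ≤ m 1 := by exact_mod_cast hr.m_one
  have hmk : (m 1 : ℝ) ≤ m (2 * k + 1) := by exact_mod_cast hr.m_odd k
  have hw2 : 2 ≤ w := by linarith
  have hw0 : 0 < w := by linarith
  have hw' : halfWeight m 0 = w := by simp [halfWeight, hw]
  have hc' : unitCost n 0 = 1 := by simp [unitCost]
  obtain ⟨Q, hQ⟩ := exists_glue (fun i => ((z i).support : Set ℕ+)) (fun i l => w * R i l)
    (fun i j l hi hj => hs.eq i j l hi hj)
  have hsupp : ∀ l ∈ x.support, ∃ i, l ∈ (z i).support := fun l hl => by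
    simpa using support_sum_subset z _ γ hl
  have hQw : ∀ l ∈ x.support, w ≤ Q l := fun l hl => by
    obtain ⟨i, hi⟩ := hsupp l hl
    rw [hQ i l hi]
    exact le_mul_of_one_le_right hw0.le ((hR i).one_le l hi)
  have hempty : ∀ (G : ℕ) (t : ℝ) (p : ℕ+ → Prop) [DecidablePred p], t ≤ w → (∀ l, p l → Q l < t) →
      x.support.filter p ∈ schreier G := fun G t p _ ht hp => by
    rw [Finset.filter_eq_empty_iff.2 fun l hl hpl => absurd (hQw l hl)
      (not_le.2 ((hp l hpl).trans_le ht))]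
    exact empty_mem_schreier G
  have hdiv : ∀ t : ℝ, ∀ i, ∀ l ∈ (z i).support, Q l < t → R i l < t / w := fun t i l hl ht => by
    rw [hQ i l hl] at ht
    rwa [lt_div_iff₀ hw0, mul_comm]
  have hlt : ∀ (i : Fin d) (J : ℕ) (t : ℝ), 1 ≤ J → t ≤ m (2 * J) → ∀ l ∈ (z i).support,
      R i l < t → j i < J := fun i J t hJ htJ l hl ht => by
    by_contra! h
    have : m (2 * J) ≤ m (2 * j i) := by
      rcases h.eq_or_lt with rfl | h
      · exact le_rfl
      · exact (hr.m_lt J (j i) hJ h).le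
    have : (m (2 * J) : ℝ) ≤ m (2 * j i) := by exact_mod_cast this
    linarith [hge i l hl]
  refine ⟨Q, fun l hl => by linarith [hQw l hl], ?_, ?_, ?_⟩
  -- The true weight is at least `m₁ = 2w`, so the effective coefficients are at most `|γ i| / 2`,
  -- and `∑ |γ i| ^ q ≤ 2 ^ q` becomes a bound by `1`.
  · refine sum_rpow_node_le (θ := fun i => 1 / (m (2 * k + 1) : ℝ) * w * γ i)
      (support_sum_subset z _ γ) (fun i l hl => ?_)
      (fun i => (hR i).one_le) ?_ fun i => (hR i).sum_le
    · rw [hx, hs.sum_apply _ _ hl, hQ i l hl]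
      simp only [abs_mul, abs_of_pos hw0]
      ring
    · have hle : ∀ i, |1 / (m (2 * k + 1) : ℝ) * w * γ i| ^ q ≤ (1 / 2) ^ q * |γ i| ^ q := fun i => by
        rw [← Real.mul_rpow (by norm_num) (abs_nonneg _), abs_mul, abs_of_nonneg (by positivity)]
        refine Real.rpow_le_rpow (by positivity) ?_ hq.le
        gcongr
        rw [div_mul_eq_mul_div, one_mul, div_le_iff₀ (by linarith)]
        linarith
      calc _ ≤ ∑ i, (1 / 2 : ℝ) ^ q * |γ i| ^ q := Finset.sum_le_sum fun i _ => hle i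
        _ = (1 / 2) ^ q * ∑ i, |γ i| ^ q := by rw [Finset.mul_sum]
        _ ≤ (1 / 2) ^ q * 2 ^ q := by gcongr
        _ = 1 := by rw [← Real.mul_rpow (by norm_num) (by norm_num)]; norm_num
  · intro J t G hJ htJ hb
    by_cases ht : t ≤ w
    · exact hempty G t _ ht fun l hl => hl.2
    rw [not_le] at ht
    obtain ⟨hG, hb'⟩ := hb.step hJ (by rw [hw']; exact hw0) (by rwa [hw'])
    rw [hw', hc'] at hb'
    rw [hc'] at hG
    have htw : t / w ≤ m (2 * J) := (div_le_self (by linarith) (by linarith)).trans htJ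
    -- Only children with `j i < J` have coordinates below the threshold. Their indices are
    -- distinct, so there are at most `J` of them, and their relevant coordinates lie beyond `J`.
    have := schreier_succ_biUnion_mem (e := J) (Finset.univ.filter fun i => j i < J) (by
        rw [← Finset.card_image_of_injective _ hinj]
        calc _ ≤ (Finset.range J).card := Finset.card_le_card fun a ha => by
              obtain ⟨i, hi, rfl⟩ := Finset.mem_image.1 ha
              simpa using hi
          _ = J := Finset.card_range J)
      (fun i => (z i).support.filter fun l : ℕ+ => J ≤ (l : ℕ) ∧ R i l < t / w)
      (fun i _ => (hR i).mem_schreier J (t / w) _ hJ htw hb')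
      (fun i _ a ha => (Finset.mem_filter.1 ha).2.1)
      (fun i i' hii a ha b hb => hs i i' hii a (Finset.mem_filter.1 ha).1 b
        (Finset.mem_filter.1 hb).1)
    rw [Nat.sub_add_cancel hG] at this
    refine schreier_hereditary this fun l hl => ?_
    obtain ⟨hl, hjl, hQl⟩ := Finset.mem_filter.1 hl
    obtain ⟨i, hi⟩ := hsupp l hl
    have hRl := hdiv t i l hi hQl
    exact Finset.mem_biUnion.2 ⟨i, Finset.mem_filter.2 ⟨Finset.mem_univ _,
      hlt i J _ hJ htw l hi hRl⟩, Finset.mem_filter.2 ⟨hi, hjl, hRl⟩⟩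
  · intro J a t G hJ htJ hta hb
    by_cases ht : t ≤ w
    · exact ⟨fun _ => 0, fun _ _ _ => Nat.pow_pos hJ, fun c => hempty G t _ ht fun l hl => hl.1⟩
    rw [not_le] at ht
    -- `2 ≤ w < t ≤ 2 ^ a` excludes `a = 0`; the odd node uses up one factor `2`.
    obtain ⟨a, rfl⟩ : ∃ a', a = a' + 1 := by
      refine Nat.exists_eq_succ_of_ne_zero fun h => ?_
      rw [h, pow_zero] at hta
      linarith
    have htw : t / w ≤ t := div_le_self (by linarith) (by linarith)
    have htw2 : t / w ≤ 2 ^ a := by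
      rw [div_le_iff₀ hw0]
      rw [pow_succ] at hta
      exact hta.trans (by gcongr)
    choose χ' hχ' hmem using fun i => (hR i).colorable J a (t / w) _ hJ (htw.trans htJ)
      htw2 (hb.mono htw)
    -- The child's index becomes a new leading digit in base `J`. A colour then determines `j i`,
    -- hence by injectivity the child, so a colour class lies inside one child.
    obtain ⟨χ, hχ⟩ := exists_glue (fun i => ((z i).support : Set ℕ+))
      (fun i l => j i * J ^ a + χ' i l) (fun i j l hi hj => hs.eq i j l hi hj)
    refine ⟨χ, fun l hl hQl => ?_, fun c => ?_⟩
    · obtain ⟨i, hi⟩ := hsupp l hl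
      rw [hχ i l hi]
      have hRl := hdiv t i l hi hQl
      have h1 := hχ' i l hi hRl
      have h2 := hlt i J _ hJ (htw.trans htJ) l hi hRl
      calc j i * J ^ a + χ' i l < j i * J ^ a + J ^ a := by omega
        _ = (j i + 1) * J ^ a := by ring
        _ ≤ J * J ^ a := Nat.mul_le_mul_right _ h2
        _ = J ^ (a + 1) := by ring
    · rcases (x.support.filter fun l => Q l < t ∧ χ l = c).eq_empty_or_nonempty with h | ⟨l₀, hl₀⟩
      · rw [h]; exact empty_mem_schreier G
      have hJa : 0 < J ^ a := Nat.pow_pos hJ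
      have hcol : ∀ l ∈ x.support.filter fun l => Q l < t ∧ χ l = c, ∀ i, l ∈ (z i).support →
          R i l < t / w ∧ j i = c / J ^ a ∧ χ' i l = c % J ^ a := fun l hl i hi => by
        obtain ⟨hl, hQl, hc⟩ := Finset.mem_filter.1 hl
        have hRl := hdiv t i l hi hQl
        have h1 := hχ' i l hi hRl
        rw [hχ i l hi] at hc
        refine ⟨hRl, ?_, ?_⟩
        · rw [← hc, Nat.mul_comm, Nat.mul_add_div hJa, Nat.div_eq_of_lt h1, Nat.add_zero]
        · rw [← hc, Nat.mul_add_mod_self_right, Nat.mod_eq_of_lt h1]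
      obtain ⟨i₀, hi₀⟩ := hsupp l₀ (Finset.mem_filter.1 hl₀).1
      refine schreier_hereditary (hmem i₀ (c % J ^ a)) fun l hl => ?_
      obtain ⟨i, hi⟩ := hsupp l (Finset.mem_filter.1 hl).1
      obtain ⟨h1, h2, h3⟩ := hcol l hl i hi
      obtain rfl : i = i₀ := hinj (h2.trans (hcol l₀ hl₀ i₀ hi₀).2.1.symm)
      exact Finset.mem_filter.2 ⟨hi, h1, h3⟩

theorem isAnalysis_odd (hq : 0 < q) (hr : Rates m n f s) {k d : ℕ} {z : Fin d → FinSeq}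
    (hs : IsSuccessive z) {γ : Fin d → ℝ} (hγ : ∑ i, |γ i| ^ q ≤ 2 ^ q) {j : Fin d → ℕ}
    (hinj : Function.Injective j)
    (hR : ∀ i, γ i ≠ 0 → ∃ R, IsAnalysis m n q (z i) R ∧
      ∀ l ∈ (z i).support, (m (2 * j i) : ℝ) ≤ R l) :
    ∃ Q, IsAnalysis m n q ((1 / (m (2 * k + 1) : ℝ)) • ∑ i, γ i • z i) Q := by
  have heq : ∀ i, γ i • (if γ i = 0 then 0 else z i) = γ i • z i := fun i => by
    split_ifs with h <;> simp [h]
  have hsub : ∀ i, (if γ i = 0 then 0 else z i).support ⊆ (z i).support := fun i => by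
    split_ifs <;> simp
  have hex : ∀ i, ∃ R, IsAnalysis m n q (if γ i = 0 then 0 else z i) R ∧
      ∀ l ∈ (if γ i = 0 then 0 else z i).support, (m (2 * j i) : ℝ) ≤ R l := fun i => by
    split_ifs with h
    · exact ⟨_, isAnalysis_zero hq, by simp⟩
    · exact hR i h
  choose R hR' hge using hex
  have := isAnalysis_odd_aux (k := k) hq hr
    (fun i j hij a ha b hb => hs i j hij a (hsub i ha) b (hsub j hb)) hγ hinj hR' hge
  simpa only [heq] using this

theorem restrict_apply (a b : ℕ+) (x : FinSeq) (l : ℕ+) :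
    restrict a b x l = if a ≤ l ∧ l ≤ b then x l else 0 := Finsupp.filter_apply _ _ _

theorem support_restrict_subset (a b : ℕ+) (x : FinSeq) :
    (restrict a b x).support ⊆ x.support := fun l hl => by
  rw [Finsupp.mem_support_iff, restrict_apply] at hl
  exact Finsupp.mem_support_iff.2 fun h => hl (by simp [h])

theorem restrict_sum {d : ℕ} (a b : ℕ+) (c : ℝ) (γ : Fin d → ℝ) (z : Fin d → FinSeq) :
    restrict a b (c • ∑ i, γ i • z i) = c • ∑ i, γ i • restrict a b (z i) := by
  ext l
  simp only [restrict_apply, Finsupp.smul_apply, Finsupp.finsetSum_apply]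
  split_ifs <;> simp

theorem sum_rpow_le_of_lqNorm_le (hq : 0 < q) {d : ℕ} {γ : Fin d → ℚ} {C : ℝ}
    (h : lqNorm q γ ≤ C) : ∑ i, |(γ i : ℝ)| ^ q ≤ C ^ q := by
  have h0 : 0 ≤ ∑ i, |(γ i : ℝ)| ^ q := Finset.sum_nonneg fun i _ => by positivity
  calc ∑ i, |(γ i : ℝ)| ^ q = (lqNorm q γ) ^ q := by
        rw [lqNorm, ← Real.rpow_mul h0, one_div_mul_cancel hq.ne', Real.rpow_one]
    _ ≤ C ^ q := Real.rpow_le_rpow (Real.rpow_nonneg h0 _) h hq.le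

theorem abs_le_of_sum_rpow_le (hq : 0 < q) {d : ℕ} {γ : Fin d → ℝ} {C : ℝ} (hC : 0 ≤ C)
    (h : ∑ i, |γ i| ^ q ≤ C ^ q) (i : Fin d) : |γ i| ≤ C := by
  refine (Real.rpow_le_rpow_iff (abs_nonneg _) hC hq).1 (le_trans ?_ h)
  exact Finset.single_le_sum (f := fun i => |γ i| ^ q) (fun i _ => by positivity)
    (Finset.mem_univ i)

theorem IsAdmissible.exists_min {N d : ℕ} {x : Fin d → FinSeq} (h : IsAdmissible N x) :
    ∃ κ : Fin d → ℕ+, StrictMono κ ∧ Finset.univ.image κ ∈ schreier N ∧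
      (∀ i, ∀ l ∈ (x i).support, κ i ≤ l) ∧ IsSuccessive x := by
  obtain ⟨⟨-, hs⟩, κ, hκ, hS⟩ := h
  exact ⟨κ, fun i j hij => hs i j hij _ (hκ i).1 _ (hκ j).1, hS, fun i l hl => (hκ i).2 hl, hs⟩

/-- Every functional in a Schreier norming set admits an analysis. -/
theorem exists_isAnalysis {p : ℝ} (hpq : p.HolderConjugate q) (hr : Rates m n f s)
    {𝒩 : NormingSet} (h𝒩 : IsSchreierNorming m n p q 𝒩) {x : FinSeq} (hx : x ∈ 𝒩.carrier) :
    ∃ Q, IsAnalysis m n q x Q := by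
  have hq : 0 < q := hpq.symm.pos
  have hm1 : (4 : ℝ) ≤ m 1 := by exact_mod_cast hr.m_one
  -- The tree is finite because passing to a descendant divides by a coefficient of modulus at most
  -- `1/2`: the coordinates at least double, and they are bounded by `1`.
  have key : ∀ N : ℕ, ∀ x ∈ 𝒩.carrier, (∀ l ∈ x.support, (1 / 2 : ℝ) ^ N < |x l|) →
      ∃ Q, IsAnalysis m n q x Q := by
    intro N
    induction N with
    | zero =>
      intro x hx hl
      have : x = 0 := Finsupp.support_eq_empty.1 (Finset.eq_empty_of_forall_notMem fun l h =>
        absurd (hl l h) (by simpa using 𝒩.abs_apply_le x hx l))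
      exact this ▸ ⟨_, isAnalysis_zero hq⟩
    | succ N ih =>
      have child : ∀ (c : ℝ) (y : FinSeq), y ∈ 𝒩.carrier → |c| ≤ 1 / 2 →
          (∀ l ∈ y.support, (1 / 2 : ℝ) ^ (N + 1) < |c * y l|) → ∃ Q, IsAnalysis m n q y Q := by
        refine fun c y hy hc hl => ih y hy fun l h => ?_
        have h1 := hl l h
        have h2 : |c| * |y l| ≤ 1 / 2 * |y l| := by gcongr
        rw [abs_mul, pow_succ] at h1
        linarith
      intro x hx hl
      rcases h𝒩.2 x hx with ⟨k, hk, d, γ, z, hγ, hz, hzN, rfl⟩ |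
        ⟨k, d, γ, a, b, z, j, hγ, hz, hj, hzj, rfl⟩ | ⟨i, h⟩
      · obtain ⟨κ, hκ, hS, hle, hs⟩ := hz.exists_min
        have hγ' := sum_rpow_le_of_lqNorm_le hq hγ
        suffices h : ∀ i, (γ i : ℝ) ≠ 0 → ∃ R, IsAnalysis m n q (z i) R by
          obtain ⟨Q, hQ, -⟩ := isAnalysis_even hq hr hk hκ hS hle hs (by simpa using hγ') h
          exact ⟨Q, hQ⟩
        intro i hi
        have hw : (2 : ℝ) ≤ m (2 * k) := by
          simpa only [weight, if_neg (Nat.one_le_iff_ne_zero.1 hk)] using hr.weight_gt k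
        refine child (1 / (m (2 * k) : ℝ) * γ i) _ (hzN i) ?_ fun l hli => ?_
        · rw [abs_mul, abs_of_nonneg (by positivity)]
          have h1 := abs_le_of_sum_rpow_le hq zero_le_one hγ' i
          have h2 : 1 / (m (2 * k) : ℝ) ≤ 1 / 2 := by gcongr
          calc _ ≤ 1 / 2 * (1 : ℝ) := by gcongr
            _ = 1 / 2 := by norm_num
        · have h1 := hs.sum_apply (1 / (m (2 * k) : ℝ)) (fun i => (γ i : ℝ)) hli
          have h2 := hl l (by
            rw [Finsupp.mem_support_iff, h1]
            have := Finsupp.mem_support_iff.1 hli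
            positivity)
          rwa [h1, ← mul_assoc] at h2
      · obtain ⟨-, -, -, -, hs⟩ := hz.exists_min
        have hγ' : ∑ i, |(γ i : ℝ)| ^ q ≤ 2 ^ q := by
          refine sum_rpow_le_of_lqNorm_le hq (hγ.trans ?_)
          calc (2 : ℝ) ^ (1 / p) ≤ 2 ^ (1 : ℝ) := by
                refine Real.rpow_le_rpow_of_exponent_le (by norm_num) ?_
                rw [div_le_one hpq.pos]; exact hpq.lt.le
            _ = 2 := Real.rpow_one 2
        have hs' : IsSuccessive fun i => restrict a b (z i) := fun i i' hii u hu v hv =>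
          hs i i' hii u (support_restrict_subset _ _ _ hu) v (support_restrict_subset _ _ _ hv)
        refine isAnalysis_odd hq hr hs' hγ' hj fun i hi => ?_
        -- The induction hypothesis is applied to the grandchildren: an analysis of the child is
        -- needed in which `Q` is at least its weight `m_{2 j_i}`, so it is rebuilt with that root.
        -- The interval restriction is moved inside to the grandchildren, which stay in `𝒩`.
        obtain ⟨hji, e, δ, y, hδ, hy, hyN, hzy⟩ := hzj i
        obtain ⟨κ, hκ, hS, hle, ht⟩ := hy.exists_min
        have hδ' := sum_rpow_le_of_lqNorm_le hq hδ
        have ht' : IsSuccessive fun i => restrict a b (y i) := fun i i' hii u hu v hv =>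
          ht i i' hii u (support_restrict_subset _ _ _ hu) v (support_restrict_subset _ _ _ hv)
        have hres : restrict a b (z i) =
            (1 / (m (2 * j i) : ℝ)) • ∑ u, (δ u : ℝ) • restrict a b (y u) := by
          rw [hzy, restrict_sum]
        rw [hres]
        refine isAnalysis_even hq hr hji hκ hS
          (fun u l hl => hle u l (support_restrict_subset _ _ _ hl)) ht' (by simpa using hδ')
          fun u hu => ?_
        have hw : (2 : ℝ) ≤ m (2 * j i) := by
          simpa only [weight, if_neg (Nat.one_le_iff_ne_zero.1 hji)] using hr.weight_gt (j i)
        have hmk : (4 : ℝ) ≤ m (2 * k + 1) := hm1.trans (by exact_mod_cast hr.m_odd k)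
        refine child (1 / (m (2 * k + 1) : ℝ) * γ i * (1 / (m (2 * j i) : ℝ) * δ u)) _
          (𝒩.restrict_mem _ (hyN u) a b) ?_ fun l hlu => ?_
        · have h1 := abs_le_of_sum_rpow_le hq zero_le_two hγ' i
          have h2 := abs_le_of_sum_rpow_le hq zero_le_one hδ' u
          have h3 : 1 / (m (2 * k + 1) : ℝ) ≤ 1 / 4 := by gcongr
          have h4 : 1 / (m (2 * j i) : ℝ) ≤ 1 / 2 := by gcongr
          simp only [abs_mul]
          rw [abs_of_nonneg (by positivity : (0 : ℝ) ≤ 1 / (m (2 * k + 1) : ℝ)),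
            abs_of_nonneg (by positivity : (0 : ℝ) ≤ 1 / (m (2 * j i) : ℝ))]
          calc _ ≤ 1 / 4 * 2 * (1 / 2 * (1 : ℝ)) := by gcongr
            _ ≤ 1 / 2 := by norm_num
        · have h1 := ht'.sum_apply (1 / (m (2 * j i) : ℝ)) (fun u => (δ u : ℝ)) hlu
          rw [← hres] at h1
          have hne : restrict a b (z i) l ≠ 0 := by
            rw [h1]
            have := Finsupp.mem_support_iff.1 hlu
            have : (δ u : ℝ) ≠ 0 := hu
            positivity
          have h2 := hs'.sum_apply (1 / (m (2 * k + 1) : ℝ)) (fun i => (γ i : ℝ))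
            (Finsupp.mem_support_iff.2 hne)
          have h3 := hl l (by
            rw [Finsupp.mem_support_iff, h2]
            positivity)
          rw [h2, h1] at h3
          refine h3.trans_eq ?_
          congr 1
          ring
      · refine ⟨_, isAnalysis_of_support_subset (i := i) ?_ (𝒩.abs_apply_le x hx i) hq⟩
        rcases h with rfl | rfl
        · exact Finsupp.support_single_subset
        · rw [Finsupp.support_neg]; exact Finsupp.support_single_subset
  obtain ⟨N, hN⟩ : ∃ N : ℕ, ∀ l ∈ x.support, (1 / 2 : ℝ) ^ N < |x l| := by
    have : ∀ l ∈ x.support, ∀ᶠ N : ℕ in Filter.atTop, (1 / 2 : ℝ) ^ N < |x l| := fun l hl =>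
      (tendsto_pow_atTop_nhds_zero_of_lt_one (by norm_num) (by norm_num)).eventually
        (gt_mem_nhds (abs_pos.2 (Finsupp.mem_support_iff.1 hl)))
    exact ((Filter.eventually_all_finset _).2 this).exists
  exact key N x hx hN

end SchreierSpace

namespace SchreierSpace

/-! ### Functionals with rational coefficients in the norming set -/

/-- The finitely supported sequence which equals `g` on `A` and vanishes off `A`. -/
noncomputable def ofFinset (A : Finset ℕ+) (g : ℕ+ → ℝ) : FinSeq :=
  ∑ l ∈ A, Finsupp.single l (g l)

theorem ofFinset_apply (A : Finset ℕ+) (g : ℕ+ → ℝ) (l : ℕ+) :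
    ofFinset A g l = if l ∈ A then g l else 0 := by
  simp [ofFinset, Finsupp.finsetSum_apply, Finsupp.single_apply]

theorem support_ofFinset_subset (A : Finset ℕ+) (g : ℕ+ → ℝ) : (ofFinset A g).support ⊆ A :=
  fun l hl => by
    by_contra h
    exact Finsupp.mem_support_iff.1 hl (by rw [ofFinset_apply, if_neg h])

theorem pairing_eq_sum_right (x a : FinSeq) {S : Finset ℕ+} (h : a.support ⊆ S) :
    pairing x a = ∑ l ∈ S, x l * a l :=
  Finsupp.sum_of_support_subset _ h _ (by simp)

theorem pairing_eq_sum_left (x a : FinSeq) {S : Finset ℕ+} (h : x.support ⊆ S) :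
    pairing x a = ∑ l ∈ S, x l * a l := by
  rw [pairing_eq_sum_right x a (Finset.subset_union_left (s₂ := S))]
  refine (Finset.sum_subset Finset.subset_union_right fun l _ hl => ?_).symm
  rw [Finsupp.notMem_support_iff.1 fun h' => hl (h h'), zero_mul]

variable {m n f s : ℕ → ℕ} {p q : ℝ} {𝒩 : NormingSet}

theorem even_mem (h𝒩 : IsSchreierNorming m n p q 𝒩) {k : ℕ} (hk : 1 ≤ k) {K : Finset ℕ+}
    (hK : K ∈ schreier (n (2 * k))) {x : ℕ+ → FinSeq} {γ : ℕ+ → ℚ}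
    (hx : ∀ κ ∈ K, x κ ∈ 𝒩.carrier) (hx0 : ∀ κ ∈ K, x κ ≠ 0)
    (hle : ∀ κ ∈ K, ∀ l ∈ (x κ).support, κ ≤ l)
    (hlt : ∀ κ ∈ K, ∀ κ' ∈ K, κ < κ' → ∀ l ∈ (x κ).support, ∀ l' ∈ (x κ').support, l < l')
    (hq : 0 < q) (hγ : ∑ κ ∈ K, |(γ κ : ℝ)| ^ q ≤ 1) :
    (1 / (m (2 * k) : ℝ)) • ∑ κ ∈ K, (γ κ : ℝ) • x κ ∈ 𝒩.carrier := by
  let e := K.orderEmbOfFin rfl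
  have he : ∀ i, e i ∈ K := K.orderEmbOfFin_mem rfl
  have himg : Finset.univ.image e = K := by
    ext κ
    have : κ ∈ Set.range e ↔ κ ∈ K := by simp [e]
    simpa using this
  have hsum : ∀ {M : Type} [AddCommMonoid M] (F : ℕ+ → M), ∑ i, F (e i) = ∑ κ ∈ K, F κ :=
    fun F => by
      conv_rhs => rw [← himg]
      rw [Finset.sum_image fun i _ j _ h => e.injective h]
  have hmin : ∀ κ ∈ K, ∃ l, IsLeast (↑(x κ).support : Set ℕ+) l := fun κ hκ =>
    ⟨_, Finset.isLeast_min' _ (Finsupp.support_nonempty_iff.2 (hx0 κ hκ))⟩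
  choose! φ hφ using hmin
  refine h𝒩.1 k hk ⟨K.card, fun i => γ (e i), fun i => x (e i), ?_,
    ⟨⟨fun i => hx0 _ (he i), fun i j hij => hlt _ (he i) _ (he j) (e.lt_iff_lt.2 hij)⟩,
      fun i => φ (e i), fun i => hφ _ (he i), ?_⟩, fun i => hx _ (he i), ?_⟩
  · rw [lqNorm, hsum fun κ => |(γ κ : ℝ)| ^ q]
    exact Real.rpow_le_one (Finset.sum_nonneg fun _ _ => by positivity) hγ (by positivity)
  · have := schreier_image_mem hK φ (fun κ hκ => hle κ hκ _ (hφ κ hκ).1)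
      fun κ hκ κ' hκ' h => hlt κ hκ κ' hκ' h _ (hφ κ hκ).1 _ (hφ κ' hκ').1
    rw [← himg, Finset.image_image] at this
    exact this
  · rw [hsum fun κ => (γ κ : ℝ) • x κ]

/-- The slack `1 - ∑ σ` is shared out among the terms, which leaves room for rational approximations
of `σ κ ^ (1/q)` from above. They replace the `ℓ_q` norms of pieces of a vector, which may be
irrational. -/
theorem exists_rat_rpow {ι : Type*} (K : Finset ι) {σ : ι → ℝ} (hσ : ∀ κ, 0 ≤ σ κ) (hq : 0 < q)
    (h : ∑ κ ∈ K, σ κ < 1) : ∃ δ : ι → ℚ, (∀ κ, 0 < δ κ) ∧ (∀ κ, σ κ < (δ κ : ℝ) ^ q) ∧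
      ∑ κ ∈ K, |(δ κ : ℝ)| ^ q ≤ 1 := by
  set η := (1 - ∑ κ ∈ K, σ κ) / (K.card + 1) with hη
  have hη0 : 0 < η := div_pos (by linarith) (by positivity)
  have hη1 : K.card * η ≤ 1 - ∑ κ ∈ K, σ κ := by
    rw [hη, mul_div_assoc', div_le_iff₀ (by positivity)]
    nlinarith
  have hex : ∀ κ, ∃ δ : ℚ, σ κ ^ (1 / q) < δ ∧ (δ : ℝ) < (σ κ + η) ^ (1 / q) := fun κ =>
    exists_rat_btwn (Real.rpow_lt_rpow (hσ κ) (by linarith) (by positivity))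
  choose δ hδ1 hδ2 using hex
  have hinv : ∀ r : ℝ, 0 ≤ r → (r ^ (1 / q)) ^ q = r := fun r hr => by
    rw [← Real.rpow_mul hr, one_div_mul_cancel hq.ne', Real.rpow_one]
  have hδ0 : ∀ κ, (0 : ℝ) < δ κ := fun κ => (Real.rpow_nonneg (hσ κ) _).trans_lt (hδ1 κ)
  refine ⟨δ, fun κ => by exact_mod_cast hδ0 κ, fun κ => ?_, ?_⟩
  · have := Real.rpow_lt_rpow (Real.rpow_nonneg (hσ κ) _) (hδ1 κ) hq
    rwa [hinv _ (hσ κ)] at this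
  · calc ∑ κ ∈ K, |(δ κ : ℝ)| ^ q ≤ ∑ κ ∈ K, (σ κ + η) := by
          refine Finset.sum_le_sum fun κ _ => ?_
          rw [abs_of_pos (hδ0 κ)]
          have := Real.rpow_le_rpow (hδ0 κ).le (hδ2 κ).le hq.le
          rwa [hinv _ (by linarith [hσ κ])] at this
      _ = ∑ κ ∈ K, σ κ + K.card * η := by simp [Finset.sum_add_distrib]
      _ ≤ 1 := by linarith

/-- The product of the weights `m_{2l}`, `l ∈ L`. -/
noncomputable def listWeight (m : ℕ → ℕ) (L : List ℕ) : ℝ := (L.map fun l => (m (2 * l) : ℝ)).prod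

/-- The sum of the costs `n_{2l}`, `l ∈ L`. -/
def listCost (n : ℕ → ℕ) (L : List ℕ) : ℕ := (L.map fun l => n (2 * l)).sum

/-- The functional with the rational coefficients `γ` on `A`, `ℓ_q` norm below one and weight
`listWeight m L` belongs to the norming set. -/
def Buildable (m n : ℕ → ℕ) (q : ℝ) (𝒩 : NormingSet) (L : List ℕ) : Prop :=
  ∀ (A : Finset ℕ+) (γ : ℕ+ → ℚ), A ∈ schreier (listCost n L) → (∀ l ∈ A, γ l ≠ 0) →
    ∑ l ∈ A, |(γ l : ℝ)| ^ q < 1 →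
    (1 / listWeight m L) • ofFinset A (fun l => (γ l : ℝ)) ∈ 𝒩.carrier

/-- Splits `A` into sets `V κ` with minima in `S_N` and normalizes the coefficients on `V κ` by a
rational `δ κ` slightly above their `ℓ_q` norm. The strict inequality in `Buildable` survives on
each piece. -/
theorem Buildable.exists_decomposition {L : List ℕ} (hL : Buildable m n q 𝒩 L)
    (hL0 : 0 < listWeight m L) (hq : 0 < q) {N : ℕ} {A : Finset ℕ+} {γ : ℕ+ → ℚ}
    (hA : A ∈ schreier (N + listCost n L)) (hγ : ∀ l ∈ A, γ l ≠ 0)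
    (hsum : ∑ l ∈ A, |(γ l : ℝ)| ^ q < 1) :
    ∃ (K : Finset ℕ+) (δ : ℕ+ → ℚ) (x : ℕ+ → FinSeq), K ∈ schreier N ∧ K ⊆ A ∧
      (∀ κ ∈ K, x κ ∈ 𝒩.carrier) ∧ (∀ κ ∈ K, x κ ≠ 0) ∧ (∀ κ ∈ K, (x κ).support ⊆ A) ∧
      (∀ κ ∈ K, ∀ l ∈ (x κ).support, κ ≤ l) ∧
      (∀ κ ∈ K, ∀ κ' ∈ K, κ < κ' → ∀ l ∈ (x κ).support, ∀ l' ∈ (x κ').support, l < l') ∧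
      ∑ κ ∈ K, |(δ κ : ℝ)| ^ q ≤ 1 ∧
      (1 / listWeight m L) • ofFinset A (fun l => (γ l : ℝ)) = ∑ κ ∈ K, (δ κ : ℝ) • x κ := by
  obtain ⟨K, V, hK, hV, hmem, hle, hlt, rfl⟩ := exists_schreier_split hA
  have hdisj : (K : Set ℕ+).PairwiseDisjoint V := by
    intro κ hκ κ' hκ' hne
    refine Finset.disjoint_left.2 fun l hl hl' => ?_
    rcases lt_or_gt_of_ne hne with h | h
    · exact lt_irrefl _ (hlt κ hκ κ' hκ' h l hl l hl')
    · exact lt_irrefl _ (hlt κ' hκ' κ hκ h l hl' l hl)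
  have hVA : ∀ κ ∈ K, V κ ⊆ K.biUnion V := fun κ hκ => Finset.subset_biUnion_of_mem V hκ
  rw [Finset.sum_biUnion hdisj] at hsum
  obtain ⟨δ, hδ0, hδ, hδ1⟩ := exists_rat_rpow K
    (fun κ => Finset.sum_nonneg fun l (_ : l ∈ V κ) =>
      Real.rpow_nonneg (abs_nonneg ((γ l : ℝ))) q) hq hsum
  have hδ0' : ∀ κ, (0 : ℝ) < δ κ := fun κ => by exact_mod_cast hδ0 κ
  have happ : ∀ κ l, ((1 / listWeight m L) • ofFinset (V κ) (fun l => ((γ l / δ κ : ℚ) : ℝ))) l =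
      1 / listWeight m L * if l ∈ V κ then (γ l : ℝ) / δ κ else 0 := fun κ l => by
    simp [ofFinset_apply]
  have hsupp : ∀ κ, ((1 / listWeight m L) •
      ofFinset (V κ) (fun l => ((γ l / δ κ : ℚ) : ℝ))).support ⊆ V κ := fun κ =>
    Finsupp.support_smul.trans (support_ofFinset_subset _ _)
  refine ⟨K, δ, fun κ => (1 / listWeight m L) • ofFinset (V κ) (fun l => ((γ l / δ κ : ℚ) : ℝ)),
    hK, fun κ hκ => hVA κ hκ (hmem κ hκ), fun κ hκ => ?_, fun κ hκ h => ?_,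
    fun κ hκ => (hsupp κ).trans (hVA κ hκ), fun κ hκ l hl => hle κ hκ l (hsupp κ hl),
    fun κ hκ κ' hκ' h l hl l' hl' => hlt κ hκ κ' hκ' h l (hsupp κ hl) l' (hsupp κ' hl'), hδ1, ?_⟩
  · refine hL _ _ (hV κ hκ) (fun l hl => div_ne_zero (hγ l (hVA κ hκ hl)) (hδ0 κ).ne') ?_
    have : ∀ l, |((γ l / δ κ : ℚ) : ℝ)| ^ q = |(γ l : ℝ)| ^ q / (δ κ : ℝ) ^ q := fun l => by
      push_cast
      rw [abs_div, abs_of_pos (hδ0' κ), Real.div_rpow (abs_nonneg _) (hδ0' κ).le]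
    simp only [this]
    rw [← Finset.sum_div, div_lt_one (Real.rpow_pos_of_pos (hδ0' κ) _)]
    exact hδ κ
  · have h1 := happ κ κ
    dsimp only at h
    rw [h, if_pos (hmem κ hκ), Finsupp.zero_apply] at h1
    have h2 : (γ κ : ℝ) ≠ 0 := by exact_mod_cast hγ κ (hVA κ hκ (hmem κ hκ))
    exact (mul_ne_zero (one_div_pos.2 hL0).ne' (div_ne_zero h2 (hδ0' κ).ne')) h1.symm
  · have h1 : ofFinset (K.biUnion V) (fun l => (γ l : ℝ)) =
        ∑ κ ∈ K, ofFinset (V κ) (fun l => (γ l : ℝ)) := Finset.sum_biUnion hdisj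
    rw [h1, Finset.smul_sum]
    refine Finset.sum_congr rfl fun κ _ => ?_
    ext l
    rw [Finsupp.smul_apply, Finsupp.smul_apply, happ, ofFinset_apply]
    have := (hδ0' κ).ne'
    simp only [smul_eq_mul]
    split_ifs
    · field_simp
    · simp

theorem Rates.listWeight_pos (hr : Rates m n f s) {L : List ℕ} (hL : ∀ l ∈ L, 1 ≤ l) :
    0 < listWeight m L := by
  refine List.prod_pos fun r hr' => ?_
  obtain ⟨l, hl, rfl⟩ := List.mem_map.1 hr'
  have := hr.m_even l (hL l hl)
  exact_mod_cast (Nat.pow_pos (by norm_num)).trans_le this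

/-- Each weight of the list is one even operation, applied to the pieces that the rest of the list
builds; the last weight acts on unit vectors. -/
theorem buildable (h𝒩 : IsSchreierNorming m n p q 𝒩) (hq : 0 < q) (hr : Rates m n f s)
    (L : List ℕ) (hL0 : L ≠ []) (hL : ∀ l ∈ L, 1 ≤ l) : Buildable m n q 𝒩 L := by
  induction L with
  | nil => exact absurd rfl hL0
  | cons k L ih =>
    intro A γ hA hγ hsum
    have hk : 1 ≤ k := hL k (by simp)
    rcases eq_or_ne L [] with rfl | hne
    · have := even_mem h𝒩 hk (K := A) (by simpa [listCost] using hA)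
        (x := fun l => Finsupp.single l 1) (γ := γ) (fun l _ => 𝒩.single_mem l)
        (fun l _ => by simp) (fun l _ l' hl' => ?_) (fun l _ l' _ hll a ha b hb => ?_) hq hsum.le
      · convert this using 2
        · simp [listWeight]
        · simp [ofFinset]
      · rw [Finset.mem_singleton.1 (Finsupp.support_single_subset hl')]
      · rwa [Finset.mem_singleton.1 (Finsupp.support_single_subset ha),
          Finset.mem_singleton.1 (Finsupp.support_single_subset hb)]
    · have hL' : ∀ l ∈ L, 1 ≤ l := fun l hl => hL l (by simp [hl])
      obtain ⟨K, δ, x, hK, -, hx, hx0, -, hle, hlt, hδ, heq⟩ :=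
        (ih hne hL').exists_decomposition (hr.listWeight_pos hL') hq (N := n (2 * k))
          (by simpa [listCost] using hA) hγ hsum
      have := even_mem h𝒩 hk hK hx hx0 hle hlt hq hδ
      rw [← heq, smul_smul] at this
      convert this using 2
      simp [listWeight, mul_comm]

/-! ### Vectors with small norm -/

theorem sum_mul_le_of_rpow (hpq : p.HolderConjugate q) {S : Finset ℕ+} {u v : ℕ+ → ℝ} {e : ℝ}
    (hu : ∀ l ∈ S, 0 ≤ u l) (hv : ∀ l ∈ S, 0 ≤ v l) (he : 0 ≤ e) (hu1 : ∑ l ∈ S, u l ^ q ≤ 1)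
    (hv1 : ∑ l ∈ S, v l ^ p ≤ e ^ p) : ∑ l ∈ S, u l * v l ≤ e := by
  have h1 : 0 ≤ ∑ l ∈ S, u l ^ q := Finset.sum_nonneg fun l hl => Real.rpow_nonneg (hu l hl) _
  have h2 : 0 ≤ ∑ l ∈ S, v l ^ p := Finset.sum_nonneg fun l hl => Real.rpow_nonneg (hv l hl) _
  have hp := hpq.pos
  have hq := hpq.symm.pos
  calc ∑ l ∈ S, u l * v l ≤ (∑ l ∈ S, u l ^ q) ^ (1 / q) * (∑ l ∈ S, v l ^ p) ^ (1 / p) :=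
        Real.inner_le_Lp_mul_Lq_of_nonneg S hpq.symm hu hv
    _ ≤ 1 * (e ^ p) ^ (1 / p) := by
        gcongr
        exact Real.rpow_le_one h1 hu1 (by positivity)
    _ = e := by rw [one_mul, ← Real.rpow_mul he, mul_one_div_cancel hp.ne', Real.rpow_one]

/-- Where `Q ≥ M`, `|x_l| ≤ |x_l| Q_l / M` and Hölder's inequality gives `1/M`. Where `Q < M` there
are at most `i ^ a` colour classes in `S_G`, each of mass at most `(1/(i^a M))^p`, and Hölder's
inequality on each class again gives `1/M` in total. -/
theorem sum_mul_le_of_isAnalysis (hpq : p.HolderConjugate q) {x : FinSeq} {Q : ℕ+ → ℝ}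
    (hQ : IsAnalysis m n q x Q) {A : Finset ℕ+} {μ : ℕ+ → ℝ} {G i a : ℕ} (hi : 1 ≤ i) {M : ℝ}
    (hM : 1 ≤ M) (hMi : M = m (2 * i)) (ha : M ≤ 2 ^ a)
    (hb : Budget (weight m) (cost n) i M G)
    (hμ : IsAverage G ((1 / ((i ^ a : ℕ) * M)) ^ p) A μ) :
    ∑ l ∈ A, x l * μ l ^ (1 / p) ≤ 2 / M := by
  have hp := hpq.pos
  have hq := hpq.symm.pos
  have hM0 : 0 < M := by linarith
  have hia : (0 : ℝ) < (i ^ a : ℕ) := by exact_mod_cast Nat.pow_pos hi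
  obtain ⟨χ, hχ, hcol⟩ := hQ.colorable i a M G hi hMi.le ha hb
  have hμp : ∀ l ∈ A, (μ l ^ (1 / p)) ^ p = μ l := fun l hl => by
    rw [← Real.rpow_mul (hμ.pos l hl).le, one_div_mul_cancel hp.ne', Real.rpow_one]
  have hμ0 : ∀ l ∈ A, 0 ≤ μ l ^ (1 / p) := fun l hl => Real.rpow_nonneg (hμ.pos l hl).le _
  have hQ0 : ∀ l ∈ x.support, 0 ≤ |x l| * Q l := fun l hl =>
    mul_nonneg (abs_nonneg _) (zero_le_one.trans (hQ.one_le l hl))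
  have hsub : ∀ S ⊆ x.support, ∑ l ∈ S, (|x l| * Q l) ^ q ≤ 1 := fun S hS =>
    (Finset.sum_le_sum_of_subset_of_nonneg hS fun l hl _ =>
      Real.rpow_nonneg (hQ0 l hl) _).trans hQ.sum_le
  have hx1 : ∀ S ⊆ x.support, ∑ l ∈ S, |x l| ^ q ≤ 1 := fun S hS =>
    (Finset.sum_le_sum fun l hl => Real.rpow_le_rpow (abs_nonneg _)
      (le_mul_of_one_le_right (abs_nonneg _) (hQ.one_le l (hS hl))) hq.le).trans (hsub S hS)
  set T := A.filter (· ∈ x.support) with hT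
  have hTA : T ⊆ A := Finset.filter_subset _ _
  have hTx : T ⊆ x.support := fun l hl => (Finset.mem_filter.1 hl).2
  have hsmall : ∑ l ∈ T with Q l < M, |x l| * μ l ^ (1 / p) ≤ 1 / M := by
    have hmaps : ∀ l ∈ T.filter (fun l => Q l < M), χ l ∈ Finset.range (i ^ a) := fun l hl => by
      obtain ⟨hl, hlM⟩ := Finset.mem_filter.1 hl
      exact Finset.mem_range.2 (hχ l (hTx hl) hlM)
    rw [← Finset.sum_fiberwise_of_maps_to hmaps]
    calc _ ≤ ∑ c ∈ Finset.range (i ^ a), 1 / ((i ^ a : ℕ) * M) := by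
          refine Finset.sum_le_sum fun c _ => ?_
          have hS : ∀ l ∈ (T.filter fun l => Q l < M).filter (fun l => χ l = c), l ∈ T := fun l hl =>
            (Finset.mem_filter.1 (Finset.mem_filter.1 hl).1).1
          refine sum_mul_le_of_rpow hpq (fun l _ => abs_nonneg _) (fun l hl => hμ0 l (hTA (hS l hl)))
            (by positivity) (hx1 _ fun l hl => hTx (hS l hl)) ?_
          rw [Finset.sum_congr rfl fun l hl => hμp l (hTA (hS l hl))]
          refine le_trans (Finset.sum_le_sum_of_subset_of_nonneg (fun l hl => ?_) fun l hl _ => ?_)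
            (hμ.small _ (hcol c))
          · obtain ⟨h1, h2⟩ := Finset.mem_filter.1 hl
            obtain ⟨h1, h3⟩ := Finset.mem_filter.1 h1
            exact Finset.mem_filter.2 ⟨hTA h1, Finset.mem_filter.2 ⟨hTx h1, h3, h2⟩⟩
          · exact (hμ.pos l (Finset.mem_filter.1 hl).1).le
      _ = 1 / M := by
          rw [Finset.sum_const, Finset.card_range, nsmul_eq_mul]
          field_simp
  have hlarge : ∑ l ∈ T, (|x l| * Q l) * μ l ^ (1 / p) ≤ 1 := by
    refine sum_mul_le_of_rpow hpq (fun l hl => hQ0 l (hTx hl)) (fun l hl => hμ0 l (hTA hl))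
      zero_le_one (hsub T hTx) ?_
    rw [Finset.sum_congr rfl fun l hl => hμp l (hTA hl), Real.one_rpow, ← hμ.sum_eq]
    exact Finset.sum_le_sum_of_subset_of_nonneg hTA fun l hl _ => (hμ.pos l hl).le
  calc ∑ l ∈ A, x l * μ l ^ (1 / p) = ∑ l ∈ T, x l * μ l ^ (1 / p) := by
        refine (Finset.sum_subset hTA fun l hl hlT => ?_).symm
        rw [Finsupp.notMem_support_iff.1 fun h => hlT (Finset.mem_filter.2 ⟨hl, h⟩), zero_mul]
    _ ≤ ∑ l ∈ T, ((if Q l < M then |x l| * μ l ^ (1 / p) else 0) +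
          1 / M * (|x l| * Q l * μ l ^ (1 / p))) := by
        refine Finset.sum_le_sum fun l hl => ?_
        have h1 : x l * μ l ^ (1 / p) ≤ |x l| * μ l ^ (1 / p) :=
          mul_le_mul_of_nonneg_right (le_abs_self _) (hμ0 l (hTA hl))
        have h2 : 0 ≤ 1 / M * (|x l| * Q l * μ l ^ (1 / p)) :=
          mul_nonneg (by positivity) (mul_nonneg (hQ0 l (hTx hl)) (hμ0 l (hTA hl)))
        split_ifs with h
        · linarith
        · rw [not_lt] at h
          have h3 : 1 ≤ Q l / M := by rwa [one_le_div hM0]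
          have h4 : 0 ≤ |x l| * μ l ^ (1 / p) := mul_nonneg (abs_nonneg _) (hμ0 l (hTA hl))
          have h5 : 1 / M * (|x l| * Q l * μ l ^ (1 / p)) =
            (|x l| * μ l ^ (1 / p)) * (Q l / M) := by ring
          rw [h5, zero_add]
          exact h1.trans (le_mul_of_one_le_right h4 h3)
    _ = ∑ l ∈ T with Q l < M, |x l| * μ l ^ (1 / p) +
          1 / M * ∑ l ∈ T, (|x l| * Q l) * μ l ^ (1 / p) := by
        rw [Finset.sum_add_distrib, Finset.mul_sum, ← Finset.sum_filter]
    _ ≤ 1 / M + 1 / M * 1 := by gcongr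
    _ = 2 / M := by ring

theorem exists_block (h𝒩 : IsSchreierNorming m n p q 𝒩) (hpq : p.HolderConjugate q)
    (hr : Rates m n f s) {i : ℕ} (hi : 2 ≤ i) (N : ℕ) :
    ∃ (A : Finset ℕ+) (γ : ℕ+ → ℚ) (α : ℕ+ → ℝ), A ∈ schreier (f i + 1) ∧ A.Nonempty ∧
      (∀ l ∈ A, N ≤ (l : ℕ)) ∧ (∀ l ∈ A, γ l ≠ 0) ∧ ∑ l ∈ A, |(γ l : ℝ)| ^ q < 1 ∧
      1 / 2 ≤ ∑ l ∈ A, (γ l : ℝ) * α l ∧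
      ∀ x ∈ 𝒩.carrier, ∑ l ∈ A, x l * α l ≤ 2 / m (2 * i) := by
  have hp := hpq.pos
  have hq := hpq.symm.pos
  have hm : 4 ^ i ≤ m (2 * i) := hr.m_even i (by omega)
  have hm1 : 1 ≤ m (2 * i) := (Nat.pow_pos (by norm_num)).trans_le hm
  have hM1 : (1 : ℝ) ≤ m (2 * i) := by exact_mod_cast hm1
  have hMa : (m (2 * i) : ℝ) ≤ 2 ^ m (2 * i) := by exact_mod_cast Nat.lt_two_pow_self.le
  have hiM : (0 : ℝ) < (i ^ m (2 * i) : ℕ) := by exact_mod_cast Nat.pow_pos (by omega)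
  obtain ⟨A, μ, hμ, hA⟩ := exists_isAverage (f i)
    ((1 / ((i ^ m (2 * i) : ℕ) * (m (2 * i) : ℝ))) ^ p) (by positivity) N
  have hne : A.Nonempty := by
    rw [Finset.nonempty_iff_ne_empty]
    rintro rfl
    simpa using hμ.sum_eq
  have hμq : ∀ l ∈ A, (μ l ^ (1 / q)) ^ q = μ l := fun l hl => by
    rw [← Real.rpow_mul (hμ.pos l hl).le, one_div_mul_cancel hq.ne', Real.rpow_one]
  -- Strictly below `μ ^ (1/q)` for the strict norm bound, above half of it for the pairing with `μ
  -- ^ (1/p)`.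
  have hex : ∀ l ∈ A, ∃ γ : ℚ, μ l ^ (1 / q) / 2 < γ ∧ (γ : ℝ) < μ l ^ (1 / q) := fun l hl =>
    exists_rat_btwn (half_lt_self (Real.rpow_pos_of_pos (hμ.pos l hl) _))
  choose! γ hγ1 hγ2 using hex
  have hγ0 : ∀ l ∈ A, (0 : ℝ) < γ l := fun l hl =>
    (half_pos (Real.rpow_pos_of_pos (hμ.pos l hl) _)).trans (hγ1 l hl)
  refine ⟨A, γ, fun l => μ l ^ (1 / p), hμ.mem, hne, hA,
    fun l hl h => (hγ0 l hl).ne' (by simp [h]), ?_, ?_, fun x hx => ?_⟩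
  · rw [← hμ.sum_eq]
    refine Finset.sum_lt_sum_of_nonempty hne fun l hl => ?_
    rw [abs_of_pos (hγ0 l hl)]
    exact (Real.rpow_lt_rpow (hγ0 l hl).le (hγ2 l hl) hq).trans_eq (hμq l hl)
  · calc (1 / 2 : ℝ) = ∑ l ∈ A, 1 / 2 * μ l := by rw [← Finset.mul_sum, hμ.sum_eq, mul_one]
      _ ≤ ∑ l ∈ A, (γ l : ℝ) * μ l ^ (1 / p) := by
        refine Finset.sum_le_sum fun l hl => ?_
        have h1 : μ l = μ l ^ (1 / q) * μ l ^ (1 / p) := by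
          have := hpq.inv_add_inv_eq_one
          rw [← Real.rpow_add (hμ.pos l hl), one_div, one_div, add_comm, this, Real.rpow_one]
        have h2 := Real.rpow_pos_of_pos (hμ.pos l hl) (1 / p)
        calc 1 / 2 * μ l = μ l ^ (1 / q) / 2 * μ l ^ (1 / p) := by
              nth_rw 1 [h1]; ring
          _ ≤ _ := by have := (hγ1 l hl).le; gcongr
  · obtain ⟨Q, hQ⟩ := exists_isAnalysis hpq hr h𝒩 hx
    exact sum_mul_le_of_isAnalysis hpq hQ (by omega) hM1 rfl hMa (hr.budget i hi) hμ

/-- The blocks from which the operator is built. The functional with index `i` has the weight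
`m_{2(i+1)}` and the coefficients `γ i` on `A i`; the coordinates `g k` belong to no block. -/
structure IsBlockSystem (m n f : ℕ → ℕ) (q : ℝ) (𝒩 : NormingSet) (A : ℕ+ → Finset ℕ+)
    (γ : ℕ+ → ℕ+ → ℚ) (α : ℕ+ → ℕ+ → ℝ) (g : ℕ → ℕ+) : Prop where
  mem : ∀ i : ℕ+, A i ∈ schreier (f ((i : ℕ) + 1) + 1)
  nonempty : ∀ i, (A i).Nonempty
  le : ∀ i, ∀ l ∈ A i, i ≤ l
  lt : ∀ i j, i < j → ∀ l ∈ A i, ∀ l' ∈ A j, l < l'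
  ne_zero : ∀ i, ∀ l ∈ A i, γ i l ≠ 0
  sum_lt : ∀ i, ∑ l ∈ A i, |(γ i l : ℝ)| ^ q < 1
  half_le : ∀ i, 1 / 2 ≤ ∑ l ∈ A i, (γ i l : ℝ) * α i l
  sum_mul_le : ∀ i : ℕ+, ∀ x ∈ 𝒩.carrier, ∑ l ∈ A i, x l * α i l ≤ 2 / m (2 * ((i : ℕ) + 1))
  injective : Function.Injective g
  notMem : ∀ i k, g k ∉ A i

theorem exists_isBlockSystem (h𝒩 : IsSchreierNorming m n p q 𝒩) (hpq : p.HolderConjugate q)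
    (hr : Rates m n f s) : ∃ A γ α g, IsBlockSystem m n f q 𝒩 A γ α g := by
  choose A γ α hA using fun (i : ℕ+) (N : ℕ) =>
    exists_block h𝒩 hpq hr (i := (i : ℕ) + 1) (by have := i.pos; omega) N
  -- Block `i` starts at or after `b (i - 1)` and ends at or before `b i - 2`, so the coordinate `b
  -- (k + 1) - 1` is free. The start value `2` makes `k + 2 ≤ b k`, hence `i ≤ A i`.
  let b : ℕ → ℕ := fun k => Nat.rec 2
    (fun k N => (A k.succPNat N).sup (fun l : ℕ+ => (l : ℕ)) + N + 2) k
  have hb : ∀ k, b (k + 1) = (A k.succPNat (b k)).sup (fun l : ℕ+ => (l : ℕ)) + b k + 2 :=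
    fun k => rfl
  have hmono : StrictMono b := strictMono_nat_of_lt_succ fun k => by rw [hb]; omega
  have hk : ∀ k, k + 2 ≤ b k := fun k => by
    induction k with
    | zero => exact le_rfl
    | succ k ih => rw [hb]; omega
  have hge : ∀ (i : ℕ+), ∀ l ∈ A i (b i.natPred), b i.natPred ≤ (l : ℕ) := fun i =>
    (hA i (b i.natPred)).2.2.1
  have hle : ∀ (i : ℕ+), ∀ l ∈ A i (b i.natPred), (l : ℕ) + 2 ≤ b (i.natPred + 1) := by
    intro i l hl
    rw [hb, PNat.succPNat_natPred]
    have := Finset.le_sup (f := fun l : ℕ+ => (l : ℕ)) hl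
    omega
  have hpred : ∀ i : ℕ+, (i : ℕ) = i.natPred + 1 := fun i => (PNat.natPred_add_one i).symm
  refine ⟨fun i => A i (b i.natPred), fun i => γ i (b i.natPred), fun i => α i (b i.natPred),
    fun k => ⟨b (k + 1) - 1, by have := hk (k + 1); omega⟩,
    fun i => (hA i _).1, fun i => (hA i _).2.1, fun i l hl => ?_, fun i j hij l hl l' hl' => ?_,
    fun i => (hA i _).2.2.2.1, fun i => (hA i _).2.2.2.2.1, fun i => (hA i _).2.2.2.2.2.1,
    fun i => (hA i _).2.2.2.2.2.2, fun k k' h => ?_, fun i k h => ?_⟩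
  · have h1 := hge i l hl
    have h2 := hk i.natPred
    have h3 := hpred i
    exact (PNat.coe_le_coe _ _).1 (by omega)
  · have h1 := hle i l hl
    have h2 := hge j l' hl'
    have h3 : i.natPred + 1 ≤ j.natPred := by
      have := hpred i
      have := hpred j
      have : (i : ℕ) < j := hij
      omega
    have h4 := hmono.monotone h3
    exact (PNat.coe_lt_coe _ _).1 (by omega)
  · have h1 : b (k + 1) - 1 = b (k' + 1) - 1 := congrArg PNat.val h
    have h2 := hk (k + 1)
    have h3 := hk (k' + 1)
    have h4 : b (k + 1) = b (k' + 1) := by omega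
    have : k + 1 = k' + 1 := hmono.injective h4
    omega
  · have h1 := hge i _ h
    have h2 := hle i _ h
    simp only [PNat.mk_coe] at h1 h2
    rcases le_or_gt i.natPred k with hik | hik
    · have := hmono.monotone (by omega : i.natPred + 1 ≤ k + 1)
      omega
    · have := hmono.monotone (by omega : k + 1 ≤ i.natPred)
      have := hk (k + 1)
      omega

end SchreierSpace

namespace SchreierSpace

/-! ### The upper estimate -/

variable {m n f s : ℕ → ℕ} {p q : ℝ} {𝒩 : NormingSet} {A : ℕ+ → Finset ℕ+}
  {γ : ℕ+ → ℕ+ → ℚ} {α : ℕ+ → ℕ+ → ℝ} {g : ℕ → ℕ+}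

/-- The functionals given by a block system. -/
noncomputable def blockFunctional (m : ℕ → ℕ) (A : ℕ+ → Finset ℕ+) (γ : ℕ+ → ℕ+ → ℚ) (i : ℕ+) :
    FinSeq :=
  (1 / (m (2 * ((i : ℕ) + 1)) : ℝ)) • ofFinset (A i) fun l => (γ i l : ℝ)

theorem support_blockFunctional_subset (i : ℕ+) : (blockFunctional m A γ i).support ⊆ A i :=
  Finsupp.support_smul.trans (support_ofFinset_subset _ _)

namespace IsBlockSystem

theorem blockFunctional_mem (h𝒩 : IsSchreierNorming m n p q 𝒩) (hq : 0 < q) (hr : Rates m n f s)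
    (h : IsBlockSystem m n f q 𝒩 A γ α g) (i : ℕ+) : blockFunctional m A γ i ∈ 𝒩.carrier := by
  have hi : 2 ≤ (i : ℕ) + 1 := by have := i.pos; omega
  have := buildable h𝒩 hq hr [(i : ℕ) + 1] (by simp) (by simp) (A i) (γ i) ?_ (h.ne_zero i)
    (h.sum_lt i)
  · simpa [listWeight, blockFunctional] using this
  · refine schreier_mono ?_ (h.mem i)
    have h1 := hr.f_lt _ hi
    have h2 := hr.f_pos _ hi
    simp only [listCost, List.map_cons, List.map_nil, List.sum_cons, List.sum_nil]
    omega

/-- The factors of `m_{2(i+1)} / m_{2j}` cost at least `f_{i+1} - f_j`. As `n_{2j} > 4 f_j` and `f_j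
≥ 1`, the set `A i ∈ S_{f_{i+1}+1}` can be built with these factors while only `n_{2j} - (2 f_j +
1)` levels remain for the outer weight `m_{2j}`. -/
theorem exists_decomposition (h𝒩 : IsSchreierNorming m n p q 𝒩) (hq : 0 < q)
    (hr : Rates m n f s) (h : IsBlockSystem m n f q 𝒩 A γ α g) {j : ℕ} (hj : 2 ≤ j) {i : ℕ+}
    (hji : j ≤ i) :
    ∃ (K : Finset ℕ+) (δ : ℕ+ → ℚ) (x : ℕ+ → FinSeq), K ∈ schreier (n (2 * j) - (2 * f j + 1)) ∧
      K ⊆ A i ∧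
      (∀ κ ∈ K, x κ ∈ 𝒩.carrier) ∧ (∀ κ ∈ K, x κ ≠ 0) ∧ (∀ κ ∈ K, (x κ).support ⊆ A i) ∧
      (∀ κ ∈ K, ∀ l ∈ (x κ).support, κ ≤ l) ∧
      (∀ κ ∈ K, ∀ κ' ∈ K, κ < κ' → ∀ l ∈ (x κ).support, ∀ l' ∈ (x κ').support, l < l') ∧
      ∑ κ ∈ K, |(δ κ : ℝ)| ^ q ≤ 1 ∧
      blockFunctional m A γ i = (1 / (m (2 * j) : ℝ)) • ∑ κ ∈ K, (δ κ : ℝ) • x κ := by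
  obtain ⟨L, hL, hL1, hw, hc⟩ := hr.exists_factorization hj (Nat.lt_succ_of_le hji)
  have h1 := hr.f_lt j hj
  have h2 := hr.f_pos j hj
  change _ = _ * listWeight m L at hw
  change _ ≤ _ + listCost n L at hc
  obtain ⟨K, δ, x, hK, hKA, hx, hx0, hxA, hle, hlt, hδ, heq⟩ :=
    (buildable h𝒩 hq hr L hL hL1).exists_decomposition (hr.listWeight_pos hL1) hq
      (N := n (2 * j) - (2 * f j + 1))
      (schreier_mono (by simp only [Nat.succ_eq_add_one] at hc; omega) (h.mem i))
      (h.ne_zero i) (h.sum_lt i)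
  refine ⟨K, δ, x, hK, hKA, hx, hx0, hxA, hle, hlt, hδ, ?_⟩
  rw [← heq, smul_smul, blockFunctional]
  congr 1
  simp only [Nat.succ_eq_add_one] at hw
  rw [hw]
  simp [mul_comm]

/-- All `y_i` are given the common weight `m_{2j}`, so the sum is one even operation over the union
of the sets `K i`. The `2 f_j + 1` levels kept in reserve pay for the outer set `F`: the union is in
`S_{n_{2j}}`. -/
theorem sum_mem (h𝒩 : IsSchreierNorming m n p q 𝒩) (hq : 0 < q) (hr : Rates m n f s)
    (h : IsBlockSystem m n f q 𝒩 A γ α g) {j : ℕ} (hj : 2 ≤ j) {F : Finset ℕ+}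
    (hFj : ∀ i ∈ F, j ≤ (i : ℕ)) (hF : F ∈ schreier (2 * f j + 1)) (β : ℕ+ → ℚ)
    (hβ : ∑ i ∈ F, |(β i : ℝ)| ^ q ≤ 1) :
    ∑ i ∈ F, (β i : ℝ) • blockFunctional m A γ i ∈ 𝒩.carrier := by
  have hex := fun i (hi : i ∈ F) => h.exists_decomposition h𝒩 hq hr hj (hFj i hi)
  choose! K δ x hK hKA hx hx0 hxA hle hlt hδ heq using hex
  have hAeq : ∀ i i' l, l ∈ A i → l ∈ A i' → i = i' := fun i i' l hl hl' => by
    rcases lt_trichotomy i i' with hii | hii | hii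
    · exact absurd (h.lt i i' hii l hl l hl') (lt_irrefl _)
    · exact hii
    · exact absurd (h.lt i' i hii l hl' l hl) (lt_irrefl _)
  have hKeq : ∀ i i' l, (i ∈ F ∧ l ∈ K i) → (i' ∈ F ∧ l ∈ K i') → i = i' := fun i i' l hl hl' =>
    hAeq i i' l (hKA i hl.1 hl.2) (hKA i' hl'.1 hl'.2)
  obtain ⟨y, hy⟩ := exists_glue (fun i => {κ | i ∈ F ∧ κ ∈ K i}) x hKeq
  obtain ⟨ε, hε⟩ := exists_glue (fun i => {κ | i ∈ F ∧ κ ∈ K i}) (fun i κ => β i * δ i κ) hKeq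
  have hy' : ∀ i ∈ F, ∀ κ ∈ K i, y κ = x i κ := fun i hi κ hκ => hy i κ ⟨hi, hκ⟩
  have hε' : ∀ i ∈ F, ∀ κ ∈ K i, ε κ = β i * δ i κ := fun i hi κ hκ => hε i κ ⟨hi, hκ⟩
  have hdisj : (F : Set ℕ+).PairwiseDisjoint K := fun i hi i' hi' hne =>
    Finset.disjoint_left.2 fun l hl hl' => hne (hKeq i i' l ⟨hi, hl⟩ ⟨hi', hl'⟩)
  have h1 := hr.f_lt j hj
  have h2 := hr.f_pos j hj
  have hS : F.biUnion K ∈ schreier (n (2 * j)) := by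
    have := schreier_biUnion_mem hF K hK (fun i hi l hl => h.le i l (hKA i hi hl))
      fun i hi i' hi' hii l hl l' hl' => h.lt i i' hii l (hKA i hi hl) l' (hKA i' hi' hl')
    rwa [Nat.add_sub_cancel' (by omega)] at this
  have hmem : ∀ κ ∈ F.biUnion K, ∃ i ∈ F, κ ∈ K i := fun κ hκ => Finset.mem_biUnion.1 hκ
  have := even_mem h𝒩 (k := j) (by omega) hS (x := y) (γ := ε) ?_ ?_ ?_ ?_ hq ?_
  · rw [Finset.sum_biUnion hdisj, Finset.smul_sum] at this
    convert this using 1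
    refine Finset.sum_congr rfl fun i hi => ?_
    rw [heq i hi, smul_comm, Finset.smul_sum]
    congr 1
    refine Finset.sum_congr rfl fun κ hκ => ?_
    rw [hy' i hi κ hκ, hε' i hi κ hκ, smul_smul]
    push_cast
    rfl
  · intro κ hκ
    obtain ⟨i, hi, hκ⟩ := hmem κ hκ
    rw [hy' i hi κ hκ]; exact hx i hi κ hκ
  · intro κ hκ
    obtain ⟨i, hi, hκ⟩ := hmem κ hκ
    rw [hy' i hi κ hκ]; exact hx0 i hi κ hκ
  · intro κ hκ
    obtain ⟨i, hi, hκ⟩ := hmem κ hκ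
    rw [hy' i hi κ hκ]; exact hle i hi κ hκ
  · intro κ hκ κ' hκ' hκκ
    obtain ⟨i, hi, hκ⟩ := hmem κ hκ
    obtain ⟨i', hi', hκ'⟩ := hmem κ' hκ'
    rw [hy' i hi κ hκ, hy' i' hi' κ' hκ']
    rcases lt_trichotomy i i' with hii | rfl | hii
    · exact fun l hl l' hl' => h.lt i i' hii l (hxA i hi κ hκ hl) l' (hxA i' hi' κ' hκ' hl')
    · exact hlt i hi κ hκ κ' hκ' hκκ
    · exact absurd (h.lt i' i hii κ' (hKA i' hi' hκ') κ (hKA i hi hκ)) (not_lt.2 hκκ.le)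
  · rw [Finset.sum_biUnion hdisj]
    refine le_trans (Finset.sum_le_sum fun i hi => ?_) hβ
    calc ∑ κ ∈ K i, |(ε κ : ℝ)| ^ q = ∑ κ ∈ K i, |(β i : ℝ)| ^ q * |(δ i κ : ℝ)| ^ q := by
          refine Finset.sum_congr rfl fun κ hκ => ?_
          rw [hε' i hi κ hκ, Rat.cast_mul, abs_mul, Real.mul_rpow (abs_nonneg _) (abs_nonneg _)]
      _ = |(β i : ℝ)| ^ q * ∑ κ ∈ K i, |(δ i κ : ℝ)| ^ q := by rw [Finset.mul_sum]
      _ ≤ |(β i : ℝ)| ^ q * 1 := by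
          have := hδ i hi
          gcongr
      _ = _ := mul_one _

end IsBlockSystem

theorem pairing_sum_smul_left {ι : Type*} (F : Finset ι) (β : ι → ℝ) (y : ι → FinSeq) (v : FinSeq) :
    pairing (∑ i ∈ F, β i • y i) v = ∑ i ∈ F, β i * pairing (y i) v := by
  simp only [pairing, Finsupp.sum, Finsupp.finsetSum_apply, Finsupp.smul_apply, smul_eq_mul,
    Finset.sum_mul, Finset.mul_sum]
  rw [Finset.sum_comm]
  simp only [mul_assoc]

theorem exists_rat_abs_le (r : ℝ) {ε : ℝ} (hε : 0 < ε) : ∃ u : ℚ, |(u : ℝ)| ≤ |r| ∧ |r - u| ≤ ε := by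
  have pos : ∀ r : ℝ, 0 < r → ∃ u : ℚ, |(u : ℝ)| ≤ |r| ∧ |r - u| ≤ ε := fun r hr => by
    obtain ⟨u, hu1, hu2⟩ := exists_rat_btwn (max_lt hr (sub_lt_self r hε))
    rw [max_lt_iff] at hu1
    exact ⟨u, by rw [abs_of_pos hu1.1, abs_of_pos hr]; exact hu2.le,
      by rw [abs_of_pos (by linarith)]; linarith⟩
  rcases lt_trichotomy r 0 with hr | rfl | hr
  · obtain ⟨u, hu1, hu2⟩ := pos (-r) (by linarith)
    refine ⟨-u, by simpa using hu1, ?_⟩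
    rw [← abs_neg]
    push_cast
    convert hu2 using 2
    ring
  · exact ⟨0, by simpa using hε.le⟩
  · exact pos r hr

/-- Passes from the rational coefficients allowed in `𝒩` to real ones. Approximating towards `0`
keeps the `ℓ_q` constraint. -/
theorem sum_mul_le_of_rat {F : Finset ℕ+} {c : ℕ+ → ℝ} {C : ℝ} (hq : 0 < q)
    (h : ∀ β : ℕ+ → ℚ, ∑ i ∈ F, |(β i : ℝ)| ^ q ≤ 1 → ∑ i ∈ F, (β i : ℝ) * c i ≤ C)
    {β : ℕ+ → ℝ} {e : ℝ} (he : 0 < e) (hβ : ∑ i ∈ F, |β i| ^ q ≤ e ^ q) :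
    ∑ i ∈ F, β i * c i ≤ e * C := by
  have real : ∀ β : ℕ+ → ℝ, ∑ i ∈ F, |β i| ^ q ≤ 1 → ∑ i ∈ F, β i * c i ≤ C := by
    intro β hβ
    refine le_of_forall_pos_le_add fun ε hε => ?_
    set S := ∑ i ∈ F, |c i| with hS
    have hS0 : 0 ≤ S := Finset.sum_nonneg fun i _ => abs_nonneg _
    choose u hu1 hu2 using fun i => exists_rat_abs_le (β i) (ε := ε / (S + 1)) (by positivity)
    have h1 := h u (le_trans (Finset.sum_le_sum fun i _ =>
      Real.rpow_le_rpow (abs_nonneg _) (hu1 i) hq.le) hβ)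
    have h2 : ∑ i ∈ F, (β i - u i) * c i ≤ ε := by
      calc ∑ i ∈ F, (β i - u i) * c i ≤ ∑ i ∈ F, ε / (S + 1) * |c i| := by
            refine Finset.sum_le_sum fun i _ => (le_abs_self _).trans ?_
            rw [abs_mul]
            gcongr
            exact hu2 i
        _ = ε / (S + 1) * S := by rw [← Finset.mul_sum]
        _ ≤ ε / (S + 1) * (S + 1) := by gcongr; linarith
        _ = ε := by field_simp
    calc ∑ i ∈ F, β i * c i = ∑ i ∈ F, (u i : ℝ) * c i + ∑ i ∈ F, (β i - u i) * c i := by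
          rw [← Finset.sum_add_distrib]
          exact Finset.sum_congr rfl fun i _ => by ring
      _ ≤ C + ε := add_le_add h1 h2
  have h1 := real (fun i => β i / e) (by
    simp only [abs_div, abs_of_pos he, Real.div_rpow (abs_nonneg _) he.le]
    rw [← Finset.sum_div, div_le_one (Real.rpow_pos_of_pos he _)]
    exact hβ)
  have h2 : ∑ i ∈ F, β i * c i = e * ∑ i ∈ F, β i / e * c i := by
    rw [Finset.mul_sum]
    exact Finset.sum_congr rfl fun i _ => by field_simp
  rw [h2]
  gcongr

/-- The first `k` with `r < m_{2(k+2)}`; minimality gives the lower bound. The shift by `2` is there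
because `f_j` is available only for `j ≥ 2`. -/
theorem Rates.exists_level (hr : Rates m n f s) {r : ℝ} (h1 : 1 ≤ r) :
    ∃ k : ℕ, r < m (2 * (k + 2)) ∧ (4 : ℝ) ^ k ≤ r := by
  have hex : ∃ k : ℕ, r < m (2 * (k + 2)) := by
    obtain ⟨k, hk⟩ := pow_unbounded_of_one_lt r (by norm_num : (1 : ℝ) < 4)
    refine ⟨k, hk.trans_le ?_⟩
    have h2 := hr.m_even (k + 2) (by omega)
    have h3 : 4 ^ k ≤ 4 ^ (k + 2) := Nat.pow_le_pow_right (by omega) (by omega)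
    exact_mod_cast h3.trans h2
  classical
  refine ⟨Nat.find hex, Nat.find_spec hex, ?_⟩
  rcases Nat.eq_zero_or_pos (Nat.find hex) with h0 | h0
  · rw [h0]; simpa using h1
  · obtain ⟨k, hk⟩ := Nat.exists_eq_succ_of_ne_zero h0.ne'
    have h2 := not_lt.1 (Nat.find_min hex (m := k) (by omega))
    rw [hk]
    have h3 := hr.m_even (k + 2) (by omega)
    have h4 : 4 ^ (k + 1) ≤ 4 ^ (k + 2) := Nat.pow_le_pow_right (by omega) (by omega)
    exact le_trans (by exact_mod_cast h4.trans h3) h2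

namespace IsBlockSystem

theorem sum_schreier_le (h𝒩 : IsSchreierNorming m n p q 𝒩) (hq : 0 < q) (hr : Rates m n f s)
    (h : IsBlockSystem m n f q 𝒩 A γ α g) (v : C00 𝒩) {j : ℕ} (hj : 2 ≤ j) {F : Finset ℕ+}
    (hFj : ∀ i ∈ F, j ≤ (i : ℕ)) (hF : F ∈ schreier (2 * f j + 1)) {β : ℕ+ → ℝ} {e : ℝ}
    (he : 0 < e) (hβ : ∑ i ∈ F, |β i| ^ q ≤ e ^ q) :
    ∑ i ∈ F, β i * pairing (blockFunctional m A γ i) (C00.coords v) ≤ e * ‖v‖ := by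
  refine sum_mul_le_of_rat hq (fun b hb => ?_) he hβ
  have := C00.pairing_le 𝒩 v (h.sum_mem h𝒩 hq hr hj hFj hF b hb)
  rwa [pairing_sum_smul_left] at this

/-- The unit vectors dominate the block functionals. -/
theorem sum_le (h𝒩 : IsSchreierNorming m n p q 𝒩) (hpq : p.HolderConjugate q)
    (hr : Rates m n f s) (h : IsBlockSystem m n f q 𝒩 A γ α g) (v : C00 𝒩) {x : FinSeq}
    (hx : x ∈ 𝒩.carrier) {a : ℕ+ → ℝ} (ha : ∀ i, |a i| ≤ 1) :
    ∑ i ∈ x.support, x i * a i * pairing (blockFunctional m A γ i) (C00.coords v) ≤ 6 * ‖v‖ := by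
  have hq := hpq.symm.pos
  have hp := hpq.pos
  obtain ⟨Q, hQ⟩ := exists_isAnalysis hpq hr h𝒩 hx
  set c : ℕ+ → ℝ := fun i => pairing (blockFunctional m A γ i) (C00.coords v) with hc
  have hc1 : ∀ i, |c i| ≤ ‖v‖ := fun i =>
    C00.abs_pairing_le 𝒩 v (h.blockFunctional_mem h𝒩 hq hr i)
  have hlev := fun i (hi : i ∈ x.support) => hr.exists_level (hQ.one_le i hi)
  choose! lev hlev1 hlev2 using hlev
  have hxQ : ∀ i ∈ x.support, ∀ k, lev i = k → |x i| ≤ (1 / 4) ^ k * (|x i| * Q i) := by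
    rintro i hi k rfl
    have h1 : 1 ≤ (1 / 4 : ℝ) ^ lev i * Q i := by
      rw [one_div, inv_pow, ← div_eq_inv_mul, le_div_iff₀ (by positivity), one_mul]
      exact hlev2 i hi
    calc |x i| ≤ |x i| * ((1 / 4 : ℝ) ^ lev i * Q i) := le_mul_of_one_le_right (abs_nonneg _) h1
      _ = _ := by ring
  have hQ0 : ∀ i ∈ x.support, 0 ≤ |x i| * Q i := fun i hi =>
    mul_nonneg (abs_nonneg _) (zero_le_one.trans (hQ.one_le i hi))
  have hQ1 : ∀ i ∈ x.support, |x i| * Q i ≤ 1 := fun i hi => by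
    have h1 : (|x i| * Q i) ^ q ≤ 1 := le_trans (Finset.single_le_sum
      (f := fun i => (|x i| * Q i) ^ q) (fun l hl => Real.rpow_nonneg (hQ0 l hl) _) hi) hQ.sum_le
    by_contra! h2
    exact absurd (Real.one_lt_rpow h2 hq) (not_lt.2 h1)
  -- On level `k`, `|x_i| ≤ 4^{-k} |x_i| Q_i`. The indices `i ≥ k + 2` form a set of `S_{2 f_{k+2} +
  -- 1}`, so `sum_schreier_le` handles them together; the fewer than `k + 2` others are estimated
  -- one by one.
  have hlevel : ∀ k, ∑ i ∈ x.support with lev i = k, x i * a i * c i ≤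
      (1 / 4 : ℝ) ^ k * ‖v‖ + (k + 2) * ((1 / 4 : ℝ) ^ k * ‖v‖) := by
    intro k
    rw [← Finset.sum_filter_add_sum_filter_not _ (fun i : ℕ+ => k + 2 ≤ (i : ℕ))]
    set F := (x.support.filter fun i => lev i = k).filter fun i : ℕ+ => k + 2 ≤ (i : ℕ) with hF
    set F' := (x.support.filter fun i => lev i = k).filter fun i : ℕ+ => ¬ k + 2 ≤ (i : ℕ) with hF'
    have hFx : ∀ i ∈ F, i ∈ x.support ∧ lev i = k ∧ k + 2 ≤ (i : ℕ) := fun i hi =>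
      ⟨(Finset.mem_filter.1 (Finset.mem_filter.1 hi).1).1,
        (Finset.mem_filter.1 (Finset.mem_filter.1 hi).1).2, (Finset.mem_filter.1 hi).2⟩
    have hFx' : ∀ i ∈ F', i ∈ x.support ∧ lev i = k ∧ ¬ k + 2 ≤ (i : ℕ) := fun i hi =>
      ⟨(Finset.mem_filter.1 (Finset.mem_filter.1 hi).1).1,
        (Finset.mem_filter.1 (Finset.mem_filter.1 hi).1).2, (Finset.mem_filter.1 hi).2⟩
    refine add_le_add ?_ ?_
    · have hS := hQ.mem_schreier (k + 2) (m (2 * (k + 2))) (2 * f (k + 2) + 1) (by omega) le_rfl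
        (budget_half (fun l => by linarith [hr.weight_gt l]) hr.m_one (hr.n_pos 1 le_rfl)
          (hr.budget (k + 2) (by omega)))
      refine h.sum_schreier_le h𝒩 hq hr v (j := k + 2) (by omega) (fun i hi => (hFx i hi).2.2)
        (schreier_hereditary hS fun i hi => ?_) (by positivity) ?_
      · obtain ⟨h1, rfl, h3⟩ := hFx i hi
        exact Finset.mem_filter.2 ⟨h1, h3, hlev1 i h1⟩
      · calc ∑ i ∈ F, |x i * a i| ^ q ≤ ∑ i ∈ F, ((1 / 4 : ℝ) ^ k) ^ q * (|x i| * Q i) ^ q := by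
              refine Finset.sum_le_sum fun i hi => ?_
              obtain ⟨h1, h2, h3⟩ := hFx i hi
              rw [← Real.mul_rpow (by positivity) (hQ0 i h1)]
              refine Real.rpow_le_rpow (abs_nonneg _) ?_ hq.le
              rw [abs_mul]
              exact (mul_le_of_le_one_right (abs_nonneg _) (ha i)).trans (hxQ i h1 k h2)
          _ = ((1 / 4 : ℝ) ^ k) ^ q * ∑ i ∈ F, (|x i| * Q i) ^ q := by rw [Finset.mul_sum]
          _ ≤ ((1 / 4 : ℝ) ^ k) ^ q * 1 := by
              gcongr
              exact (Finset.sum_le_sum_of_subset_of_nonneg (fun i hi => (hFx i hi).1)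
                fun l hl _ => Real.rpow_nonneg (hQ0 l hl) _).trans hQ.sum_le
          _ = _ := mul_one _
    · have hcard : F'.card ≤ k + 2 := by
        rw [← Finset.card_image_of_injective F' PNat.coe_injective]
        refine (Finset.card_le_card (t := Finset.range (k + 2)) fun a ha => ?_).trans_eq
          (Finset.card_range _)
        obtain ⟨i, hi, rfl⟩ := Finset.mem_image.1 ha
        exact Finset.mem_range.2 (not_le.1 (hFx' i hi).2.2)
      calc ∑ i ∈ F', x i * a i * c i ≤ ∑ i ∈ F', (1 / 4 : ℝ) ^ k * ‖v‖ := by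
            refine Finset.sum_le_sum fun i hi => (le_abs_self _).trans ?_
            obtain ⟨h1, h2, h3⟩ := hFx' i hi
            rw [abs_mul, abs_mul]
            have h4 : |x i| ≤ (1 / 4 : ℝ) ^ k := (hxQ i h1 k h2).trans
              (mul_le_of_le_one_right (by positivity) (hQ1 i h1))
            calc |x i| * |a i| * |c i| ≤ (1 / 4 : ℝ) ^ k * 1 * ‖v‖ := by
                  gcongr
                  · exact ha i
                  · exact hc1 i
              _ = _ := by rw [mul_one]
        _ = F'.card * ((1 / 4 : ℝ) ^ k * ‖v‖) := by rw [Finset.sum_const, nsmul_eq_mul]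
        _ ≤ (k + 2) * ((1 / 4 : ℝ) ^ k * ‖v‖) := by
            gcongr
            exact_mod_cast hcard
  have hlevel' : ∀ k, ∑ i ∈ x.support with lev i = k, x i * a i * c i ≤
      (1 / 2 : ℝ) ^ k * (3 * ‖v‖) := by
    intro k
    refine (hlevel k).trans ?_
    -- Trades half of the decay `4^{-k}` for the linear factor; the geometric sum then gives `2 · 3
    -- = 6`.
    have h1 : (k : ℝ) + 3 ≤ 3 * 2 ^ k := by
      have : k + 3 ≤ 3 * 2 ^ k := by have := Nat.lt_two_pow_self (n := k); omega
      exact_mod_cast this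
    have h2 : (1 / 4 : ℝ) ^ k * 2 ^ k = (1 / 2) ^ k := by rw [← mul_pow]; norm_num
    calc _ = (1 / 4 : ℝ) ^ k * ‖v‖ * (k + 3) := by ring
      _ ≤ (1 / 4 : ℝ) ^ k * ‖v‖ * (3 * 2 ^ k) := by gcongr
      _ = ((1 / 4 : ℝ) ^ k * 2 ^ k) * (3 * ‖v‖) := by ring
      _ = _ := by rw [h2]
  have hmaps : ∀ i ∈ x.support, lev i ∈ Finset.range (x.support.sup lev + 1) := fun i hi =>
    Finset.mem_range.2 (Nat.lt_succ_of_le (Finset.le_sup hi))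
  rw [← Finset.sum_fiberwise_of_maps_to hmaps]
  calc _ ≤ ∑ k ∈ Finset.range (x.support.sup lev + 1), (1 / 2 : ℝ) ^ k * (3 * ‖v‖) :=
        Finset.sum_le_sum fun k _ => hlevel' k
    _ = (∑ k ∈ Finset.range (x.support.sup lev + 1), (1 / 2 : ℝ) ^ k) * (3 * ‖v‖) := by
        rw [Finset.sum_mul]
    _ ≤ 2 * (3 * ‖v‖) := by
        gcongr
        exact sum_geometric_two_le _
    _ = 6 * ‖v‖ := by ring

end IsBlockSystem

end SchreierSpace

namespace SchreierSpace

/-! ### Operators on Banach spaces -/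

section Banach

variable {E : Type} [NormedAddCommGroup E] [NormedSpace ℝ E]

/-- On a hereditarily indecomposable space an operator with infinite-dimensional kernel is strictly
singular. -/
theorem IsHI.isStrictlySingular [CompleteSpace E] (hE : IsHI E) {T : E →L[ℝ] E}
    (hT : ¬ FiniteDimensional ℝ (LinearMap.ker (T : E →ₗ[ℝ] E))) : IsStrictlySingular T := by
  rintro Y hY ⟨c, hc, hcY⟩
  set Z := LinearMap.ker (T : E →ₗ[ℝ] E) with hZ
  have hTZ : ∀ z ∈ Z, T z = 0 := fun z hz => hz
  have hZc : IsClosed (Z : Set E) := T.isClosed_ker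
  have hYc : IsClosed (Y.topologicalClosure : Set E) := Y.isClosed_topologicalClosure
  have hcY' : ∀ y ∈ Y.topologicalClosure, c * ‖y‖ ≤ ‖T y‖ := fun y hy => by
    have hcl : IsClosed {y | c * ‖y‖ ≤ ‖T y‖} :=
      isClosed_le (by fun_prop) (by fun_prop)
    exact closure_minimal (fun y hy => hcY y hy) hcl hy
  have hYinf : ¬ FiniteDimensional ℝ Y.topologicalClosure := fun h =>
    hY (Submodule.finiteDimensional_of_le Y.le_topologicalClosure)
  let Φ : (Y.topologicalClosure × Z) →L[ℝ] E :=
    Y.topologicalClosure.subtypeL.coprod Z.subtypeL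
  have hΦ : ∀ u, Φ u = u.1 + u.2 := fun u => by simp [Φ]
  -- Since `T` sees only the component `y` of `y + z`, `c ‖y‖ ≤ ‖T‖ ‖y + z‖`. Hence the sum map is
  -- bounded below and the sum is closed.
  have hbound : ∀ u, ‖u‖ ≤ (⟨‖T‖ / c + 1, by positivity⟩ : NNReal) * ‖Φ u‖ := by
    rintro ⟨⟨y, hy⟩, ⟨z, hz⟩⟩
    rw [hΦ]
    change _ ≤ (‖T‖ / c + 1) * ‖y + z‖
    have h1 : c * ‖y‖ ≤ ‖T‖ * ‖y + z‖ := by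
      have h2 := T.le_opNorm (y + z)
      rw [map_add, hTZ z hz, add_zero] at h2
      exact (hcY' y hy).trans h2
    have h2 : ‖y‖ ≤ ‖T‖ / c * ‖y + z‖ := by
      rw [div_mul_eq_mul_div, le_div_iff₀ hc]
      linarith
    have h3 : ‖z‖ ≤ ‖y + z‖ + ‖y‖ := by
      have := norm_sub_le (y + z) y
      rwa [add_sub_cancel_left] at this
    refine max_le ?_ ?_
    · change ‖y‖ ≤ _
      linarith [norm_nonneg (y + z)]
    · change ‖z‖ ≤ _
      linarith
  have : CompleteSpace Y.topologicalClosure := hYc.completeSpace_coe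
  have : CompleteSpace Z := hZc.completeSpace_coe
  have hrange : Set.range Φ = ((Y.topologicalClosure ⊔ Z : Submodule ℝ E) : Set E) := by
    ext x
    simp only [Set.mem_range, hΦ, SetLike.mem_coe, Submodule.mem_sup, Prod.exists, Subtype.exists,
      exists_prop]
  refine hE _ Y.topologicalClosure Z ?_ hYc hZc hYinf hT ?_ rfl
  · rw [← hrange]
    exact (ContinuousLinearMap.antilipschitz_of_bound Φ hbound).isClosed_range Φ.uniformContinuous
  · rw [Submodule.disjoint_def]
    intro y hy hz
    have := hcY' y hy
    rw [hTZ y hz, norm_zero] at this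
    exact norm_le_zero_iff.1 (nonpos_of_mul_nonpos_right this hc)

/-- A compact operator does not map a bounded sequence to a separated one. -/
theorem false_of_isCompactOperator_of_separated {K : E →L[ℝ] E} (hK : IsCompactOperator K) {u : ℕ → E}
    {R r : ℝ} (hu : ∀ k, ‖u k‖ ≤ R) (hr : 0 < r) (h : ∀ k l, k ≠ l → r ≤ ‖K (u k) - K (u l)‖) :
    False := by
  obtain ⟨C, hC, hsub⟩ := hK.image_closedBall_subset_compact (f := (K : E →ₗ[ℝ] E)) R
  have hmem : ∀ k, K (u k) ∈ C := fun k => hsub ⟨u k, by simpa using hu k, rfl⟩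
  obtain ⟨x, -, φ, hφ, hlim⟩ := hC.tendsto_subseq hmem
  obtain ⟨N, hN⟩ := Metric.cauchySeq_iff'.1 hlim.cauchySeq r hr
  have h1 := hN (N + 1) (Nat.le_succ N)
  rw [dist_eq_norm] at h1
  exact absurd (h (φ (N + 1)) (φ N) (hφ (Nat.lt_succ_self N)).ne') (not_le.2 h1)

/-- Uniformly bounded operators which converge on a dense set converge everywhere. -/
theorem exists_tendsto_of_dense [CompleteSpace E] {S : ℕ+ → E →L[ℝ] E} {C : ℝ}
    (hS : ∀ N x, ‖S N x‖ ≤ C * ‖x‖) {D : Set E} (hD : Dense D)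
    (hlim : ∀ x ∈ D, ∃ N₀, ∀ N ≥ N₀, S N x = S N₀ x) (x : E) :
    ∃ y, Filter.Tendsto (fun N => S N x) Filter.atTop (nhds y) := by
  refine cauchySeq_tendsto_of_complete (Metric.cauchySeq_iff'.2 fun ε hε => ?_)
  obtain ⟨d, hdD, hd⟩ := Metric.mem_closure_iff.1 (hD x) (ε / (2 * (|C| + 1))) (by positivity)
  rw [dist_eq_norm] at hd
  obtain ⟨N₀, hN₀⟩ := hlim d hdD
  have hb : ∀ N, ‖S N (x - d)‖ < ε / 2 := fun N => by
    calc ‖S N (x - d)‖ ≤ C * ‖x - d‖ := hS N _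
      _ ≤ (|C| + 1) * ‖x - d‖ := by gcongr; linarith [le_abs_self C]
      _ < (|C| + 1) * (ε / (2 * (|C| + 1))) := by gcongr
      _ = ε / 2 := by field_simp
  refine ⟨N₀, fun N hN => ?_⟩
  have h1 : S N x - S N₀ x = S N (x - d) - S N₀ (x - d) := by
    rw [map_sub, map_sub, hN₀ N hN]; abel
  rw [dist_eq_norm, h1]
  linarith [norm_sub_le (S N (x - d)) (S N₀ (x - d)), hb N, hb N₀]

end Banach

/-! ### The space `X_𝒩` -/

variable {𝒩 : NormingSet}

/-- A functional in the norming set extends to a functional on `X_𝒩` of norm at most one. -/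
theorem exists_functional {x : FinSeq} (hx : x ∈ 𝒩.carrier) :
    ∃ φ : X 𝒩 →L[ℝ] ℝ, (∀ v : C00 𝒩, φ v = pairing x (C00.coords v)) ∧ ∀ u, |φ u| ≤ ‖u‖ := by
  let ψ : C00 𝒩 →ₗ[ℝ] ℝ :=
    { toFun := fun v => pairing x (C00.coords v)
      map_add' := fun v w => pairing_add x (C00.coords v) (C00.coords w)
      map_smul' := fun c v => pairing_smul x (C00.coords v) c }
  let e : C00 𝒩 →L[ℝ] X 𝒩 := UniformSpace.Completion.toComplL
  let φ : X 𝒩 →L[ℝ] ℝ :=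
    (ψ.mkContinuous 1 fun v => by rw [one_mul]; exact C00.abs_pairing_le 𝒩 v hx).extend e
  have hφ : ∀ v : C00 𝒩, φ v = pairing x (C00.coords v) := fun v =>
    ContinuousLinearMap.extend_eq (e := e) _ UniformSpace.Completion.denseRange_coe
      (UniformSpace.Completion.isUniformInducing_coe _) v
  refine ⟨φ, hφ, fun u => ?_⟩
  induction u using UniformSpace.Completion.induction_on with
  | hp => exact isClosed_le (by fun_prop) (by fun_prop)
  | ih v =>
    rw [hφ, UniformSpace.Completion.norm_coe]
    exact C00.abs_pairing_le 𝒩 v hx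

/-- Finitely supported sequences as elements of `X_𝒩`. -/
noncomputable def toX (𝒩 : NormingSet) : FinSeq →ₗ[ℝ] X 𝒩 where
  toFun a := ((C00.of 𝒩 a : C00 𝒩) : X 𝒩)
  map_add' a b := UniformSpace.Completion.coe_add (C00.of 𝒩 a) (C00.of 𝒩 b)
  map_smul' c a := UniformSpace.Completion.coe_smul c (C00.of 𝒩 a)

theorem toX_single (i : ℕ+) : toX 𝒩 (Finsupp.single i 1) = basisVec 𝒩 i := rfl

theorem norm_toX_le {a : FinSeq} {r : ℝ} (h : ∀ x ∈ 𝒩.carrier, pairing x a ≤ r) :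
    ‖toX 𝒩 a‖ ≤ r :=
  (UniformSpace.Completion.norm_coe (C00.of 𝒩 a)).trans_le (C00.norm_le 𝒩 _ h)

theorem abs_apply_le_norm_toX (a : FinSeq) (i : ℕ+) : |a i| ≤ ‖toX 𝒩 a‖ := by
  rw [← pairing_single_left]
  exact (C00.abs_pairing_le 𝒩 (C00.of 𝒩 a) (𝒩.single_mem i)).trans_eq
    (UniformSpace.Completion.norm_coe (C00.of 𝒩 a)).symm

theorem toX_injective : Function.Injective (toX 𝒩) := by
  rw [← LinearMap.ker_eq_bot, LinearMap.ker_eq_bot']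
  intro a ha
  ext i
  have := abs_apply_le_norm_toX (𝒩 := 𝒩) a i
  rw [ha, norm_zero] at this
  exact abs_nonpos_iff.1 this

theorem linearIndependent_basisVec : LinearIndependent ℝ (basisVec 𝒩) := by
  have h : LinearIndependent ℝ fun i : ℕ+ => (Finsupp.single i 1 : FinSeq) := by
    simpa using (Finsupp.basisSingleOne (R := ℝ) (ι := ℕ+)).linearIndependent
  exact h.map' (toX 𝒩) (LinearMap.ker_eq_bot.2 toX_injective)

theorem norm_basisVec (i : ℕ+) : ‖basisVec 𝒩 i‖ = 1 := by
  rw [← toX_single]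
  refine le_antisymm (norm_toX_le fun x hx => ?_) ?_
  · rw [pairing_eq_sum_right x _ Finsupp.support_single_subset]
    simpa using (le_abs_self _).trans (𝒩.abs_apply_le x hx i)
  · simpa using abs_apply_le_norm_toX (𝒩 := 𝒩) (Finsupp.single i 1) i

theorem abs_le_norm_smul_sub_smul (b c : ℝ) {i j : ℕ+} (hij : i ≠ j) :
    |b| ≤ ‖b • basisVec 𝒩 i - c • basisVec 𝒩 j‖ := by
  rw [← toX_single, ← toX_single, ← map_smul, ← map_smul, ← map_sub]
  refine le_trans (le_of_eq ?_) (abs_apply_le_norm_toX _ i)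
  simp [hij.symm]

theorem not_isCompactOperator {K : X 𝒩 →L[ℝ] X 𝒩} {u : ℕ → X 𝒩} {τ : ℕ → ℕ+} {b : ℕ → ℝ} {R r : ℝ}
    (hu : ∀ k, ‖u k‖ ≤ R) (hr : 0 < r) (hτ : Function.Injective τ) (hb : ∀ k, r ≤ |b k|)
    (hK : ∀ k, K (u k) = b k • basisVec 𝒩 (τ k)) : ¬ IsCompactOperator K := fun h =>
  false_of_isCompactOperator_of_separated h hu hr fun k l hkl => by
    rw [hK, hK]
    exact (hb k).trans (abs_le_norm_smul_sub_smul _ _ (hτ.ne hkl))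

end SchreierSpace

namespace SchreierSpace

/-! ### The operators given by a block system -/

variable {m n f s : ℕ → ℕ} {p q : ℝ} {𝒩 : NormingSet} {A : ℕ+ → Finset ℕ+}
  {γ : ℕ+ → ℕ+ → ℚ} {α : ℕ+ → ℕ+ → ℝ} {g : ℕ → ℕ+}

/-- The partial sums of `∑ aᵢ yᵢ ⊗ eᵢ`. -/
noncomputable def partialSum (y : ℕ+ → X 𝒩 →L[ℝ] ℝ) (a : ℕ+ → ℝ) (N : ℕ+) : X 𝒩 →L[ℝ] X 𝒩 :=
  ∑ i ∈ Finset.Icc 1 N, (a i • y i).smulRight (basisVec 𝒩 i)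

theorem partialSum_apply (y : ℕ+ → X 𝒩 →L[ℝ] ℝ) (a : ℕ+ → ℝ) (N : ℕ+) (x : X 𝒩) :
    partialSum y a N x = ∑ i ∈ Finset.Icc 1 N, (a i * y i x) • basisVec 𝒩 i := by
  simp [partialSum]

theorem partialSum_apply_eq_of_le {y : ℕ+ → X 𝒩 →L[ℝ] ℝ} {a : ℕ+ → ℝ} {x : X 𝒩} {N₀ N : ℕ+}
    (h : ∀ i, N₀ < i → y i x = 0) (hN : N₀ ≤ N) : partialSum y a N x = partialSum y a N₀ x := by
  rw [partialSum_apply, partialSum_apply]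
  refine (Finset.sum_subset (Finset.Icc_subset_Icc_right hN) fun i hi hi' => ?_).symm
  have : N₀ < i := by
    by_contra! h'
    exact hi' (Finset.mem_Icc.2 ⟨(Finset.mem_Icc.1 hi).1, h'⟩)
  rw [h i this, mul_zero, zero_smul]

namespace IsBlockSystem

theorem norm_partialSum_le (h𝒩 : IsSchreierNorming m n p q 𝒩) (hpq : p.HolderConjugate q)
    (hr : Rates m n f s) (h : IsBlockSystem m n f q 𝒩 A γ α g) {y : ℕ+ → X 𝒩 →L[ℝ] ℝ}
    (hy : ∀ i, ∀ v : C00 𝒩, y i v = pairing (blockFunctional m A γ i) (C00.coords v))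
    {a : ℕ+ → ℝ} {R : ℝ} (ha : ∀ i, |a i| ≤ R) (N : ℕ+) (x : X 𝒩) :
    ‖partialSum y a N x‖ ≤ 6 * R * ‖x‖ := by
  have hR : 0 ≤ R := (abs_nonneg _).trans (ha 1)
  induction x using UniformSpace.Completion.induction_on with
  | hp => exact isClosed_le (by fun_prop) (by fun_prop)
  | ih v =>
    rw [UniformSpace.Completion.norm_coe]
    set c : ℕ+ → ℝ := fun i => pairing (blockFunctional m A γ i) (C00.coords v) with hc
    have heq : partialSum y a N v = toX 𝒩 (ofFinset (Finset.Icc 1 N) fun i => a i * c i) := by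
      rw [partialSum_apply, ofFinset, map_sum]
      refine Finset.sum_congr rfl fun i _ => ?_
      rw [hy, ← toX_single, ← map_smul]
      simp [hc]
    rw [heq]
    refine norm_toX_le fun x hx => ?_
    rw [pairing_eq_sum_left x _ (subset_refl x.support)]
    rcases hR.eq_or_lt with hR | hR
    · have h0 : ∀ i, a i = 0 := fun i => abs_nonpos_iff.1 ((ha i).trans hR.symm.le)
      simp [ofFinset_apply, h0, ← hR]
    -- The cut-off at `N` is part of the multiplier, so the bound is uniform in `N`.
    have h1 := h.sum_le h𝒩 hpq hr v hx (a := fun i => if i ∈ Finset.Icc 1 N then a i / R else 0)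
      fun i => by
        split_ifs
        · rw [abs_div, abs_of_pos hR, div_le_one hR]; exact ha i
        · simp
    calc ∑ l ∈ x.support, x l * ofFinset (Finset.Icc 1 N) (fun i => a i * c i) l
        = R * ∑ i ∈ x.support, x i * (if i ∈ Finset.Icc 1 N then a i / R else 0) * c i := by
          rw [Finset.mul_sum]
          refine Finset.sum_congr rfl fun i _ => ?_
          rw [ofFinset_apply]
          split_ifs
          · field_simp
          · simp
      _ ≤ R * (6 * ‖v‖) := by gcongr
      _ = 6 * R * ‖v‖ := by ring

theorem apply_eq_zero (h : IsBlockSystem m n f q 𝒩 A γ α g) {y : ℕ+ → X 𝒩 →L[ℝ] ℝ}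
    (hy : ∀ i, ∀ v : C00 𝒩, y i v = pairing (blockFunctional m A γ i) (C00.coords v)) (v : C00 𝒩) :
    ∃ N₀, ∀ i, N₀ < i → y i v = 0 := by
  refine ⟨(C00.coords v).support.sup id, fun i hi => ?_⟩
  rw [hy, pairing_eq_sum_right _ _ subset_rfl]
  refine Finset.sum_eq_zero fun l hl => ?_
  rw [Finsupp.notMem_support_iff.1 fun hl' => ?_, zero_mul]
  have h1 := h.le i l (support_blockFunctional_subset i hl')
  have h2 : l ≤ (C00.coords v).support.sup id := Finset.le_sup (f := id) hl
  exact absurd (h1.trans h2) (not_le.2 hi)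

/-- On finitely supported vectors the partial sums are eventually constant because `i ≤ A i`; the
uniform bound extends the convergence to all of `X 𝒩`. -/
theorem exists_operators (h𝒩 : IsSchreierNorming m n p q 𝒩) (hpq : p.HolderConjugate q)
    (hr : Rates m n f s) (h : IsBlockSystem m n f q 𝒩 A γ α g) {y : ℕ+ → X 𝒩 →L[ℝ] ℝ}
    (hy : ∀ i, ∀ v : C00 𝒩, y i v = pairing (blockFunctional m A γ i) (C00.coords v)) :
    ∃ J : lp (fun _ : ℕ+ => ℝ) ⊤ →L[ℝ] (X 𝒩 →L[ℝ] X 𝒩),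
      ∀ (a : lp (fun _ : ℕ+ => ℝ) ⊤) (x : X 𝒩),
      Filter.Tendsto (fun N => partialSum y a N x) Filter.atTop (nhds (J a x)) := by
  have hbound := fun (a : lp (fun _ : ℕ+ => ℝ) ⊤) => h.norm_partialSum_le h𝒩 hpq hr hy
    (a := a) (R := ‖a‖) fun i => lp.norm_apply_le_norm ENNReal.top_ne_zero a i
  have hlim : ∀ (a : lp (fun _ : ℕ+ => ℝ) ⊤) (x : X 𝒩),
      ∃ z, Filter.Tendsto (fun N => partialSum y a N x) Filter.atTop (nhds z) := fun a =>
    exists_tendsto_of_dense (hbound a) (D := Set.range ((↑) : C00 𝒩 → X 𝒩))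
      UniformSpace.Completion.denseRange_coe (by
        rintro _ ⟨v, rfl⟩
        obtain ⟨N₀, hN₀⟩ := h.apply_eq_zero hy v
        exact ⟨N₀, fun N hN => partialSum_apply_eq_of_le hN₀ hN⟩)
  choose L hL using hlim
  have huniq : ∀ (a : lp (fun _ : ℕ+ => ℝ) ⊤) (x z : X 𝒩), Filter.Tendsto (fun N => partialSum y a N x) Filter.atTop (nhds z) →
      L a x = z := fun a x z hz => tendsto_nhds_unique (hL a x) hz
  let B : lp (fun _ : ℕ+ => ℝ) ⊤ →ₗ[ℝ] X 𝒩 →ₗ[ℝ] X 𝒩 := LinearMap.mk₂ ℝ L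
    (fun a b x => huniq _ _ _ (((hL a x).add (hL b x)).congr fun N => by
      rw [partialSum_apply, partialSum_apply, partialSum_apply, ← Finset.sum_add_distrib]
      refine Finset.sum_congr rfl fun i _ => ?_
      rw [lp.coeFn_add, Pi.add_apply, add_mul, add_smul]))
    (fun c a x => huniq _ _ _ (((hL a x).const_smul c).congr fun N => by
      simp [partialSum_apply, Finset.smul_sum, mul_assoc, smul_smul]))
    (fun a x z => huniq _ _ _ (((hL a x).add (hL a z)).congr fun N => by simp))
    (fun c a x => huniq _ _ _ (((hL a x).const_smul c).congr fun N => by simp))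
  refine ⟨B.mkContinuous₂ 6 fun a x => ?_, hL⟩
  exact le_of_tendsto (hL a x).norm (Filter.Eventually.of_forall fun N => hbound a N x)

theorem apply_of_single {y : ℕ+ → X 𝒩 →L[ℝ] ℝ} {a : ℕ+ → ℝ} {x z : X 𝒩} {i : ℕ+}
    (hz : Filter.Tendsto (fun N => partialSum y a N x) Filter.atTop (nhds z))
    (hx : ∀ k, k ≠ i → y k x = 0) : z = (a i * y i x) • basisVec 𝒩 i := by
  refine tendsto_nhds_unique hz (tendsto_const_nhds.congr' ?_)
  filter_upwards [Filter.eventually_ge_atTop i] with N hN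
  rw [partialSum_apply, Finset.sum_eq_single i]
  · intro k _ hk
    rw [hx k hk, mul_zero, zero_smul]
  · intro hi
    exact absurd (Finset.mem_Icc.2 ⟨one_le, hN⟩) hi

theorem blockFunctional_apply_eq_zero {i l : ℕ+} (hl : l ∉ A i) : blockFunctional m A γ i l = 0 :=
  Finsupp.notMem_support_iff.1 fun h => hl (support_blockFunctional_subset i h)

theorem notMem_of_ne (h : IsBlockSystem m n f q 𝒩 A γ α g) {i k l : ℕ+} (hki : k ≠ i)
    (hl : l ∈ A i) : l ∉ A k := fun hl' => by
  rcases lt_or_gt_of_ne hki with hlt | hlt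
  · exact lt_irrefl _ (h.lt k i hlt l hl' l hl)
  · exact lt_irrefl _ (h.lt i k hlt l hl l hl')

theorem isBlock (hr : Rates m n f s) (h : IsBlockSystem m n f q 𝒩 A γ α g) :
    IsBlock (blockFunctional m A γ) := by
  refine ⟨fun i hi => ?_, fun i j hij a ha b hb => h.lt i j hij a
    (support_blockFunctional_subset i ha) b (support_blockFunctional_subset j hb)⟩
  obtain ⟨l, hl⟩ := h.nonempty i
  have h1 := DFunLike.congr_fun hi l
  have h2 : (γ i l : ℝ) ≠ 0 := by exact_mod_cast h.ne_zero i l hl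
  have h3 := hr.m_even ((i : ℕ) + 1) (by omega)
  have h4 : (0 : ℝ) < m (2 * ((i : ℕ) + 1)) := by
    exact_mod_cast (Nat.pow_pos (by norm_num)).trans_le h3
  rw [blockFunctional, Finsupp.smul_apply, ofFinset_apply, if_pos hl, smul_eq_mul] at h1
  exact (mul_ne_zero (one_div_pos.2 h4).ne' h2) h1

/-- The vectors `u i` of norm at most one on which the block functionals are large. -/
theorem exists_vectors (hr : Rates m n f s) (h : IsBlockSystem m n f q 𝒩 A γ α g)
    {y : ℕ+ → X 𝒩 →L[ℝ] ℝ}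
    (hy : ∀ i, ∀ v : C00 𝒩, y i v = pairing (blockFunctional m A γ i) (C00.coords v)) (i : ℕ+) :
    ∃ u : X 𝒩, ‖u‖ ≤ 1 ∧ 1 / 4 ≤ y i u ∧ ∀ k, k ≠ i → y k u = 0 := by
  set M : ℝ := (m (2 * ((i : ℕ) + 1)) : ℝ) with hM
  have h3 := hr.m_even ((i : ℕ) + 1) (by omega)
  have hM0 : (0 : ℝ) < m (2 * ((i : ℕ) + 1)) := by
    exact_mod_cast (Nat.pow_pos (by norm_num)).trans_le h3
  rw [← hM] at hM0
  -- The factor `M / 2` turns the bound `2 / M` on `𝒩` into norm at most one and cancels the weight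
  -- `1 / M` of the functional.
  set a : FinSeq := (M / 2) • ofFinset (A i) (α i) with ha
  have hsupp : a.support ⊆ A i := Finsupp.support_smul.trans (support_ofFinset_subset _ _)
  have hpair : ∀ x, pairing x a = M / 2 * ∑ l ∈ A i, x l * α i l := fun x => by
    rw [ha, pairing_smul, pairing_eq_sum_right _ _ (support_ofFinset_subset _ _)]
    congr 1
    exact Finset.sum_congr rfl fun l hl => by rw [ofFinset_apply, if_pos hl]
  have hya : ∀ k, y k (toX 𝒩 a) = pairing (blockFunctional m A γ k) a := fun k => hy k _
  refine ⟨toX 𝒩 a, norm_toX_le fun x hx => ?_, ?_, fun k hk => ?_⟩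
  · rw [hpair]
    calc M / 2 * ∑ l ∈ A i, x l * α i l ≤ M / 2 * (2 / M) := by
          have := h.sum_mul_le i x hx
          gcongr
      _ = 1 := by field_simp
  · rw [hya, hpair]
    have h1 : ∑ l ∈ A i, blockFunctional m A γ i l * α i l =
        1 / M * ∑ l ∈ A i, (γ i l : ℝ) * α i l := by
      rw [Finset.mul_sum]
      refine Finset.sum_congr rfl fun l hl => ?_
      rw [blockFunctional, Finsupp.smul_apply, ofFinset_apply, if_pos hl, smul_eq_mul, mul_assoc]
    rw [h1]
    have h2 := h.half_le i
    calc (1 / 4 : ℝ) = M / 2 * (1 / M * (1 / 2)) := by field_simp; norm_num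
      _ ≤ _ := by gcongr
  · rw [hya, hpair]
    rw [Finset.sum_eq_zero fun l hl => ?_, mul_zero]
    rw [blockFunctional_apply_eq_zero (h.notMem_of_ne hk hl), zero_mul]

end IsBlockSystem

end SchreierSpace

/-! ### The theorem: perturbations of scalars, strict singularity and the copy of `ℓ_∞` -/

theorem theorem3p1 (m n : ℕ → ℕ) (hmn : SchreierSpace.Conditions m n)
    (p q : ℝ) (hpq : p.HolderConjugate q)
    (𝒩 : SchreierSpace.NormingSet) (h𝒩 : SchreierSpace.IsSchreierNorming m n p q 𝒩) :
    ∃ (z : ℕ+ → SchreierSpace.FinSeq) (y : ℕ+ → SchreierSpace.X 𝒩 →L[ℝ] ℝ)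
      (T : SchreierSpace.X 𝒩 →L[ℝ] SchreierSpace.X 𝒩)
      (J : lp (fun _ : ℕ+ => ℝ) ⊤ →L[ℝ] (SchreierSpace.X 𝒩 →L[ℝ] SchreierSpace.X 𝒩)),
      -- `(y i)` is a block sequence of functionals belonging to the norming set
      (∀ i, z i ∈ 𝒩.carrier) ∧ SchreierSpace.IsBlock z ∧
      (∀ i k, y i (SchreierSpace.basisVec 𝒩 k) = z i k) ∧
      -- the operator `T = SOT-lim ∑ y i ⊗ e i`
      (∀ x, Filter.Tendsto
        (fun N : ℕ+ => ∑ i ∈ Finset.Icc 1 N, y i x • SchreierSpace.basisVec 𝒩 i)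
        Filter.atTop (nhds (T x))) ∧
      ¬ SchreierSpace.IsScalarPlusCompact T ∧
      (SchreierSpace.IsHI (SchreierSpace.X 𝒩) → SchreierSpace.IsStrictlySingular T) ∧
      -- the isomorphic embedding of `ℓ_∞`
      (∃ c : ℝ, 0 < c ∧ ∀ a, c * ‖a‖ ≤ ‖J a‖) ∧
      (∀ (a : lp (fun _ : ℕ+ => ℝ) ⊤) (x : SchreierSpace.X 𝒩), Filter.Tendsto
        (fun N : ℕ+ => ∑ i ∈ Finset.Icc 1 N, (a i * y i x) • SchreierSpace.basisVec 𝒩 i)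
        Filter.atTop (nhds (J a x))) := by
  classical
  obtain ⟨f, s, hr⟩ := hmn.exists_rates
  have hq := hpq.symm.pos
  obtain ⟨A, γ, α, g, h⟩ := SchreierSpace.exists_isBlockSystem h𝒩 hpq hr
  have hz := h.blockFunctional_mem h𝒩 hq hr
  choose y hy hy1 using fun i => SchreierSpace.exists_functional (hz i)
  have hye : ∀ i k, y i (SchreierSpace.basisVec 𝒩 k) =
      SchreierSpace.blockFunctional m A γ i k := fun i k => by
    refine (hy i _).trans ?_
    change SchreierSpace.pairing _ (Finsupp.single k 1) = _
    rw [SchreierSpace.pairing_eq_sum_right _ _ Finsupp.support_single_subset]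
    simp
  obtain ⟨J, hJ⟩ := h.exists_operators h𝒩 hpq hr hy
  choose u hu1 hu2 hu3 using h.exists_vectors hr hy
  let one : lp (fun _ : ℕ+ => ℝ) ⊤ := ⟨fun _ => 1, memℓp_infty ⟨1, by rintro _ ⟨i, rfl⟩; simp⟩⟩
  have hone : ∀ i, (one : ℕ+ → ℝ) i = 1 := fun i => rfl
  have hJu : ∀ a i, J a (u i) = (a i * y i (u i)) • SchreierSpace.basisVec 𝒩 i := fun a i =>
    SchreierSpace.IsBlockSystem.apply_of_single (hJ a (u i)) (hu3 i)
  have hTg : ∀ k, J one (SchreierSpace.basisVec 𝒩 (g k)) = 0 := fun k => by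
    have h0 : ∀ i, y i (SchreierSpace.basisVec 𝒩 (g k)) = 0 := fun i => by
      rw [hye, SchreierSpace.IsBlockSystem.blockFunctional_apply_eq_zero (h.notMem i k)]
    rw [SchreierSpace.IsBlockSystem.apply_of_single (i := 1) (hJ one _) fun i _ => h0 i, h0,
      mul_zero, zero_smul]
  refine ⟨SchreierSpace.blockFunctional m A γ, y, J one, J, hz, h.isBlock hr, hye,
    fun x => ?_, ?_, fun hHI => hHI.isStrictlySingular fun hfin => ?_,
    ⟨1 / 4, by norm_num, fun a => ?_⟩, fun a x => ?_⟩
  · simpa only [SchreierSpace.partialSum_apply, hone, one_mul] using hJ one x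
  · rintro ⟨c, K, hK, hT⟩
    have hTapp : ∀ x, J one x = c • x + K x := fun x => by rw [hT]; simp
    -- If `c = 0`, then `K = T` maps the bounded sequence `u_i` to multiples at least `1/4` of
    -- distinct unit vectors. If `c ≠ 0`, then `K = -c` on the basis vectors outside the blocks,
    -- which `T` kills. Both images are separated.
    rcases eq_or_ne c 0 with rfl | hc
    · refine SchreierSpace.not_isCompactOperator (u := fun k => u k.succPNat)
        (τ := fun k => k.succPNat) (b := fun k => y k.succPNat (u k.succPNat)) (R := 1)
        (r := 1 / 4) (fun k => hu1 _) (by norm_num) Nat.succPNat_injective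
        (fun k => (hu2 _).trans (le_abs_self _)) (fun k => ?_) hK
      have := hTapp (u k.succPNat)
      rw [zero_smul, zero_add] at this
      rw [← this, hJu, hone, one_mul]
    · refine SchreierSpace.not_isCompactOperator (u := fun k => SchreierSpace.basisVec 𝒩 (g k))
        (τ := g) (b := fun _ => -c) (R := 1) (r := |c|)
        (fun k => (SchreierSpace.norm_basisVec _).le) (abs_pos.2 hc) h.injective
        (fun k => (abs_neg c).ge) (fun k => ?_) hK
      have := hTapp (SchreierSpace.basisVec 𝒩 (g k))
      rw [hTg] at this
      rw [neg_smul]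
      exact (neg_eq_of_add_eq_zero_right this.symm).symm
  -- The basis vectors outside the blocks span an infinite-dimensional part of the kernel.
  · have hli : LinearIndependent ℝ fun k => (⟨SchreierSpace.basisVec 𝒩 (g k), hTg k⟩ :
        LinearMap.ker ((J one : SchreierSpace.X 𝒩 →L[ℝ] SchreierSpace.X 𝒩) :
          SchreierSpace.X 𝒩 →ₗ[ℝ] SchreierSpace.X 𝒩)) :=
      LinearIndependent.of_comp (Submodule.subtype _)
        (SchreierSpace.linearIndependent_basisVec.comp g h.injective)
    exact not_finite_iff_infinite.2 (inferInstance : Infinite ℕ) hli.finite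
  -- Evaluating `J a` at `u i` isolates the coordinate `a i`, up to the factor `y i (u i) ≥ 1/4`.
  · have h1 : ‖a‖ ≤ 4 * ‖J a‖ := lp.norm_le_of_forall_le (by positivity) fun i => by
      have h2 := (J a).le_opNorm_of_le (hu1 i)
      rw [hJu, norm_smul, SchreierSpace.norm_basisVec, mul_one, mul_one, norm_mul,
        Real.norm_eq_abs (y i (u i))] at h2
      have h3 : 1 / 4 ≤ |y i (u i)| := (hu2 i).trans (le_abs_self _)
      nlinarith [norm_nonneg (a i)]
    linarith
  · simpa only [SchreierSpace.partialSum_apply] using hJ a x
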